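/- Let $k\subset\mathbb C$ be an imaginary quadratic field of odd discriminant $-D$, let $n\ge 3$, and let $V$ be a hermitian space over $k$ of signature $(n-1,1)$, with hermitian form $\langle\cdot,\cdot\rangle$, $[x,y]=\mathrm{Tr}_{k/\mathbb Q}\langle x,y\rangle$ and $Q(x)=\langle x,x\rangle=\tfrac12[x,x]$. Let $L\subset V$ be an $\mathcal O_k$-lattice that is self-dual for $\langle\cdot,\cdot\rangle$, let $L'$ be its dual lattice with respect to $[\cdot,\cdot]$, and put $S_L=\mathbb C[L'/L]$ with standard basis $\phi_\mu$ ($\mu\in L'/L$). Let $\omega_L$ be the Weil representation of $\mathrm{SL}_2(\mathbb Z)$ on $S_L$ attached to the standard additive character of $\mathbb A/\mathbb Q$, i.e. the unique representation with $$\omega_L\begin{pmatrix}1&1\\0&1\end{pmatrix}\phi_\mu=e^{-2\pi iQ(\mu)}\phi_\mu,\qquad \omega_L\begin{pmatrix}0&-1\\1&0\end{pmatrix}\phi_\mu=\frac{\gamma}{\sqrt{|L'/L|}}\sum_{\nu\in L'/L}e^{2\pi i[\mu,\nu]}\phi_\nu,$$ where $\gamma=|L'/L|^{-1/2}\sum_{\lambda\in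 L'/L}e^{2\pi iQ(\lambda)}$ is the Weil index of $V\otimes\mathbb A_f$ (such a representation exists and is unique). Let $\chi_k$ be the quadratic Dirichlet character modulo $D$ of $k/\mathbb Q$, let $\chi=\chi_k^{n-2}$, and for $r\mid D$, $s=D/r$, write $\chi=\chi_r\chi_s$ with quadratic characters modulo $r$ and $s$. Let $f=\sum_{m\gg-\infty}c(m)q^m$ be a weakly holomorphic modular form of weight $2-n$, level $\Gamma_0(D)$ and character $\chi$ that is holomorphic at all cusps other than $\infty$. For $r\mid D$ choose $R_r=\begin{pmatrix}\alpha&\beta\\ s\gamma'&r\delta'\end{pmatrix}\in\Gamma_0(s)$, put $W_r=R_r\begin{pmatrix}r&0\\0&1\end{pmatrix}$, and define $c_r(m)$ by $$\chi_r(\beta)\chi_s(\alpha)\,(f|_{2-n}W_r)=\sum_{m\gg-\infty}c_r(m)q^m,$$ where $(f|_k M)(\tau)=\det(M)^{k/2}(c\tau+d)^{-k}f(M\tau)$; set $c_r(m)=c(m)=0$ for $m\in\mathbb Q\setminus\mathbb Z$. For a prime $p\mid D$ let $$\gamma_p=\epsilon_p^{-n}\,(D,p)_p^n\,(\det V,-D)_p,$$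 where $(\cdot,\cdot)_p$ is the Hilbert symbol, $\det V$ is the determinant of the hermitian form in a basis, and $\epsilon_p=1$ or $i$ according to $p\equiv1$ or $3\pmod 4$; let $\gamma_r=\prod_{p\mid r}\gamma_p$. For $\mu\in L'/L$ let $r_\mu$ be the product of the primes $p\mid D$ for which the $p$-component $\mu_p\in L'_p/L_p$ is nonzero. Then the induced form $$\tilde f(\tau)=\sum_{\gamma\in\Gamma_0(D)\backslash\mathrm{SL}_2(\mathbb Z)}(f|_{2-n}\gamma)(\tau)\cdot\omega_L(\gamma)^{-1}\phi_0$$ (for any choice of coset representatives) has a Fourier expansion $\tilde f=\sum_{m\in\mathbb Q,\ m\gg-\infty}\sum_{\mu\in L'/L}\tilde c(m,\mu)\,q^m\phi_\mu$, with $m$ of bounded denominator, and its coefficients satisfy, for all $m\in\mathbb Q$ and $\mu\in L'/L$: 1. $\tilde c(m,\mu)=\sum_{r_\mu\mid r\mid D}\gamma_r\,c_r(mr)$ if $m\equiv-Q(\mu)\pmod{\mathbb Z}$, and $\tilde c(m,\mu)=0$ otherwise; 2. if $m<0$, then $\tilde c(m,\mu)=c(m)$ if $\mu=0$, and $\tilde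 c(m,\mu)=0$ if $\mu\ne0$; 3. if $Q(\mu)\in\mathbb Z$, then $\tilde c(0,\mu)=\sum_{r_\mu\mid r\mid D}\gamma_r\,c_r(0)$. -/

import Mathlib

open scoped UpperHalfPlane MatrixGroups ModularForm Manifold NumberField Real

noncomputable section

namespace PromotedForm

/-- `e(z) = exp(2πiz)`. -/
def e (z : ℂ) : ℂ := Complex.exp (2 * π * Complex.I * z)

/-! ### Fourier expansions -/

/-- `g(τ) = ∑_{m ≫ -∞} a(m) q^m` for all `τ`, where `m` runs over `(1/N)ℤ`.  The coefficients are
indexed by all rational numbers and vanish outside `(1/N)ℤ`. -/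
structure IsQExpansion (N : ℕ) (g : ℍ → ℂ) (a : ℚ → ℂ) : Prop where
  support : ∀ m : ℚ, a m ≠ 0 → ∃ j : ℤ, m * N = j
  bounded_below : ∃ M : ℚ, ∀ m : ℚ, a m ≠ 0 → M ≤ m
  hasSum : ∀ τ : ℍ, HasSum (fun m : ℚ => a m * e ((m : ℂ) * (τ : ℂ))) (g τ)

/-! ### Characters and scalar valued weakly holomorphic forms -/

/-- Let `-D` be an odd negative fundamental discriminant.  The quadratic Dirichlet character of
`ℚ(√-D)` is `χ_k(a) = (-D/a) = (a/D)`, the Jacobi symbol modulo `D`.  This is the `r`-part `χ_r`,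
for `r ∣ D`, of `χ = χ_k^(n-2)`: the unique factorization `χ = χ_r χ_s` for `D = rs` is
`(a/D)^(n-2) = (a/r)^(n-2) (a/s)^(n-2)`.  The character `χ` itself is the case `r = D`. -/
def chi (n r : ℕ) (a : ℤ) : ℂ := ((jacobiSym a r : ℤ) : ℂ) ^ (n - 2)

/-- The weight `k` slash operator `det(M)^(k/2) (cτ+d)^(-k) f(Mτ)` of an integral matrix
`M = (a b; c d)` of positive determinant. -/
def slash (k : ℤ) (f : ℍ → ℂ) (M : Matrix (Fin 2) (Fin 2) ℤ) (τ : ℍ) : ℂ :=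
  (((M.det : ℝ) ^ ((k : ℝ) / 2) : ℝ) : ℂ) * ((M 1 0 : ℂ) * (τ : ℂ) + (M 1 1 : ℂ)) ^ (-k) *
    f (UpperHalfPlane.ofComplex
      (((M 0 0 : ℂ) * (τ : ℂ) + (M 0 1 : ℂ)) / ((M 1 0 : ℂ) * (τ : ℂ) + (M 1 1 : ℂ))))

/-- The space `M^{!,∞}_{2-n}(D, χ)`, with `χ = χ_k^(n-2)`: weakly holomorphic forms of weight
`2 - n`, level `Γ₀(D)` and character `χ` which are holomorphic at every cusp other than `∞`.
The cusp `γ∞` is `Γ₀(D)`-equivalent to `∞` exactly when `γ ∈ Γ₀(D)`. -/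
structure IsWeaklyHolomorphicForm (D n : ℕ) (f : ℍ → ℂ) : Prop where
  holomorphic : MDifferentiable 𝓘(ℂ) 𝓘(ℂ) f
  slash_eq : ∀ γ ∈ CongruenceSubgroup.Gamma0 D, f ∣[2 - (n : ℤ)] γ = chi n D (γ 1 1) • f
  meromorphic_at_cusps : ∀ γ : SL(2, ℤ), ∃ N : ℕ, 0 < N ∧ ∃ a : ℚ → ℂ,
    IsQExpansion N (f ∣[2 - (n : ℤ)] γ) a
  holomorphic_off_infinity : ∀ γ : SL(2, ℤ), γ ∉ CongruenceSubgroup.Gamma0 D →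
    ∃ N : ℕ, 0 < N ∧ ∃ a : ℚ → ℂ,
      IsQExpansion N (f ∣[2 - (n : ℤ)] γ) a ∧ ∀ m : ℚ, m < 0 → a m = 0

/-- `∑ c(m) q^m` is the `q`-expansion of `f` at the cusp `∞_r = r/D`, that is, the `q`-expansion of
`χ_r(β) χ_s(α) (f ∣_{2-n} W_r)`, where `s = D/r`, `R_r = (α β; sγ rδ) ∈ Γ₀(s)` and
`W_r = R_r (r 0; 0 1)`.  It does not depend on the choice of `R_r`. -/
def IsQExpansionAtCusp (D n : ℕ) (f : ℍ → ℂ) (r : ℕ) (c : ℚ → ℂ) : Prop :=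
  ∃ R : SL(2, ℤ), ((D / r : ℕ) : ℤ) ∣ R 1 0 ∧ (r : ℤ) ∣ R 1 1 ∧
    IsQExpansion 1
      (fun τ => chi n r (R 0 1) * chi n (D / r) (R 0 0) *
        slash (2 - (n : ℤ)) f
          ((R : Matrix (Fin 2) (Fin 2) ℤ) * !![(r : ℤ), 0; 0, 1]) τ) c

/-! ### Hermitian spaces and self-dual lattices -/

section Hermitian

variable {K : Type*} [Field K] [NumberField K] [StarRing K]
variable {V : Type*} [AddCommGroup V] [Module K V]

/-- The form `⟨x, y⟩`, linear in `x` and conjugate linear in `y`, has signature `(p, q)`;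
in particular `dim V = p + q`. -/
def HasSignature (ι : K →+* ℂ) (h : V →ₗ[K] V →ₛₗ[starRingEnd K] K) (p q : ℕ) : Prop :=
  ∃ b : Module.Basis (Fin p ⊕ Fin q) K V,
    (∀ i j, i ≠ j → h (b i) (b j) = 0) ∧
    (∀ i : Fin p, 0 < (ι (h (b (.inl i)) (b (.inl i)))).re) ∧
    (∀ j : Fin q, (ι (h (b (.inr j)) (b (.inr j)))).re < 0)

/-- `L` is an `𝓞 K`-lattice in `V`, self-dual with respect to the hermitian form. -/
structure IsSelfDualLattice (h : V →ₗ[K] V →ₛₗ[starRingEnd K] K) (L : AddSubgroup V) : Prop where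
  smul_mem : ∀ (a : 𝓞 K) (x : V), x ∈ L → (a : K) • x ∈ L
  fg : L.FG
  span_eq_top : Submodule.span K (L : Set V) = ⊤
  mem_iff : ∀ x : V, x ∈ L ↔ ∀ y ∈ L, IsIntegral ℤ (h x y)

/-- `[x, y] = Tr_{K/ℚ} ⟨x, y⟩`. -/
def bilin (h : V →ₗ[K] V →ₛₗ[starRingEnd K] K) (x y : V) : ℚ := Algebra.trace ℚ K (h x y)

/-- `Q(x) = ⟨x, x⟩ = [x, x] / 2`. -/
def quad (h : V →ₗ[K] V →ₛₗ[starRingEnd K] K) (x : V) : ℚ := bilin h x x / 2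

/-- The dual lattice `L'` of `L` with respect to `[·, ·]`. -/
def dualLattice (h : V →ₗ[K] V →ₛₗ[starRingEnd K] K) (L : AddSubgroup V) : AddSubgroup V where
  carrier := {x | ∀ y ∈ L, ∃ j : ℤ, bilin h x y = j}
  zero_mem' := fun y _ => ⟨0, by simp [bilin]⟩
  add_mem' := by
    intro x x' hx hx' y hy
    obtain ⟨j, hj⟩ := hx y hy
    obtain ⟨j', hj'⟩ := hx' y hy
    refine ⟨j + j', ?_⟩
    simp only [bilin] at hj hj' ⊢
    simp [hj, hj']
  neg_mem' := by
    intro x hx y hy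
    obtain ⟨j, hj⟩ := hx y hy
    refine ⟨-j, ?_⟩
    simp only [bilin] at hj ⊢
    simp [hj]

/-- The discriminant group `L'/L`. -/
abbrev DiscGroup (h : V →ₗ[K] V →ₛₗ[starRingEnd K] K) (L : AddSubgroup V) : Type _ :=
  (dualLattice h L) ⧸ (L.addSubgroupOf (dualLattice h L))

variable {h : V →ₗ[K] V →ₛₗ[starRingEnd K] K} {L : AddSubgroup V}

/-- `Q(μ)`, computed on a representative of `μ`; for self-dual `L` only its class modulo `ℤ`
matters, and that class does not depend on the representative. -/
def discQuad (μ : DiscGroup h L) : ℚ := quad h (μ.out : V)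

/-- `[μ, ν]`, computed on representatives; for self-dual `L` only its class modulo `ℤ`
matters, and that class does not depend on the representatives. -/
def discBilin (μ ν : DiscGroup h L) : ℚ := bilin h (μ.out : V) (ν.out : V)

/-! ### The Weil representation -/

variable (h L) in
/-- The Weil index of the quadratic space `V ⊗ 𝔸_f`, i.e. the product over all primes `p` of the
local Weil indices of `V ⊗ ℚ_p` with respect to `ψ_p`, as the normalized Gauss sum of the
discriminant form.  Here `ψ_f = ∏ ψ_p` is the finite part of the standard additive character
of `𝔸/ℚ`, so that `ψ_f(x) = e(-x)` for rational `x`. -/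
def weilIndex : ℂ :=
  ((√(Nat.card (DiscGroup h L) : ℝ) : ℝ) : ℂ)⁻¹ * ∑ᶠ μ : DiscGroup h L, e (discQuad μ)

/-- `ω` is the Weil representation `ω_L` of `SL₂(ℤ)` on `S_L = ℂ[L'/L]`, i.e. on functions on
`L'/L`.  With `T = (1 1; 0 1)` and `S = (0 -1; 1 0)` it is determined by
`ω(T)φ(x) = ψ_f(Q(x)) φ(x)` and `ω(S)φ(x) = γ ∫ ψ_f(-[x,y]) φ(y) dy`, where `γ` is the Weil index
and `dy` is the self-dual measure, which gives `L` the volume `|L'/L|^(-1/2)`.  The complex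
conjugate representation is the one that is usually called `ρ_L`. -/
structure IsWeilRepresentation (ω : Representation ℂ SL(2, ℤ) (DiscGroup h L → ℂ)) : Prop where
  map_T : ∀ (φ : DiscGroup h L → ℂ) (μ : DiscGroup h L),
    ω ModularGroup.T φ μ = e (-(discQuad μ : ℂ)) * φ μ
  map_S : ∀ (φ : DiscGroup h L → ℂ) (μ : DiscGroup h L),
    ω ModularGroup.S φ μ = weilIndex h L * ((√(Nat.card (DiscGroup h L) : ℝ) : ℝ) : ℂ)⁻¹ *
      ∑ᶠ ν : DiscGroup h L, e (discBilin μ ν) * φ ν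

open Classical in
/-- `φ_0`, the characteristic function of `0 ∈ L'/L`. -/
def phiZero : DiscGroup h L → ℂ := Pi.single 0 1

/-- `f̃(τ) = ∑_γ (f ∣_{2-n} γ)(τ) · ω(γ)⁻¹ φ_0`, summed over a set `R` of representatives `γ`
of `Γ₀(D) \ SL₂(ℤ)`. -/
def inducedForm (n : ℕ) (ω : Representation ℂ SL(2, ℤ) (DiscGroup h L → ℂ)) (f : ℍ → ℂ)
    (R : Finset SL(2, ℤ)) (τ : ℍ) : DiscGroup h L → ℂ :=
  ∑ γ ∈ R, (f ∣[2 - (n : ℤ)] γ) τ • ω γ⁻¹ phiZero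

open Classical in
/-- `r_μ`, the product of the primes `p ∣ D` with `μ_p ≠ 0`, where `μ_p ∈ L'_p/L_p` is the
`p`-component of `μ`: it vanishes if and only if `μ` is killed by an integer prime to `p`. -/
def rOf (D : ℕ) (μ : DiscGroup h L) : ℕ :=
  ∏ p ∈ D.primeFactors with ∀ t : ℕ, t.Coprime p → t • μ ≠ 0, p

/-! ### The constants `γ_r` -/

open Classical in
/-- The Hilbert symbol `(a, b)_p` of nonzero `a`, `b` in `ℚ_p`. -/
def hilbertSymbol (p : ℕ) [Fact p.Prime] (a b : ℚ_[p]) : ℤ :=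
  if ∃ x y z : ℚ_[p], (x ≠ 0 ∨ y ≠ 0 ∨ z ≠ 0) ∧ z ^ 2 = a * x ^ 2 + b * y ^ 2 then 1 else -1

variable (h) in
/-- The determinant of the Gram matrix of the hermitian form in the basis `b`.  It lies in `ℚ`,
and so it is recovered as half of its trace. -/
def gramDet {n : ℕ} (b : Module.Basis (Fin n) K V) : ℚ :=
  Algebra.trace ℚ K (Matrix.det (Matrix.of fun i j => h (b i) (b j))) / 2

variable (h) in
/-- The invariant `inv_p(V_p) = (det V, -D)_p`; it does not depend on the basis. -/
def localInvariant (D : ℕ) {n : ℕ} (b : Module.Basis (Fin n) K V) (p : ℕ) [Fact p.Prime] : ℤ :=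
  hilbertSymbol p ((gramDet h b : ℚ) : ℚ_[p]) (-(D : ℚ_[p]))

/-- `ε_p = 1` if `p ≡ 1 (mod 4)` and `ε_p = i` if `p ≡ 3 (mod 4)`. -/
def epsilon (p : ℕ) : ℂ := if p % 4 = 1 then 1 else Complex.I

variable (h) in
/-- `γ_p = ε_p^(-n) (D, p)_p^n inv_p(V_p)`. -/
def gammaPrime (D : ℕ) {n : ℕ} (b : Module.Basis (Fin n) K V) (p : ℕ) [Fact p.Prime] : ℂ :=
  (epsilon p ^ n)⁻¹ * ((hilbertSymbol p (D : ℚ_[p]) (p : ℚ_[p]) : ℤ) : ℂ) ^ n *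
    ((localInvariant h D b p : ℤ) : ℂ)

variable (h) in
/-- `γ_r = ∏_{p ∣ r} γ_p`. -/
def gammaDiv (D : ℕ) {n : ℕ} (b : Module.Basis (Fin n) K V) (r : ℕ) : ℂ :=
  ∏ p : {p : ℕ // p ∈ r.primeFactors},
    haveI : Fact (p : ℕ).Prime := ⟨Nat.prime_of_mem_primeFactors p.2⟩
    gammaPrime h D b (p : ℕ)

end Hermitian

end PromotedForm

end

/-!
Multiplication by `δ = √-D` maps `L'` onto `L`, and reducing the hermitian form of `L` modulo the
ramified primes identifies `L'/L` with `∏_{p ∣ D} 𝔽_p^n` in such a way that `e(Q(μ))` becomes a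
product of primitive additive characters of squares. In these coordinates `ω_L` is a tensor product
of the Weil representations of the groups `SL₂(𝔽_p)` on functions on `𝔽_p`, whose matrices are
explicit, with one Gauss sum for each factor. The sign of the quadratic Gauss sum, which comes from
the functional equation of the theta function, and the Hilbert symbols of `det V` turn the product
of the Gauss sums into `γ_r`.

Since `D` is squarefree, `Γ₀(D) \ SL₂(ℤ)` is represented by the matrices `R_r T^j` for `r ∣ D` and
`0 ≤ j < r`. For fixed `r`, the vector `ω_L(R_r)⁻¹ φ_0` is constant on the `μ` with `r_μ ∣ r` and
zero elsewhere, and summing over `j` projects the expansion of `f` at the cusp `∞_r` to the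
exponents `m ≡ -Q(μ)`. If `m < 0`, only the cusp `∞`, which is `r = 1`, contributes.
-/

noncomputable section

namespace PromotedForm

/-! ### Quadratic Gauss sums -/

section GaussSumSign

open Complex Filter Topology

lemma summable_exp_neg_mul_int_sq {c : ℝ} (hc : 0 < c) :
    Summable fun n : ℤ => Real.exp (-c * n ^ 2) := by
  refine (summable_pow_mul_jacobiTheta₂_term_bound 0 (T := c / π) (by positivity) 0).congr
    fun n => ?_
  rw [pow_zero, one_mul]
  congr 1
  field_simp
  ring

lemma tendsto_jacobiTheta₂_of_tendsto_im_atTop {α : Type*} {l : Filter α} {τ : α → ℂ} (x : ℝ)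
    (hτ : Tendsto (fun t => (τ t).im) l atTop) :
    Tendsto (fun t => jacobiTheta₂ x (τ t)) l (𝓝 1) := by
  have hlim : Tendsto (fun t => ∑' n : ℤ, jacobiTheta₂_term n x (τ t)) l
      (𝓝 (∑' n : ℤ, if n = 0 then (1 : ℂ) else 0)) := by
    refine tendsto_tsum_of_dominated_convergence (summable_exp_neg_mul_int_sq Real.pi_pos)
      (fun n => ?_) ?_
    · split_ifs with hn
      · simp [hn, jacobiTheta₂_term, tendsto_const_nhds]
      · rw [tendsto_zero_iff_norm_tendsto_zero]
        simp_rw [norm_jacobiTheta₂_term]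
        have hpos : (0 : ℝ) < π * n ^ 2 := by positivity
        exact Real.tendsto_exp_atBot.comp
          ((tendsto_neg_atTop_atBot.comp (hτ.const_mul_atTop hpos)).congr fun t => by simp)
    · filter_upwards [hτ.eventually_ge_atTop 1] with t ht n
      rw [norm_jacobiTheta₂_term, ofReal_im, mul_zero, sub_zero, Real.exp_le_exp]
      nlinarith [show 0 ≤ π * (n : ℝ) ^ 2 by positivity]
  rwa [tsum_ite_eq] at hlim

lemma cexp_rat_mul_sq_add_mul {a : ℕ} [NeZero a] {b : ℤ} (hab : Even (a * b)) (r k : ℤ) :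
    cexp (π * I * (b / a) * (a * k + r) ^ 2) = cexp (π * I * (b / a) * r ^ 2) := by
  have ha : (a : ℂ) ≠ 0 := NeZero.ne _
  obtain ⟨j, hj⟩ := hab
  have hjc : (a : ℂ) * b = j + j := mod_cast hj
  refine Complex.exp_eq_exp_iff_exists_int.mpr ⟨b * k * r + j * k ^ 2, ?_⟩
  push_cast
  field_simp
  linear_combination (a * k ^ 2 : ℂ) * hjc

/-- Grouping the theta series by residues modulo `a` leaves inner sums that are themselves theta
series, to which the functional equation applies. -/
lemma cpow_mul_jacobiTheta₂_rat_add {a : ℕ} [NeZero a] {b : ℤ} (hab : Even (a * b)) {w : ℂ}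
    (hw : 0 < w.im) :
    (-I * (a ^ 2 * w)) ^ (1 / 2 : ℂ) * jacobiTheta₂ 0 (b / a + w) =
      ∑ r : Fin a, cexp (π * I * (b / a) * (r : ℕ) ^ 2) *
        jacobiTheta₂ ((r : ℕ) / a : ℝ) (-1 / (a ^ 2 * w)) := by
  have ha : (a : ℂ) ≠ 0 := NeZero.ne _
  have hw0 : w ≠ 0 := by rintro rfl; simp at hw
  have him : 0 < ((b / a : ℝ) + w : ℂ).im := by simpa using hw
  have haw : 0 < ((a : ℂ) ^ 2 * w).im := by
    have : (0 : ℝ) < a := mod_cast Nat.pos_of_ne_zero (NeZero.ne a)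
    rw [← ofReal_natCast, ← ofReal_pow, im_ofReal_mul]
    positivity
  have hcpow : (-I * (a ^ 2 * w)) ^ (1 / 2 : ℂ) ≠ 0 := by
    simp [Complex.cpow_eq_zero_iff, hw0, ha]
  have hθ := (Equiv.hasSum_iff ((Equiv.prodComm (Fin a) ℤ).trans (Int.divModEquiv a).symm)).mpr
    (hasSum_jacobiTheta₂_term 0 (by push_cast at him; exact him))
  have hclass (r : Fin a) : HasSum
      (fun k : ℤ => jacobiTheta₂_term (k * a + (r : ℕ)) 0 (b / a + w))
      (1 / (-I * (a ^ 2 * w)) ^ (1 / 2 : ℂ) * (cexp (π * I * (b / a) * (r : ℕ) ^ 2) *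
        jacobiTheta₂ ((r : ℕ) / a : ℝ) (-1 / (a ^ 2 * w)))) := by
    have hcancel : cexp (π * I * w * (r : ℕ) ^ 2) *
        cexp (-π * I * (w * (r : ℕ) * a) ^ 2 / (a ^ 2 * w)) = 1 := by
      rw [← Complex.exp_add, ← Complex.exp_zero]
      congr 1
      field_simp
      ring
    convert (hasSum_jacobiTheta₂_term (w * (r : ℕ) * a) haw).mul_left
      (cexp (π * I * (b / a) * (r : ℕ) ^ 2) * cexp (π * I * w * (r : ℕ) ^ 2)) using 1
    · rfl
    · funext k
      have hper := cexp_rat_mul_sq_add_mul hab (r : ℕ) k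
      rw [Int.cast_natCast] at hper
      rw [← hper, ← Complex.exp_add, jacobiTheta₂_term, jacobiTheta₂_term, ← Complex.exp_add]
      congr 1
      push_cast
      ring
    · rw [jacobiTheta₂_functional_equation (w * (r : ℕ) * a),
        show w * (r : ℕ) * a / (a ^ 2 * w) = (((r : ℕ) / a : ℝ) : ℂ) by push_cast; field_simp]
      linear_combination -(1 / (-I * (a ^ 2 * w : ℂ)) ^ (1 / 2 : ℂ) *
        (cexp (π * I * (b / a) * (r : ℕ) ^ 2) *
          jacobiTheta₂ ((r : ℕ) / a : ℝ) (-1 / (a ^ 2 * w)))) * hcancel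
  rw [(hθ.prod_fiberwise hclass).unique (hasSum_fintype _), ← Finset.mul_sum, ← mul_assoc,
    mul_one_div_cancel hcpow, one_mul]

lemma tendsto_cpow_mul_jacobiTheta₂_rat_add {a : ℕ} [NeZero a] {b : ℤ} (hab : Even (a * b))
    {α : Type*} {l : Filter α} {w : α → ℂ} (hw : ∀ᶠ t in l, 0 < (w t).im)
    (hlim : Tendsto (fun t => (-1 / w t).im) l atTop) :
    Tendsto (fun t => (-I * (a ^ 2 * w t)) ^ (1 / 2 : ℂ) * jacobiTheta₂ 0 (b / a + w t)) l
      (𝓝 (∑ r : Fin a, cexp (π * I * (b / a) * (r : ℕ) ^ 2))) := by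
  have ha : (0 : ℝ) < a := mod_cast Nat.pos_of_ne_zero (NeZero.ne a)
  have him : Tendsto (fun t => (-1 / (a ^ 2 * w t)).im) l atTop := by
    refine (hlim.const_mul_atTop (inv_pos.mpr (pow_pos ha 2))).congr fun t => ?_
    rw [← im_ofReal_mul]
    push_cast
    rw [div_mul_eq_div_div_swap, div_eq_inv_mul _ ((a : ℂ) ^ 2)]
  have hsum : Tendsto (fun t => ∑ r : Fin a, cexp (π * I * (b / a) * (r : ℕ) ^ 2) *
      jacobiTheta₂ ((r : ℕ) / a : ℝ) (-1 / (a ^ 2 * w t))) l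
      (𝓝 (∑ r : Fin a, cexp (π * I * (b / a) * (r : ℕ) ^ 2) * 1)) :=
    tendsto_finsetSum _ fun r _ => (tendsto_jacobiTheta₂_of_tendsto_im_atTop _ him).const_mul _
  simp only [mul_one] at hsum
  exact hsum.congr' (hw.mono fun t ht => (cpow_mul_jacobiTheta₂_rat_add hab ht).symm)

lemma cpow_half_ofReal_mul {t : ℝ} (ht : 0 < t) {z : ℂ} (hz : z ≠ 0) :
    ((t : ℂ) * z) ^ (1 / 2 : ℂ) = (√t : ℝ) * z ^ (1 / 2 : ℂ) := by
  rw [Complex.cpow_def_of_ne_zero (mul_ne_zero (ofReal_ne_zero.mpr ht.ne') hz),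
    Complex.log_ofReal_mul ht hz, add_mul, Complex.exp_add, ← Complex.cpow_def_of_ne_zero hz,
    Real.sqrt_eq_rpow, Real.rpow_def_of_pos ht]
  push_cast
  rfl

lemma cpow_half_neg_I : (-I : ℂ) ^ (1 / 2 : ℂ) = (√2 / 2 : ℝ) * (1 - I) := by
  rw [Complex.cpow_def_of_ne_zero (by simp), Complex.log_neg_I,
    show -(π / 2 : ℂ) * I * (1 / 2) = ((-(π / 4) : ℝ) : ℂ) * I by push_cast; ring,
    Complex.exp_mul_I, ← Complex.ofReal_cos, ← Complex.ofReal_sin, Real.cos_neg, Real.sin_neg,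
    Real.cos_pi_div_four, Real.sin_pi_div_four]
  push_cast
  ring

lemma cpow_half_mul_jacobiTheta₂_functional_equation {a b : ℕ} [NeZero a] [NeZero b] {t : ℝ}
    (ht : 0 < t) :
    (-I * (a ^ 2 * (t * I))) ^ (1 / 2 : ℂ) * jacobiTheta₂ 0 (b / a + t * I) =
      a / ((-I * (b / a + t * I)) ^ (1 / 2 : ℂ) * (a * b / (b / a + t * I)) ^ (1 / 2 : ℂ)) *
        ((-I * (b ^ 2 * (-1 / (b / a + t * I) + a / b))) ^ (1 / 2 : ℂ) *
          jacobiTheta₂ 0 (-1 / (b / a + t * I))) := by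
  have ha : (a : ℂ) ≠ 0 := NeZero.ne _
  have hb : (b : ℂ) ≠ 0 := NeZero.ne _
  have hτ : (b / a + t * I : ℂ) ≠ 0 := fun h => ht.ne' <| by
    simpa [← ofReal_natCast, ← ofReal_div] using congrArg Complex.im h
  have hleft : (-I * (a ^ 2 * (t * I))) ^ (1 / 2 : ℂ) = (√t : ℝ) * a := by
    rw [show -I * (a ^ 2 * (t * I) : ℂ) = t * a ^ 2 by
        linear_combination (-a ^ 2 * t : ℂ) * I_sq,
      cpow_half_ofReal_mul ht (pow_ne_zero 2 ha), one_div, Complex.sq_cpow_two_inv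
        (by simpa using Nat.pos_of_ne_zero (NeZero.ne a))]
  have hright : (-I * (b ^ 2 * (-1 / (b / a + t * I) + a / b))) ^ (1 / 2 : ℂ) =
      (√t : ℝ) * (a * b / (b / a + t * I)) ^ (1 / 2 : ℂ) := by
    rw [← cpow_half_ofReal_mul ht (div_ne_zero (mul_ne_zero ha hb) hτ)]
    congr 1
    have : (a : ℂ) * (b / a + t * I) = b + a * t * I := by field_simp
    generalize (b / a + t * I : ℂ) = τ at *
    field_simp
    linear_combination (-I) * this - (a * t : ℂ) * I_sq
  have hcpow : (a * b / (b / a + t * I) : ℂ) ^ (1 / 2 : ℂ) ≠ 0 := by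
    simp [Complex.cpow_eq_zero_iff, ha, hb, hτ]
  rw [jacobiTheta₂_functional_equation 0 (b / a + t * I), hleft, hright, zero_div]
  simp only [ne_eq, OfNat.ofNat_ne_zero, not_false_eq_true, zero_pow, mul_zero, zero_div,
    Complex.exp_zero, mul_one]
  generalize (b / a + t * I : ℂ) = τ at *
  rw [mul_assoc (_ : ℂ) (a : ℂ)]
  field_simp

lemma rat_add_mul_I_im (a b : ℕ) (t : ℝ) : (b / a + t * I : ℂ).im = t := by
  simp [← ofReal_natCast, ← ofReal_div]

lemma tendsto_cpow_mul_jacobiTheta₂_neg_one_div {a b : ℕ} [NeZero a] [NeZero b]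
    (hab : Even (a * b)) :
    Tendsto (fun t : ℝ => (-I * (b ^ 2 * (-1 / (b / a + t * I) + a / b))) ^ (1 / 2 : ℂ) *
      jacobiTheta₂ 0 (-1 / (b / a + t * I))) (𝓝[>] 0)
      (𝓝 (∑ r : Fin b, cexp (π * I * (-a / b) * (r : ℕ) ^ 2))) := by
  have ha : (a : ℂ) ≠ 0 := NeZero.ne _
  have hb : (b : ℂ) ≠ 0 := NeZero.ne _
  have hpos : ∀ᶠ t : ℝ in 𝓝[>] 0, 0 < t := eventually_mem_nhdsWithin
  have hτ {t : ℝ} (ht : 0 < t) : (b / a + t * I : ℂ) ≠ 0 := fun h =>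
    ht.ne' ((rat_add_mul_I_im a b t).symm.trans (congrArg im h))
  have him : ∀ᶠ t : ℝ in 𝓝[>] 0, 0 < (-1 / (b / a + t * I) + a / b : ℂ).im := by
    refine hpos.mono fun t ht => ?_
    have := div_neg_of_neg_of_pos (neg_lt_zero.mpr ht) (Complex.normSq_pos.mpr (hτ ht))
    simpa [div_im, rat_add_mul_I_im, ← ofReal_natCast, ← ofReal_div] using this
  have hinv : ∀ᶠ t : ℝ in 𝓝[>] 0,
      (b / a : ℝ) ^ 2 * t⁻¹ = (-1 / (-1 / (b / a + t * I) + a / b : ℂ)).im := by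
    refine hpos.mono fun t ht => ?_
    have hτt := hτ ht
    have htc : (t : ℂ) ≠ 0 := ofReal_ne_zero.mpr ht.ne'
    have hw : -1 / (b / a + t * I) + a / b = a * t * I / (b * (b / a + t * I)) := by
      have : (a : ℂ) * (b / a + t * I) = b + a * t * I := by field_simp
      generalize (b / a + t * I : ℂ) = τ at *
      field_simp
      linear_combination this
    have hneg : -1 / (-1 / (b / a + t * I) + a / b) =
        ((-b / a : ℝ) : ℂ) + (((b / a : ℝ) ^ 2 * t⁻¹ : ℝ) : ℂ) * I := by
      rw [hw, div_div_eq_mul_div]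
      push_cast
      field_simp
      linear_combination (-b : ℂ) * I_sq
    simp [hneg, -ofReal_div, -ofReal_mul]
  have hlim := tendsto_cpow_mul_jacobiTheta₂_rat_add (a := b) (b := -a) (by
    rw [mul_neg, even_neg, mul_comm]; exact_mod_cast hab) him
    ((tendsto_inv_nhdsGT_zero.const_mul_atTop (pow_pos (div_pos
      (mod_cast Nat.pos_of_ne_zero (NeZero.ne b)) (mod_cast Nat.pos_of_ne_zero (NeZero.ne a)))
      2)).congr' hinv)
  push_cast at hlim
  refine hlim.congr fun t => ?_
  rw [add_left_comm, neg_div (b : ℂ) (a : ℂ), neg_add_cancel, add_zero]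

/-- The Landsberg–Schaar relation compares the leading terms of the two sides of the functional
equation of `θ` as `τ` tends to `b / a`. -/
theorem landsberg_schaar {a b : ℕ} [NeZero a] [NeZero b] (hab : Even (a * b)) :
    ∑ r : Fin a, cexp (π * I * (b / a) * (r : ℕ) ^ 2) =
      1 / (-I * (b / a)) ^ (1 / 2 : ℂ) *
        ∑ r : Fin b, cexp (π * I * (-a / b) * (r : ℕ) ^ 2) := by
  have ha : (a : ℂ) ≠ 0 := NeZero.ne _
  have hb : (b : ℂ) ≠ 0 := NeZero.ne _
  have ha_pos : (0 : ℝ) < a := mod_cast Nat.pos_of_ne_zero (NeZero.ne a)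
  have hpos : ∀ᶠ t : ℝ in 𝓝[>] 0, 0 < t := eventually_mem_nhdsWithin
  have hleft := tendsto_cpow_mul_jacobiTheta₂_rat_add (a := a) (b := b) (by exact_mod_cast hab)
    (l := 𝓝[>] 0) (w := fun t : ℝ => t * I) (by simpa using hpos)
    (tendsto_inv_nhdsGT_zero.congr fun t => by simp [div_mul_eq_div_div_swap])
  have hτ : Tendsto (fun t : ℝ => (b / a + t * I : ℂ)) (𝓝[>] 0) (𝓝 (b / a)) := by
    have : Continuous fun t : ℝ => (b / a + t * I : ℂ) := by fun_prop
    simpa using (this.tendsto 0).mono_left nhdsWithin_le_nhds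
  have hdiv : (a * b / (b / a) : ℂ) = a ^ 2 := by field_simp
  have hfactor : Tendsto (fun t : ℝ => a / ((-I * (b / a + t * I)) ^ (1 / 2 : ℂ) *
      (a * b / (b / a + t * I)) ^ (1 / 2 : ℂ))) (𝓝[>] 0)
      (𝓝 (a / ((-I * (b / a)) ^ (1 / 2 : ℂ) * (a * b / (b / a)) ^ (1 / 2 : ℂ)))) := by
    refine tendsto_const_nhds.div (((hτ.const_mul _).cpow tendsto_const_nhds ?_).mul
      ((tendsto_const_nhds.div hτ (div_ne_zero hb ha)).cpow tendsto_const_nhds ?_)) ?_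
    · right
      rw [← ofReal_natCast, ← ofReal_natCast, ← ofReal_div, im_mul_ofReal]
      simpa using ⟨NeZero.ne b, NeZero.ne a⟩
    · left
      rw [hdiv]
      exact_mod_cast pow_pos ha_pos 2
    · simp [Complex.cpow_eq_zero_iff, ha, hb]
  have hroot : (a * b / (b / a) : ℂ) ^ (1 / 2 : ℂ) = a := by
    rw [hdiv, one_div, Complex.sq_cpow_two_inv (by exact_mod_cast ha_pos)]
  have hright := hfactor.mul (tendsto_cpow_mul_jacobiTheta₂_neg_one_div hab)
  rw [hroot, div_mul_cancel_right₀ ha, ← one_div] at hright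
  exact tendsto_nhds_unique (hleft.congr' <| hpos.mono fun t ht =>
    cpow_half_mul_jacobiTheta₂_functional_equation ht) hright

lemma cexp_neg_half_mul_odd {p : ℕ} (hp : Odd p) :
    cexp (π * I * (-p / 2)) = if p % 4 = 1 then -I else I := by
  rw [Nat.odd_iff] at hp
  rcases (by lia : p % 4 = 1 ∨ p % 4 = 3) with hmod | hmod
  · obtain ⟨k, rfl⟩ : ∃ k, p = 4 * k + 1 := ⟨p / 4, by lia⟩
    rw [if_pos hmod, ← Complex.exp_neg_pi_div_two_mul_I, Complex.exp_eq_exp_iff_exists_int]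
    exact ⟨-k, by push_cast; ring⟩
  · obtain ⟨k, rfl⟩ : ∃ k, p = 4 * k + 3 := ⟨p / 4, by lia⟩
    rw [if_neg (by lia)]
    conv_rhs => rw [← Complex.exp_pi_div_two_mul_I]
    rw [Complex.exp_eq_exp_iff_exists_int]
    exact ⟨-k - 1, by push_cast; ring⟩

lemma sum_cexp_two_div_mul_sq {p : ℕ} (hp : Odd p) :
    ∑ r : Fin p, cexp (π * I * (2 / p) * (r : ℕ) ^ 2) =
      (√p : ℝ) * epsilon p := by
  have hp0 : p ≠ 0 := hp.pos.ne'
  have : NeZero p := ⟨hp0⟩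
  have hsqrt : ((√p : ℝ) : ℂ) ≠ 0 := mod_cast (Real.sqrt_pos.mpr (mod_cast hp.pos)).ne'
  have hI : (1 - I : ℂ) ≠ 0 := fun h => by simpa using congrArg Complex.im h
  have hroot : (-I * (2 / p) : ℂ) ^ (1 / 2 : ℂ) = (1 - I) / (√p : ℝ) := by
    rw [show -I * (2 / p : ℂ) = ((2 / p : ℝ) : ℂ) * (-I) by push_cast; ring,
      cpow_half_ofReal_mul (div_pos two_pos (mod_cast hp.pos)) (by simp), cpow_half_neg_I,
      ← mul_assoc, ← ofReal_mul, Real.sqrt_div zero_le_two,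
      show √2 / √p * (√2 / 2) = (√2 * √2) / 2 / √p by ring, Real.mul_self_sqrt zero_le_two]
    push_cast
    ring
  have hrel := landsberg_schaar (a := p) (b := 2) (even_two.mul_left p)
  push_cast at hrel
  rw [hrel, hroot, Fin.sum_univ_two]
  simp only [Fin.val_zero, Fin.val_one, Nat.cast_zero, Nat.cast_one, one_pow, mul_one,
    zero_pow two_ne_zero, mul_zero, Complex.exp_zero, cexp_neg_half_mul_odd hp, epsilon]
  split_ifs
  · field_simp
    ring
  · field_simp
    linear_combination I_sq

theorem sum_stdAddChar_sq {p : ℕ} [NeZero p] (hp : Odd p) :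
    ∑ x : ZMod p, ZMod.stdAddChar (x ^ 2) = (√p : ℝ) * epsilon p := by
  rw [← sum_cexp_two_div_mul_sq hp]
  obtain ⟨k, rfl⟩ : ∃ k, p = k + 1 := Nat.exists_eq_succ_of_ne_zero (NeZero.ne p)
  refine Finset.sum_congr rfl fun r _ => ?_
  have hcast : r ^ 2 = (((ZMod.val r : ℕ) ^ 2 : ℤ) : ZMod (k + 1)) := by simp
  rw [hcast, ZMod.stdAddChar_coe]
  congr 1
  push_cast
  rw [ZMod.val]
  ring

end GaussSumSign

/-! ### The Weil representation of `SL₂` of a finite field -/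

section LocalWeil

variable {F : Type*} [Field F] [Fintype F] [DecidableEq F]

variable (F) in
/-- The quadratic character of a finite field, with complex values. -/
def quadChar : MulChar F ℂ := (quadraticChar F).ringHomComp (Int.castRingHom ℂ)

lemma quadChar_apply (t : F) : quadChar F t = (quadraticChar F t : ℂ) := rfl

lemma quadChar_mul_self {t : F} (ht : t ≠ 0) : quadChar F t * quadChar F t = 1 := by
  rw [quadChar_apply, ← Int.cast_mul, ← sq, quadraticChar_sq_one ht, Int.cast_one]

lemma quadChar_inv (t : F) : quadChar F t⁻¹ = quadChar F t := by
  rcases eq_or_ne t 0 with rfl | ht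
  · rw [inv_zero]
  · exact mul_right_cancel₀ (b := quadChar F t) (left_ne_zero_of_mul_eq_one (quadChar_mul_self ht))
      (by rw [← map_mul, inv_mul_cancel₀ ht, map_one, quadChar_mul_self ht])

lemma quadChar_div (s t : F) : quadChar F (s / t) = quadChar F s * quadChar F t := by
  rw [div_eq_mul_inv, map_mul, quadChar_inv]

lemma quadChar_isQuadratic : (quadChar F).IsQuadratic := (quadraticChar_isQuadratic F).comp _

lemma quadChar_ne_one (hF : ringChar F ≠ 2) : quadChar F ≠ 1 :=
  (MulChar.ringHomComp_ne_one_iff (RingHom.injective_int (Int.castRingHom ℂ))).mpr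
    (quadraticChar_ne_one hF)

/-- The quadratic Gauss sum attached to an additive character of a finite field. -/
def quadGauss (ψ : AddChar F ℂ) : ℂ := ∑ x, ψ (x ^ 2)

lemma sum_comp_sq (hF : ringChar F ≠ 2) (f : F → ℂ) :
    ∑ x, f (x ^ 2) = ∑ t, (1 + quadChar F t) * f t := by
  rw [← Finset.sum_fiberwise_of_maps_to (s := Finset.univ) (t := Finset.univ)
    (g := fun x : F => x ^ 2) (fun _ _ => Finset.mem_univ _)]
  refine Finset.sum_congr rfl fun t _ => ?_
  rw [Finset.sum_congr rfl (g := fun _ => f t)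
    (fun x hx => by rw [(Finset.mem_filter.mp hx).2]), Finset.sum_const, nsmul_eq_mul]
  congr 1
  rw [quadChar_apply, add_comm, ← Int.cast_one, ← Int.cast_add, ← quadraticChar_card_sqrts hF t,
    Int.cast_natCast]
  congr 2
  ext x
  simp

variable {ψ : AddChar F ℂ}

lemma sum_addChar_mul_sq_eq_gaussSum (hF : ringChar F ≠ 2) (hψ : ψ.IsPrimitive) {t : F}
    (ht : t ≠ 0) : ∑ x, ψ (t * x ^ 2) = quadChar F t * gaussSum (quadChar F) ψ := by
  have horth : ∑ x, ψ (t * x) = 0 := by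
    simpa [ht, mul_comm] using AddChar.sum_mulShift t hψ
  have hshift := gaussSum_mulShift (quadChar F) ψ (Units.mk0 t ht)
  rw [Units.val_mk0] at hshift
  rw [sum_comp_sq hF (fun x => ψ (t * x)), ← hshift, ← mul_assoc, quadChar_mul_self ht, one_mul]
  simp_rw [add_mul, one_mul]
  rw [Finset.sum_add_distrib, horth, zero_add]
  rfl

lemma quadGauss_eq_gaussSum (hF : ringChar F ≠ 2) (hψ : ψ.IsPrimitive) :
    quadGauss ψ = gaussSum (quadChar F) ψ := by
  simpa [quadGauss] using sum_addChar_mul_sq_eq_gaussSum hF hψ one_ne_zero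

lemma sum_addChar_mul_sq (hF : ringChar F ≠ 2) (hψ : ψ.IsPrimitive) {t : F} (ht : t ≠ 0) :
    ∑ x, ψ (t * x ^ 2) = quadChar F t * quadGauss ψ := by
  rw [quadGauss_eq_gaussSum hF hψ, sum_addChar_mul_sq_eq_gaussSum hF hψ ht]

lemma quadGauss_sq (hF : ringChar F ≠ 2) (hψ : ψ.IsPrimitive) :
    quadGauss ψ ^ 2 = quadChar F (-1) * Fintype.card F := by
  rw [quadGauss_eq_gaussSum hF hψ, gaussSum_sq (quadChar_ne_one hF) quadChar_isQuadratic hψ]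

/-- The matrix of the Weil representation of `SL₂(F)` attached to the form `x²` and the character
`ψ⁻¹`. -/
def localKernel (ψ : AddChar F ℂ) (g : SL(2, F)) : Matrix F F ℂ := Matrix.of fun x y =>
  if g 1 0 = 0 then
    if y = g 0 0 * x then quadChar F (g 0 0) * ψ (-(g 0 0 * g 0 1 * x ^ 2)) else 0
  else quadChar F (g 1 0) * (quadGauss ψ / Fintype.card F) *
    ψ ((2 * x * y - g 0 0 * x ^ 2 - g 1 1 * y ^ 2) / g 1 0)

lemma localKernel_apply_of_eq_zero {g : SL(2, F)} (hg : g 1 0 = 0) (x y : F) :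
    localKernel ψ g x y =
      if y = g 0 0 * x then quadChar F (g 0 0) * ψ (-(g 0 0 * g 0 1 * x ^ 2)) else 0 :=
  if_pos hg

lemma localKernel_apply_of_ne_zero {g : SL(2, F)} (hg : g 1 0 ≠ 0) (x y : F) :
    localKernel ψ g x y = quadChar F (g 1 0) * (quadGauss ψ / Fintype.card F) *
      ψ ((2 * x * y - g 0 0 * x ^ 2 - g 1 1 * y ^ 2) / g 1 0) :=
  if_neg hg

lemma localKernel_one : localKernel ψ 1 = 1 := by
  ext x y
  rw [localKernel_apply_of_eq_zero (by simp)]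
  simp [Matrix.one_apply, eq_comm]

lemma sl2_mul_apply {R : Type*} [CommRing R] (g h : SL(2, R)) (i j : Fin 2) :
    (g * h) i j = g i 0 * h 0 j + g i 1 * h 1 j := by
  simp [Matrix.mul_apply]

lemma sl2_det {R : Type*} [CommRing R] (g : SL(2, R)) :
    g 0 0 * g 1 1 - g 0 1 * g 1 0 = 1 := by
  rw [← Matrix.det_fin_two, g.det_coe]

lemma localKernel_mul_of_left_eq_zero {g h : SL(2, F)} (hg : g 1 0 = 0) :
    localKernel ψ (g * h) = localKernel ψ g * localKernel ψ h := by
  have hdet := sl2_det g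
  have hdet' := sl2_det h
  rw [hg, mul_zero, sub_zero] at hdet
  have ha : g 0 0 ≠ 0 := left_ne_zero_of_mul_eq_one hdet
  have hd : g 1 1 = (g 0 0)⁻¹ := eq_inv_of_mul_eq_one_right hdet
  ext x z
  have hsum : (localKernel ψ g * localKernel ψ h) x z =
      quadChar F (g 0 0) * ψ (-(g 0 0 * g 0 1 * x ^ 2)) * localKernel ψ h (g 0 0 * x) z := by
    simp [Matrix.mul_apply, localKernel_apply_of_eq_zero hg]
  rw [hsum]
  by_cases hh : h 1 0 = 0
  · rw [hh, mul_zero, sub_zero] at hdet'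
    rw [localKernel_apply_of_eq_zero hh, localKernel_apply_of_eq_zero (by simp [sl2_mul_apply, *]),
      sl2_mul_apply, sl2_mul_apply, hh, mul_zero, add_zero, ← mul_assoc, mul_comm (h 0 0), mul_ite,
      mul_zero, mul_mul_mul_comm, ← map_mul, ← AddChar.map_add_eq_mul]
    congr 3
    linear_combination (-(g 0 0 * g 0 1 * x ^ 2)) * hdet'
  · rw [localKernel_apply_of_ne_zero hh, localKernel_apply_of_ne_zero (by simp [sl2_mul_apply, *]),
      sl2_mul_apply, sl2_mul_apply, sl2_mul_apply, hg, hd, zero_mul, zero_add, zero_mul, zero_add,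
      map_mul, quadChar_inv, mul_mul_mul_comm, ← AddChar.map_add_eq_mul, mul_assoc (quadChar F _)]
    congr 2
    field_simp
    ring

lemma localKernel_mul_of_right_eq_zero {g h : SL(2, F)} (hg : g 1 0 ≠ 0) (hh : h 1 0 = 0) :
    localKernel ψ (g * h) = localKernel ψ g * localKernel ψ h := by
  have hdet := sl2_det h
  rw [hh, mul_zero, sub_zero] at hdet
  have ha : h 0 0 ≠ 0 := left_ne_zero_of_mul_eq_one hdet
  have hd : h 1 1 = (h 0 0)⁻¹ := eq_inv_of_mul_eq_one_right hdet
  ext x z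
  have hiff (y : F) : z = h 0 0 * y ↔ y = z / h 0 0 := by
    rw [eq_div_iff ha, mul_comm y, eq_comm]
  rw [Matrix.mul_apply]
  simp_rw [localKernel_apply_of_eq_zero hh, hiff, mul_ite, mul_zero]
  rw [Finset.sum_ite_eq' Finset.univ, if_pos (Finset.mem_univ _),
    localKernel_apply_of_ne_zero hg, localKernel_apply_of_ne_zero (by simp [sl2_mul_apply, *]),
    sl2_mul_apply, sl2_mul_apply, sl2_mul_apply, hh, mul_zero, add_zero, mul_zero, add_zero,
    hd, map_mul, mul_mul_mul_comm, ← AddChar.map_add_eq_mul, mul_right_comm (quadChar F _)]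
  congr 2
  field_simp
  ring

lemma localKernel_mul_apply_of_ne_zero {g h : SL(2, F)} (hg : g 1 0 ≠ 0) (hh : h 1 0 ≠ 0)
    (x z : F) :
    (localKernel ψ g * localKernel ψ h) x z =
      quadChar F (g 1 0 * h 1 0) * (quadGauss ψ / Fintype.card F) ^ 2 *
        ψ (-(g 0 0 / g 1 0 * x ^ 2) - h 1 1 / h 1 0 * z ^ 2) *
        ∑ y, ψ (-((g * h) 1 0 / (g 1 0 * h 1 0)) * y ^ 2 +
          y * (2 * (x / g 1 0 + z / h 1 0))) := by
  rw [Matrix.mul_apply, Finset.mul_sum]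
  refine Finset.sum_congr rfl fun y _ => ?_
  rw [localKernel_apply_of_ne_zero hg, localKernel_apply_of_ne_zero hh, mul_mul_mul_comm,
    ← AddChar.map_add_eq_mul, mul_assoc _ (ψ _), ← AddChar.map_add_eq_mul, mul_mul_mul_comm,
    ← map_mul, ← sq, sl2_mul_apply]
  congr 2
  field_simp
  ring

lemma localKernel_mul_of_mul_eq_zero (hF : ringChar F ≠ 2) (hψ : ψ.IsPrimitive) {g h : SL(2, F)}
    (hg : g 1 0 ≠ 0) (hh : h 1 0 ≠ 0) (hgh : (g * h) 1 0 = 0) :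
    localKernel ψ (g * h) = localKernel ψ g * localKernel ψ h := by
  have h2 : (2 : F) ≠ 0 := Ring.two_ne_zero hF
  have hq : (Fintype.card F : ℂ) ≠ 0 := Nat.cast_ne_zero.mpr Fintype.card_ne_zero
  have hdet := sl2_det g
  have hdet' := sl2_det h
  have hc := hgh
  rw [sl2_mul_apply] at hc
  have ha : (g * h) 0 0 = -(h 1 0 / g 1 0) := by
    rw [sl2_mul_apply]
    field_simp
    linear_combination g 0 0 * hc - h 1 0 * hdet
  ext x z
  rw [localKernel_mul_apply_of_ne_zero hg hh, localKernel_apply_of_eq_zero hgh, hgh, ha]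
  simp_rw [zero_div, neg_zero, zero_mul, zero_add]
  rw [AddChar.sum_mulShift _ hψ]
  have hiff : z = -(h 1 0 / g 1 0) * x ↔ 2 * (x / g 1 0 + z / h 1 0) = 0 := by
    rw [mul_eq_zero_iff_left h2]
    field_simp
    grind
  by_cases hz : z = -(h 1 0 / g 1 0) * x
  · have harg : -(-(h 1 0 / g 1 0) * (g * h) 0 1 * x ^ 2) =
        -(g 0 0 / g 1 0 * x ^ 2) - h 1 1 / h 1 0 * (-(h 1 0 / g 1 0) * x) ^ 2 := by
      rw [sl2_mul_apply]
      field_simp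
      linear_combination g 0 0 * h 1 1 * x ^ 2 * hc - h 1 0 * h 1 1 * x ^ 2 * hdet -
        g 1 0 * g 0 0 * x ^ 2 * hdet'
    rw [if_pos hz, if_pos (hiff.mp hz), hz, harg, div_pow, quadGauss_sq hF hψ,
      ← neg_one_mul (_ / _), map_mul, quadChar_div, map_mul]
    field_simp
  · rw [if_neg hz, if_neg (hiff.not.mp hz), Nat.cast_zero, mul_zero]

lemma sum_addChar_quadratic (hF : ringChar F ≠ 2) (hψ : ψ.IsPrimitive) {t : F} (ht : t ≠ 0)
    (u : F) : ∑ y, ψ (t * y ^ 2 + y * (2 * u)) = quadChar F t * quadGauss ψ * ψ (-(u ^ 2 / t)) := by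
  rw [← sum_addChar_mul_sq hF hψ ht, Finset.sum_mul,
    ← Equiv.sum_comp (Equiv.addRight (u / t)) fun y => ψ (t * y ^ 2) * _]
  refine Finset.sum_congr rfl fun y _ => ?_
  rw [← AddChar.map_add_eq_mul, Equiv.coe_addRight]
  congr 1
  field_simp
  ring

lemma localKernel_mul_of_mul_ne_zero (hF : ringChar F ≠ 2) (hψ : ψ.IsPrimitive) {g h : SL(2, F)}
    (hg : g 1 0 ≠ 0) (hh : h 1 0 ≠ 0) (hgh : (g * h) 1 0 ≠ 0) :
    localKernel ψ (g * h) = localKernel ψ g * localKernel ψ h := by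
  have hq : (Fintype.card F : ℂ) ≠ 0 := Nat.cast_ne_zero.mpr Fintype.card_ne_zero
  have hdet := sl2_det g
  have hdet' := sl2_det h
  have ht : -((g * h) 1 0 / (g 1 0 * h 1 0)) ≠ 0 :=
    neg_ne_zero.mpr (div_ne_zero hgh (mul_ne_zero hg hh))
  ext x z
  rw [localKernel_mul_apply_of_ne_zero hg hh, localKernel_apply_of_ne_zero hgh,
    sum_addChar_quadratic hF hψ ht]
  have harg : (2 * x * z - (g * h) 0 0 * x ^ 2 - (g * h) 1 1 * z ^ 2) / (g * h) 1 0 =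
      -(g 0 0 / g 1 0 * x ^ 2) - h 1 1 / h 1 0 * z ^ 2 +
        -((x / g 1 0 + z / h 1 0) ^ 2 / -((g * h) 1 0 / (g 1 0 * h 1 0))) := by
    field_simp
    simp only [sl2_mul_apply]
    linear_combination x ^ 2 * h 1 0 ^ 2 * hdet + z ^ 2 * g 1 0 ^ 2 * hdet'
  have hchar : quadChar F (-((g * h) 1 0 / (g 1 0 * h 1 0))) =
      quadChar F (-1) * (quadChar F ((g * h) 1 0) * quadChar F (g 1 0 * h 1 0)) := by
    rw [← neg_one_mul, map_mul, quadChar_div]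
  have hgauss : quadGauss ψ ^ 2 * quadChar F (-1) = Fintype.card F := by
    rw [quadGauss_sq hF hψ, mul_right_comm, quadChar_mul_self (neg_ne_zero.mpr one_ne_zero),
      one_mul]
  rw [harg, AddChar.map_add_eq_mul, hchar]
  have hsq := quadChar_mul_self (mul_ne_zero hg hh)
  generalize ψ (-((x / g 1 0 + z / h 1 0) ^ 2 / _)) = Φ
  generalize ψ (-(g 0 0 / g 1 0 * x ^ 2) - h 1 1 / h 1 0 * z ^ 2) = Ψ
  field_simp
  linear_combination (-(quadChar F ((g * h) 1 0) * quadGauss ψ * Ψ * Φ)) *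
    (quadChar F (g 1 0 * h 1 0) ^ 2 * hgauss + Fintype.card F * hsq)

lemma localKernel_mul (hF : ringChar F ≠ 2) (hψ : ψ.IsPrimitive) (g h : SL(2, F)) :
    localKernel ψ (g * h) = localKernel ψ g * localKernel ψ h := by
  by_cases hg : g 1 0 = 0
  · exact localKernel_mul_of_left_eq_zero hg
  by_cases hh : h 1 0 = 0
  · exact localKernel_mul_of_right_eq_zero hg hh
  by_cases hgh : (g * h) 1 0 = 0
  · exact localKernel_mul_of_mul_eq_zero hF hψ hg hh hgh
  · exact localKernel_mul_of_mul_ne_zero hF hψ hg hh hgh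

lemma localKernel_inv_apply_zero_of_lower_left_eq_zero {g : SL(2, F)} (hg : g 1 0 = 0) (x : F) :
    localKernel ψ g⁻¹ x 0 = if x = 0 then quadChar F (g 0 0) else 0 := by
  have hdet := sl2_det g
  rw [hg, mul_zero, sub_zero] at hdet
  have hd : g 1 1 = (g 0 0)⁻¹ := eq_inv_of_mul_eq_one_right hdet
  have ha : g 0 0 ≠ 0 := left_ne_zero_of_mul_eq_one hdet
  rw [localKernel_apply_of_eq_zero (by simp [Matrix.SpecialLinearGroup.SL2_inv_expl, hg])]
  rcases eq_or_ne x 0 with rfl | hx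
  · simp [Matrix.SpecialLinearGroup.SL2_inv_expl, hd, quadChar_inv]
  · simp [Matrix.SpecialLinearGroup.SL2_inv_expl, hd, ha, hx]

lemma localKernel_inv_apply_zero_of_lower_right_eq_zero {g : SL(2, F)} (hg : g 1 1 = 0) (x : F) :
    localKernel ψ g⁻¹ x 0 = quadChar F (g 0 1) * (quadGauss ψ / Fintype.card F) := by
  have hdet := sl2_det g
  rw [hg, mul_zero, zero_sub, ← mul_neg] at hdet
  have hc : -g 1 0 = (g 0 1)⁻¹ := eq_inv_of_mul_eq_one_right hdet
  rw [localKernel_apply_of_ne_zero]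
  · simp [Matrix.SpecialLinearGroup.SL2_inv_expl, hg, hc, quadChar_inv]
  · simpa [Matrix.SpecialLinearGroup.SL2_inv_expl] using
      neg_ne_zero.mp (right_ne_zero_of_mul_eq_one hdet)

end LocalWeil

section ProductWeil

variable {I : Type*} [Fintype I] {F : I → Type*} [∀ i, Field (F i)] [∀ i, Fintype (F i)]
  [∀ i, DecidableEq (F i)] {ψ : ∀ i, AddChar (F i) ℂ}

/-- The matrix of the action of `SL₂(ℤ)` through the product of the Weil representations of the
`SL₂(F i)`. -/
def weilKernel (ψ : ∀ i, AddChar (F i) ℂ) (g : SL(2, ℤ)) : Matrix (∀ i, F i) (∀ i, F i) ℂ :=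
  Matrix.of fun x y =>
    ∏ i, localKernel (ψ i) (Matrix.SpecialLinearGroup.map (Int.castRingHom (F i)) g) (x i) (y i)

lemma weilKernel_apply (g : SL(2, ℤ)) (x y : ∀ i, F i) :
    weilKernel ψ g x y =
      ∏ i, localKernel (ψ i) (Matrix.SpecialLinearGroup.map (Int.castRingHom (F i)) g)
        (x i) (y i) :=
  rfl

lemma weilKernel_one : weilKernel ψ 1 = 1 := by
  ext x y
  simp_rw [weilKernel_apply, map_one, localKernel_one, Matrix.one_apply]
  rw [Fintype.prod_ite_zero, Finset.prod_const_one]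
  simp only [funext_iff]

lemma weilKernel_mul [DecidableEq I] (hF : ∀ i, ringChar (F i) ≠ 2)
    (hψ : ∀ i, (ψ i).IsPrimitive) (g h : SL(2, ℤ)) :
    weilKernel ψ (g * h) = weilKernel ψ g * weilKernel ψ h := by
  ext x z
  simp_rw [Matrix.mul_apply, weilKernel_apply, map_mul, localKernel_mul (hF _) (hψ _),
    Matrix.mul_apply, Fintype.prod_sum, Finset.prod_mul_distrib]

end ProductWeil

section ExponentialFunction

lemma e_add (x y : ℂ) : e (x + y) = e x * e y := by
  rw [e, e, e, ← Complex.exp_add, mul_add]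

lemma e_neg (x : ℂ) : e (-x) = (e x)⁻¹ := by
  rw [e, e, ← Complex.exp_neg, mul_neg]

lemma e_intCast (j : ℤ) : e j = 1 := by
  rw [e, Complex.exp_eq_one_iff]
  exact ⟨j, by ring⟩

lemma e_ne_zero (x : ℂ) : e x ≠ 0 := Complex.exp_ne_zero _

lemma e_sum {ι : Type*} (s : Finset ι) (f : ι → ℂ) : e (∑ i ∈ s, f i) = ∏ i ∈ s, e (f i) := by
  simp only [e, Finset.mul_sum, Complex.exp_sum]

end ExponentialFunction

section PrimeFactors

variable {D : ℕ}

instance factPrimeOfMemPrimeFactors (p : D.primeFactors) : Fact (p : ℕ).Prime :=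
  ⟨Nat.prime_of_mem_primeFactors p.2⟩

lemma ringChar_zmod_ne_two_of_odd {p : ℕ} (hp : Odd p) : ringChar (ZMod p) ≠ 2 := by
  rw [ZMod.ringChar_zmod_n]
  exact hp.ne_two_of_dvd_nat dvd_rfl

lemma ringChar_zmod_ne_two (hD : Odd D) (p : D.primeFactors) : ringChar (ZMod (p : ℕ)) ≠ 2 :=
  ringChar_zmod_ne_two_of_odd (hD.of_dvd_nat (Nat.dvd_of_mem_primeFactors p.2))

lemma dvd_cofactor_of_ne {p q : D.primeFactors} (hqp : q ≠ p) : (q : ℕ) ∣ D / p := by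
  have hp := Nat.prime_of_mem_primeFactors p.2
  have hq := Nat.prime_of_mem_primeFactors q.2
  refine (hq.dvd_mul.mp ?_).resolve_left fun hqp' =>
    hqp (Subtype.ext ((Nat.prime_dvd_prime_iff_eq hq hp).mp hqp'))
  rw [Nat.mul_div_cancel' (Nat.dvd_of_mem_primeFactors p.2)]
  exact Nat.dvd_of_mem_primeFactors q.2

lemma natCast_cofactor_eq_zero {p q : D.primeFactors} (hqp : q ≠ p) :
    ((D / p : ℕ) : ZMod (q : ℕ)) = 0 :=
  (ZMod.natCast_eq_zero_iff _ _).mpr (dvd_cofactor_of_ne hqp)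

lemma coprime_cofactor (hD : Squarefree D) (p : D.primeFactors) : Nat.Coprime (D / p) p := by
  rw [← Nat.div_mul_cancel (Nat.dvd_of_mem_primeFactors p.2)] at hD
  exact Nat.coprime_of_squarefree_mul hD

lemma natCast_ne_zero_of_coprime {p t : ℕ} [Fact p.Prime] (ht : t.Coprime p) :
    (t : ZMod p) ≠ 0 := by
  rw [Ne, ZMod.natCast_eq_zero_iff]
  exact (Nat.Prime.coprime_iff_not_dvd Fact.out).mp ht.symm

lemma prod_primeFactors_of_dvd {M : Type*} [CommMonoid M] {r : ℕ} (hD : D ≠ 0) (hr : r ∣ D)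
    (f : D.primeFactors → M) :
    ∏ p : r.primeFactors, f ⟨p, Nat.primeFactors_mono hr hD p.2⟩ =
      ∏ p : D.primeFactors, if (p : ℕ) ∣ r then f p else 1 := by
  refine Fintype.prod_of_injective
    (fun p : r.primeFactors => ⟨p, Nat.primeFactors_mono hr hD p.2⟩) (fun p q hpq => ?_) _ _
    (fun p hp => if_neg fun hpr => hp ⟨⟨p, ?_⟩, rfl⟩) fun p => ?_
  · exact Subtype.ext (congrArg (fun p : D.primeFactors => (p : ℕ)) hpq)
  · exact Nat.mem_primeFactors.mpr
      ⟨Nat.prime_of_mem_primeFactors p.2, hpr, ne_zero_of_dvd_ne_zero hD hr⟩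
  · exact (if_pos (Nat.dvd_of_mem_primeFactors p.2)).symm

lemma dvd_right_iff_not_dvd_left {r s : ℕ} (hD : Squarefree D) (hrs : D = r * s)
    (p : D.primeFactors) : (p : ℕ) ∣ s ↔ ¬ (p : ℕ) ∣ r := by
  have hp := Nat.prime_of_mem_primeFactors p.2
  refine ⟨fun hs hr => hp.one_lt.ne' ?_, fun hr => ?_⟩
  · exact Nat.eq_one_of_dvd_coprimes (Nat.coprime_of_squarefree_mul (hrs ▸ hD)) hr hs
  · exact (hp.dvd_mul.mp (hrs ▸ Nat.dvd_of_mem_primeFactors p.2)).resolve_left hr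

lemma chi_eq_prod (n : ℕ) {r : ℕ} (hr : Squarefree r) (a : ℤ) :
    chi n r a = ∏ p : r.primeFactors, quadChar (ZMod (p : ℕ)) a ^ (n - 2) := by
  have hjacobi : jacobiSym a r = ∏ p : r.primeFactors, quadraticChar (ZMod (p : ℕ)) a := by
    conv_lhs => rw [← Nat.prod_primeFactorsList hr.ne_zero]
    rw [jacobiSym.list_prod_right fun p hp => (Nat.prime_of_mem_primeFactorsList hp).ne_zero,
      ← List.prod_toFinset _ ((Nat.squarefree_iff_nodup_primeFactorsList hr.ne_zero).mp hr),
      Nat.toFinset_factors, ← Finset.prod_coe_sort]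
    exact Finset.prod_congr rfl fun p _ => (jacobiSym.legendreSym.to_jacobiSym (p : ℕ) a).symm
  rw [Finset.prod_pow, chi, hjacobi, Int.cast_prod]
  rfl

lemma chi_mul_chi_eq_prod (n : ℕ) {r s : ℕ} (hD : Squarefree D) (hrs : D = r * s) (x y : ℤ) :
    chi n r x * chi n s y = ∏ p : D.primeFactors,
      if (p : ℕ) ∣ r then quadChar (ZMod (p : ℕ)) x ^ (n - 2)
        else quadChar (ZMod (p : ℕ)) y ^ (n - 2) := by
  have hr : r ∣ D := Dvd.intro _ hrs.symm
  have hs : s ∣ D := Dvd.intro_left _ hrs.symm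
  rw [chi_eq_prod n (hD.squarefree_of_dvd hr), chi_eq_prod n (hD.squarefree_of_dvd hs)]
  refine (congrArg₂ (· * ·)
    (prod_primeFactors_of_dvd hD.ne_zero hr fun p => quadChar (ZMod (p : ℕ)) x ^ (n - 2))
    (prod_primeFactors_of_dvd hD.ne_zero hs fun p => quadChar (ZMod (p : ℕ)) y ^ (n - 2))).trans ?_
  rw [← Finset.prod_mul_distrib]
  refine Finset.prod_congr rfl fun p _ => ?_
  simp only [dvd_right_iff_not_dvd_left hD hrs p, ite_not]
  split_ifs <;> simp

end PrimeFactors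

/-! ### The Weil representation in diagonal coordinates -/

section Diagonal

variable {K : Type*} [Field K] [NumberField K] [StarRing K]
variable {V : Type*} [AddCommGroup V] [Module K V]
variable {h : V →ₗ[K] V →ₛₗ[starRingEnd K] K} {L : AddSubgroup V}

/-- The index set of the coordinates `∏_{p ∣ D} 𝔽_p^n` on the discriminant group. -/
abbrev PrimeIdx (D n : ℕ) : Type := D.primeFactors × Fin n

/-- Coordinates `θ` on `L'/L` in which the discriminant form is `∑ xᵢ²`, with `ψ i` the additive
character through which the `i`-th square enters `e (Q(μ))`. The last field says that these
characters have the prescribed local Weil indices. -/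
structure IsDiagonalization {D n : ℕ} (b : Module.Basis (Fin n) K V)
    (θ : DiscGroup h L ≃+ (∀ i : PrimeIdx D n, ZMod (i.1 : ℕ)))
    (ψ : ∀ i : PrimeIdx D n, AddChar (ZMod (i.1 : ℕ)) ℂ) : Prop where
  primitive : ∀ i, (ψ i).IsPrimitive
  quad : ∀ μ, e (discQuad μ) = ∏ i, ψ i (θ μ i ^ 2)
  bilin : ∀ μ ν, e (discBilin μ ν) = ∏ i, ψ i (2 * θ μ i * θ ν i)
  gamma : ∀ p : D.primeFactors,
    gammaPrime h D b (p : ℕ) = ∏ j : Fin n, (quadGauss (ψ (p, j)) / ((√(p : ℕ) : ℝ) : ℂ))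

variable {D n : ℕ} {b : Module.Basis (Fin n) K V}
  {θ : DiscGroup h L ≃+ (∀ i : PrimeIdx D n, ZMod (i.1 : ℕ))}
  {ψ : ∀ i : PrimeIdx D n, AddChar (ZMod (i.1 : ℕ)) ℂ}

/-- The Weil representation in diagonal coordinates. -/
def weilRep (hθ : IsDiagonalization b θ ψ) (hodd : Odd D) :
    Representation ℂ SL(2, ℤ) (DiscGroup h L → ℂ) :=
  letI : Fintype (DiscGroup h L) := Fintype.ofEquiv _ θ.symm.toEquiv
  letI : DecidableEq (DiscGroup h L) := Classical.decEq _
  { toFun := fun g => ((weilKernel ψ g).submatrix θ θ).mulVecLin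
    map_one' := by
      rw [weilKernel_one]
      exact (congrArg _ (Matrix.submatrix_one_equiv θ.toEquiv)).trans Matrix.mulVecLin_one
    map_mul' := fun g g' => by
      rw [weilKernel_mul (fun i => ringChar_zmod_ne_two hodd i.1) hθ.primitive]
      exact (congrArg _ (Matrix.submatrix_mul_equiv _ _ θ θ.toEquiv θ).symm).trans
        (Matrix.mulVecLin_mul _ _) }

lemma weilRep_apply [Fintype (DiscGroup h L)] (hθ : IsDiagonalization b θ ψ) (hodd : Odd D)
    (g : SL(2, ℤ)) (φ : DiscGroup h L → ℂ) (μ : DiscGroup h L) :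
    weilRep hθ hodd g φ μ = ∑ ν, weilKernel ψ g (θ μ) (θ ν) * φ ν :=
  Finset.sum_congr (by ext; simp) fun _ _ => rfl

lemma weilRep_phiZero (hθ : IsDiagonalization b θ ψ) (hodd : Odd D) (g : SL(2, ℤ))
    (μ : DiscGroup h L) : weilRep hθ hodd g phiZero μ = weilKernel ψ g (θ μ) 0 := by
  classical
  let _ : Fintype (DiscGroup h L) := Fintype.ofEquiv _ θ.symm.toEquiv
  rw [weilRep_apply, Finset.sum_eq_single 0]
  · simp [phiZero]
  · intro ν _ hν
    simp [phiZero, hν]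
  · simp

lemma weilRep_T (hθ : IsDiagonalization b θ ψ) (hodd : Odd D)
    (φ : DiscGroup h L → ℂ) (μ : DiscGroup h L) :
    weilRep hθ hodd ModularGroup.T φ μ = e (-(discQuad μ : ℂ)) * φ μ := by
  classical
  let _ : Fintype (DiscGroup h L) := Fintype.ofEquiv _ θ.symm.toEquiv
  rw [weilRep_apply, Finset.sum_eq_single μ]
  · rw [e_neg, hθ.quad, ← Finset.prod_inv_distrib, weilKernel_apply]
    simp [localKernel, ModularGroup.coe_T, AddChar.map_neg_eq_inv]
  · intro ν _ hν
    obtain ⟨i, hi⟩ := Function.ne_iff.mp (θ.injective.ne hν)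
    rw [weilKernel_apply, Finset.prod_eq_zero (Finset.mem_univ i), zero_mul]
    simp [localKernel, ModularGroup.coe_T, hi]
  · simp

lemma finsum_e_discQuad (hθ : IsDiagonalization b θ ψ) :
    ∑ᶠ μ : DiscGroup h L, e (discQuad μ) = ∏ i, quadGauss (ψ i) := by
  let _ : Fintype (DiscGroup h L) := Fintype.ofEquiv _ θ.symm.toEquiv
  simp only [finsum_eq_sum_of_fintype, hθ.quad, quadGauss]
  rw [Fintype.prod_sum]
  exact θ.toEquiv.sum_comp fun x => ∏ i, ψ i (x i ^ 2)

lemma weilIndex_mul_inv_sqrt_card (hθ : IsDiagonalization b θ ψ) :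
    weilIndex h L * ((√(Nat.card (DiscGroup h L) : ℝ) : ℝ) : ℂ)⁻¹ =
      ∏ i : PrimeIdx D n, quadGauss (ψ i) / Fintype.card (ZMod (i.1 : ℕ)) := by
  have hcard : Nat.card (DiscGroup h L) = ∏ i : PrimeIdx D n, Fintype.card (ZMod (i.1 : ℕ)) := by
    rw [Nat.card_congr θ.toEquiv, Nat.card_eq_fintype_card, Fintype.card_pi]
  rw [weilIndex, finsum_e_discQuad hθ, mul_right_comm, ← mul_inv, ← Complex.ofReal_mul,
    Real.mul_self_sqrt (Nat.cast_nonneg _), hcard, Finset.prod_div_distrib, div_eq_inv_mul]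
  push_cast
  rfl

lemma weilRep_S (hθ : IsDiagonalization b θ ψ) (hodd : Odd D)
    (φ : DiscGroup h L → ℂ) (μ : DiscGroup h L) :
    weilRep hθ hodd ModularGroup.S φ μ =
      weilIndex h L * ((√(Nat.card (DiscGroup h L) : ℝ) : ℝ) : ℂ)⁻¹ *
      ∑ᶠ ν : DiscGroup h L, e (discBilin μ ν) * φ ν := by
  let _ : Fintype (DiscGroup h L) := Fintype.ofEquiv _ θ.symm.toEquiv
  rw [weilRep_apply, weilIndex_mul_inv_sqrt_card hθ, finsum_eq_sum_of_fintype, Finset.mul_sum]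
  refine Finset.sum_congr rfl fun ν _ => ?_
  rw [hθ.bilin, ← mul_assoc, ← Finset.prod_mul_distrib, weilKernel_apply]
  simp [localKernel, ModularGroup.coe_S]

lemma isWeilRepresentation_weilRep (hθ : IsDiagonalization b θ ψ) (hodd : Odd D) :
    IsWeilRepresentation (weilRep hθ hodd) :=
  ⟨weilRep_T hθ hodd, weilRep_S hθ hodd⟩

lemma IsWeilRepresentation.unique {ω ω' : Representation ℂ SL(2, ℤ) (DiscGroup h L → ℂ)}
    (hω : IsWeilRepresentation ω) (hω' : IsWeilRepresentation ω') : ω' = ω := by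
  refine MonoidHom.eq_of_eqOn_dense SpecialLinearGroup.SL2Z_generators ?_
  rintro g (rfl | rfl)
  · ext1 φ
    funext μ
    rw [hω.map_S, hω'.map_S]
  · ext1 φ
    funext μ
    rw [hω.map_T, hω'.map_T]

end Diagonal

section PhiZero

lemma quadChar_pow_sub_two {F : Type*} [Field F] [Fintype F] [DecidableEq F] {t : F} (ht : t ≠ 0)
    {n : ℕ} (hn : 2 ≤ n) : quadChar F t ^ n = quadChar F t ^ (n - 2) := by
  obtain ⟨k, rfl⟩ := Nat.exists_eq_add_of_le' hn
  rw [pow_add, sq, quadChar_mul_self ht, mul_one, Nat.add_sub_cancel]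

lemma prod_localKernel_inv_of_dvd_lower_left {p n : ℕ} [Fact p.Prime] (hn : 2 ≤ n)
    (ψ : Fin n → AddChar (ZMod p) ℂ) {R : SL(2, ℤ)} (hR : (p : ℤ) ∣ R 1 0) (x : Fin n → ZMod p) :
    ∏ j, localKernel (ψ j) (Matrix.SpecialLinearGroup.map (Int.castRingHom (ZMod p)) R⁻¹) (x j) 0 =
      quadChar (ZMod p) (R 0 0 : ℤ) ^ (n - 2) * if ∀ j, x j = 0 then 1 else 0 := by
  set g := Matrix.SpecialLinearGroup.map (Int.castRingHom (ZMod p)) R with hg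
  have hg10 : g 1 0 = 0 := (ZMod.intCast_zmod_eq_zero_iff_dvd _ _).mpr hR
  have hdet := sl2_det g
  rw [hg10, mul_zero, sub_zero] at hdet
  simp_rw [map_inv, ← hg, localKernel_inv_apply_zero_of_lower_left_eq_zero hg10]
  rw [Fintype.prod_ite_zero, Fin.prod_const,
    quadChar_pow_sub_two (left_ne_zero_of_mul_eq_one hdet) hn, mul_ite, mul_one, mul_zero]
  split_ifs <;> rfl

lemma prod_localKernel_inv_of_dvd_lower_right {p n : ℕ} [Fact p.Prime] (hn : 2 ≤ n)
    (ψ : Fin n → AddChar (ZMod p) ℂ) {R : SL(2, ℤ)} (hR : (p : ℤ) ∣ R 1 1) (x : Fin n → ZMod p) :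
    ∏ j, localKernel (ψ j) (Matrix.SpecialLinearGroup.map (Int.castRingHom (ZMod p)) R⁻¹) (x j) 0 =
      quadChar (ZMod p) (R 0 1 : ℤ) ^ (n - 2) * ∏ j, quadGauss (ψ j) / p := by
  set g := Matrix.SpecialLinearGroup.map (Int.castRingHom (ZMod p)) R with hg
  have hg11 : g 1 1 = 0 := (ZMod.intCast_zmod_eq_zero_iff_dvd _ _).mpr hR
  have hdet := sl2_det g
  rw [hg11, mul_zero, zero_sub, ← mul_neg] at hdet
  simp_rw [map_inv, ← hg, localKernel_inv_apply_zero_of_lower_right_eq_zero hg11, ZMod.card]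
  rw [Finset.prod_mul_distrib, Fin.prod_const,
    quadChar_pow_sub_two (left_ne_zero_of_mul_eq_one hdet) hn]
  rfl

variable {D n : ℕ} {ψ : ∀ i : PrimeIdx D n, AddChar (ZMod (i.1 : ℕ)) ℂ}

lemma weilKernel_inv_apply_zero (hn : 2 ≤ n) {r s : ℕ} (hD : Squarefree D) (hrs : D = r * s)
    (R : SL(2, ℤ)) (hs : (s : ℤ) ∣ R 1 0) (hr : (r : ℤ) ∣ R 1 1)
    (x : ∀ i : PrimeIdx D n, ZMod (i.1 : ℕ)) :
    weilKernel ψ R⁻¹ x 0 = chi n r (R 0 1) * chi n s (R 0 0) *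
      if ∀ p : D.primeFactors, (p : ℕ) ∣ r ∨ ∀ j, x (p, j) = 0 then
        ∏ p : D.primeFactors,
          if (p : ℕ) ∣ r then ∏ j : Fin n, quadGauss (ψ (p, j)) / (p : ℕ) else 1
      else 0 := by
  rw [chi_mul_chi_eq_prod n hD hrs, ← Fintype.prod_ite_zero, ← Finset.prod_mul_distrib,
    weilKernel_apply, Fintype.prod_prod_type]
  refine Finset.prod_congr rfl fun p _ => ?_
  by_cases hp : (p : ℕ) ∣ r
  · have hR : ((p : ℕ) : ℤ) ∣ R 1 1 := (Int.natCast_dvd_natCast.mpr hp).trans hr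
    rw [if_pos hp, if_pos hp, if_pos (Or.inl hp)]
    have hprod := prod_localKernel_inv_of_dvd_lower_right (p := p) hn (fun j => ψ (p, j)) hR
      fun j => x (p, j)
    rw [← hprod]
    rfl
  · have hR : ((p : ℕ) : ℤ) ∣ R 1 0 :=
      (Int.natCast_dvd_natCast.mpr ((dvd_right_iff_not_dvd_left hD hrs p).mpr hp)).trans hs
    rw [if_neg hp, if_neg hp]
    simp only [hp, false_or]
    have hprod := prod_localKernel_inv_of_dvd_lower_left (p := p) hn (fun j => ψ (p, j)) hR
      fun j => x (p, j)
    rw [← hprod]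
    rfl

variable {K : Type*} [Field K] [NumberField K] [StarRing K]
variable {V : Type*} [AddCommGroup V] [Module K V]
variable {h : V →ₗ[K] V →ₛₗ[starRingEnd K] K} {L : AddSubgroup V}
variable {b : Module.Basis (Fin n) K V}

lemma exists_coprime_nsmul_eq_zero_iff (hD : Squarefree D) {A : Type*} [AddCommGroup A]
    (θ : A ≃+ (∀ i : PrimeIdx D n, ZMod (i.1 : ℕ))) (p : D.primeFactors) (μ : A) :
    (∃ t : ℕ, t.Coprime p ∧ t • μ = 0) ↔ ∀ j, θ μ (p, j) = 0 := by
  refine ⟨?_, fun hμ => ⟨D / p, coprime_cofactor hD p, ?_⟩⟩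
  · rintro ⟨t, ht, htμ⟩ j
    have hmul := congrFun (congrArg θ htμ) (p, j)
    rw [map_nsmul, map_zero, Pi.smul_apply, nsmul_eq_mul] at hmul
    exact (mul_eq_zero.mp hmul).resolve_left (natCast_ne_zero_of_coprime ht)
  · apply θ.injective
    rw [map_nsmul, map_zero]
    ext ⟨q, j⟩
    rw [Pi.smul_apply, nsmul_eq_mul, Pi.zero_apply]
    rcases eq_or_ne q p with rfl | hqp
    · rw [hμ j, mul_zero]
    · rw [natCast_cofactor_eq_zero hqp, zero_mul]

lemma rOf_dvd_iff (hD : Squarefree D) (θ : DiscGroup h L ≃+ (∀ i : PrimeIdx D n, ZMod (i.1 : ℕ)))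
    (r : ℕ) (μ : DiscGroup h L) :
    rOf D μ ∣ r ↔ ∀ p : D.primeFactors, (p : ℕ) ∣ r ∨ ∀ j, θ μ (p, j) = 0 := by
  classical
  have hprime : rOf D μ ∣ r ↔
      ∀ p ∈ D.primeFactors, (∀ t : ℕ, t.Coprime p → t • μ ≠ 0) → p ∣ r := by
    simp only [rOf]
    refine ⟨fun hd p hp hpμ => (Finset.dvd_prod_of_mem _ ?_).trans hd, fun hall =>
      Finset.prod_primes_dvd _ (fun p hp => ?_) fun p hp => ?_⟩
    · exact Finset.mem_filter.mpr ⟨hp, hpμ⟩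
    · exact (Nat.prime_of_mem_primeFactors (Finset.mem_filter.mp hp).1).prime
    · exact hall p (Finset.mem_filter.mp hp).1 (Finset.mem_filter.mp hp).2
  rw [hprime, Subtype.forall]
  refine forall₂_congr fun p hp => ?_
  rw [← exists_coprime_nsmul_eq_zero_iff hD θ ⟨p, hp⟩ μ, or_iff_not_imp_right]
  push Not
  rfl

variable {θ : DiscGroup h L ≃+ (∀ i : PrimeIdx D n, ZMod (i.1 : ℕ))}

lemma sqrt_eq_prod_primeFactors {r : ℕ} (hr : Squarefree r) :
    ((√r : ℝ) : ℂ) = ∏ p : r.primeFactors, ((√(p : ℕ) : ℝ) : ℂ) := by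
  rw [← Complex.ofReal_prod, ← Real.sqrt_prod _ (fun _ _ => Nat.cast_nonneg _), ← Nat.cast_prod,
    Finset.prod_coe_sort r.primeFactors (fun p => p), Nat.prod_primeFactors_of_squarefree hr]

lemma gammaDiv_eq_prod (hθ : IsDiagonalization b θ ψ) (hD : Squarefree D) {r : ℕ} (hr : r ∣ D) :
    gammaDiv h D b r * (((√r : ℝ) : ℂ) ^ n)⁻¹ = ∏ p : D.primeFactors,
      if (p : ℕ) ∣ r then ∏ j : Fin n, quadGauss (ψ (p, j)) / (p : ℕ) else 1 := by
  have hsqrt (p : ℕ) : ((√p : ℝ) : ℂ) * ((√p : ℝ) : ℂ) = p := by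
    rw [← Complex.ofReal_mul, Real.mul_self_sqrt (Nat.cast_nonneg _), Complex.ofReal_natCast]
  rw [gammaDiv, sqrt_eq_prod_primeFactors (hD.squarefree_of_dvd hr), ← Finset.prod_pow,
    ← Finset.prod_inv_distrib, ← Finset.prod_mul_distrib]
  refine (prod_primeFactors_of_dvd hD.ne_zero hr fun p =>
    gammaPrime h D b (p : ℕ) * (((√(p : ℕ) : ℝ) : ℂ) ^ n)⁻¹).trans ?_
  refine Finset.prod_congr rfl fun p _ => if_congr Iff.rfl ?_ rfl
  rw [hθ.gamma p, ← inv_pow, ← Fin.prod_const, ← Finset.prod_mul_distrib]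
  refine Finset.prod_congr rfl fun j _ => ?_
  rw [← div_eq_mul_inv, div_div, hsqrt]

lemma weilRep_inv_phiZero (hθ : IsDiagonalization b θ ψ) (hodd : Odd D) (hn : 2 ≤ n) {r s : ℕ}
    (hD : Squarefree D) (hrs : D = r * s) (R : SL(2, ℤ)) (hs : (s : ℤ) ∣ R 1 0)
    (hr : (r : ℤ) ∣ R 1 1) (μ : DiscGroup h L) :
    weilRep hθ hodd R⁻¹ phiZero μ = chi n r (R 0 1) * chi n s (R 0 0) *
      if rOf D μ ∣ r then gammaDiv h D b r * (((√r : ℝ) : ℂ) ^ n)⁻¹ else 0 := by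
  have hrD : r ∣ D := Dvd.intro _ hrs.symm
  rw [weilRep_phiZero, weilKernel_inv_apply_zero hn hD hrs R hs hr, gammaDiv_eq_prod hθ hD hrD]
  simp only [rOf_dvd_iff hD θ r μ]

end PhiZero

/-! ### The imaginary quadratic field -/

section Quadratic

lemma algebraMap_trace_eq_add {F K : Type*} [Field F] [Field K] [Algebra F K]
    [Algebra.IsQuadraticExtension F K] [IsGalois F K] {τ : Gal(K/F)} (hτ : τ ≠ 1) (x : K) :
    algebraMap F K (Algebra.trace F K x) = x + τ x := by
  classical
  have : FiniteDimensional F K :=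
    Module.finite_of_finrank_eq_succ (Algebra.IsQuadraticExtension.finrank_eq_two F K)
  have hcard : Fintype.card Gal(K/F) = 2 := by
    rw [← Nat.card_eq_fintype_card, IsGalois.card_aut_eq_finrank,
      Algebra.IsQuadraticExtension.finrank_eq_two]
  have huniv : ({1, τ} : Finset Gal(K/F)) = Finset.univ :=
    Finset.eq_univ_of_card _ (by rw [Finset.card_pair hτ.symm, hcard])
  rw [trace_eq_sum_automorphisms, ← huniv, Finset.sum_pair hτ.symm, AlgEquiv.one_apply]

lemma isIntegral_star {R : Type*} [CommRing R] [StarRing R] {x : R} (hx : IsIntegral ℤ x) :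
    IsIntegral ℤ (star x) :=
  map_isIntegral_int (starRingEnd R) hx

section NumberField

variable {K : Type*} [Field K] [NumberField K]

lemma sq_basis_eq_discr [Algebra.IsQuadraticExtension ℚ K] {τ : Gal(K/ℚ)} (hτ : τ ≠ 1)
    (ω : Module.Basis (Fin 2) ℤ (𝓞 K)) :
    ((ω 0 : K) * τ (ω 1 : K) - ω 1 * τ (ω 0 : K)) ^ 2 = NumberField.discr K := by
  have htrace (a : 𝓞 K) : ((Algebra.trace ℤ (𝓞 K) a : ℤ) : K) = a + τ a := by
    rw [← algebraMap_trace_eq_add hτ, ← Algebra.coe_trace_int, map_intCast]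
  rw [← NumberField.discr_eq_discr K ω, Algebra.discr_def, Matrix.det_fin_two]
  simp only [Algebra.traceMatrix_apply, Algebra.traceForm_apply]
  push_cast
  simp only [htrace, map_mul]
  ring

lemma exists_intBasis (hK : Module.finrank ℚ K = 2) :
    Nonempty (Module.Basis (Fin 2) ℤ (𝓞 K)) :=
  ⟨Module.finBasisOfFinrankEq ℤ (𝓞 K) (by rw [NumberField.RingOfIntegers.rank, hK])⟩

lemma exists_int_mul_eq_sub (σ : K →+* K) (ω : Module.Basis (Fin 2) ℤ (𝓞 K)) (a b : 𝓞 K) :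
    ∃ k : ℤ, (a : K) * σ b - b * σ a = k * ((ω 0 : K) * σ (ω 1) - ω 1 * σ (ω 0)) := by
  have hrepr (c : 𝓞 K) : (c : K) = ω.repr c 0 * ω 0 + ω.repr c 1 * ω 1 := by
    have hsum := congrArg (algebraMap (𝓞 K) K) (ω.sum_repr c)
    simpa only [Fin.sum_univ_two, map_add, zsmul_eq_mul, map_mul, map_intCast] using hsum.symm
  refine ⟨ω.repr a 0 * ω.repr b 1 - ω.repr a 1 * ω.repr b 0, ?_⟩
  rw [hrepr a, hrepr b]
  simp only [map_add, map_mul, map_intCast]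
  push_cast
  ring

end NumberField

variable {K : Type*} [Field K] [NumberField K] [StarRing K]

lemma exists_star_ne (ι : K →+* ℂ) (hι : ∀ x : K, ι (star x) = starRingEnd ℂ (ι x))
    (hK : Module.finrank ℚ K = 2) (hdiscr : NumberField.discr K < 0) : ∃ x : K, star x ≠ x := by
  have : Algebra.IsQuadraticExtension ℚ K := ⟨hK⟩
  obtain ⟨ω⟩ := exists_intBasis hK
  obtain ⟨τ, hτ⟩ : ∃ τ : Gal(K/ℚ), τ ≠ 1 := by
    have : Nontrivial Gal(K/ℚ) := by
      rw [← Finite.one_lt_card_iff_nontrivial, IsGalois.card_aut_eq_finrank, hK]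
      exact one_lt_two
    exact exists_ne 1
  by_contra! hstar
  have hsq := congrArg ι (sq_basis_eq_discr hτ ω)
  set δ : K := (ω 0 : K) * τ (ω 1 : K) - ω 1 * τ (ω 0 : K)
  obtain ⟨y, hy⟩ := Complex.conj_eq_iff_real.mp (by rw [← hι, hstar] : starRingEnd ℂ (ι δ) = ι δ)
  rw [map_pow, hy, map_intCast] at hsq
  have hreal : y ^ 2 = (NumberField.discr K : ℝ) := by exact_mod_cast hsq
  have hneg : (NumberField.discr K : ℝ) < 0 := by exact_mod_cast hdiscr
  exact absurd (sq_nonneg y) (by rw [hreal]; exact hneg.not_ge)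

/-- `δ = √-D` generates the different of `K`, and `star` is the nontrivial automorphism. -/
structure IsDifferentGenerator (D : ℕ) (δ : K) : Prop where
  trace : ∀ x : K, algebraMap ℚ K (Algebra.trace ℚ K x) = x + star x
  sq : δ ^ 2 = -D
  star_eq : star δ = -δ
  sub : ∀ a b : 𝓞 K, ∃ k : ℤ, (a : K) * star (b : K) - b * star (a : K) = k * δ
  dual : ∀ x : K, (∀ a : 𝓞 K, ∃ j : ℤ, Algebra.trace ℚ K (x * a) = j) → IsIntegral ℤ (δ * x)

lemma exists_isDifferentGenerator (ι : K →+* ℂ)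
    (hι : ∀ x : K, ι (star x) = starRingEnd ℂ (ι x)) (hK : Module.finrank ℚ K = 2)
    {D : ℕ} (hD : NumberField.discr K = -(D : ℤ)) : ∃ δ : K, IsDifferentGenerator D δ := by
  have : Algebra.IsQuadraticExtension ℚ K := ⟨hK⟩
  have hD0 : D ≠ 0 := by
    rintro rfl
    exact NumberField.discr_ne_zero K (by simpa using hD)
  obtain ⟨y, hy⟩ := exists_star_ne ι hι hK (by omega)
  let σ : Gal(K/ℚ) := AlgEquiv.ofBijective (RingHom.toRatAlgHom (starRingEnd K))
    star_involutive.bijective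
  have hσ : σ ≠ 1 := fun hσ1 => hy (DFunLike.congr_fun hσ1 y)
  have htrace (x : K) : algebraMap ℚ K (Algebra.trace ℚ K x) = x + star x :=
    algebraMap_trace_eq_add hσ x
  obtain ⟨ω⟩ := exists_intBasis hK
  set u : K := (ω 0 : K)
  set v : K := (ω 1 : K)
  refine ⟨u * star v - v * star u, htrace, ?_, ?_, exists_int_mul_eq_sub (starRingEnd K) ω, ?_⟩
  · have hsq := sq_basis_eq_discr hσ ω
    rw [hD] at hsq
    exact_mod_cast hsq
  · rw [star_sub, star_mul', star_mul', star_star, star_star]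
    ring
  · intro x hx
    obtain ⟨k, hk⟩ := hx (ω 0)
    obtain ⟨l, hl⟩ := hx (ω 1)
    have hku := htrace (x * u)
    have hlv := htrace (x * v)
    rw [hk, map_intCast, star_mul'] at hku
    rw [hl, map_intCast, star_mul'] at hlv
    have hx : (u * star v - v * star u) * x = k * star v - l * star u := by
      rw [hku, hlv]
      ring
    rw [hx]
    have hint (j : ℤ) : IsIntegral ℤ (j : K) := isIntegral_algebraMap (R := ℤ) (x := j)
    exact ((hint k).mul (isIntegral_star (ω 1).isIntegral_coe)).sub
      ((hint l).mul (isIntegral_star (ω 0).isIntegral_coe))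

namespace IsDifferentGenerator

variable {D : ℕ} {δ : K}

lemma isIntegral (hδ : IsDifferentGenerator D δ) : IsIntegral ℤ δ := by
  simpa only [mul_one] using
    hδ.dual 1 fun a => ⟨Algebra.trace ℤ (𝓞 K) a, by rw [one_mul, Algebra.coe_trace_int]⟩

lemma ne_zero (hδ : IsDifferentGenerator D δ) (hD : D ≠ 0) : δ ≠ 0 := by
  rintro rfl
  have hsq := hδ.sq
  rw [zero_pow two_ne_zero, eq_comm, neg_eq_zero] at hsq
  exact hD (Nat.cast_eq_zero.mp hsq)

lemma squarefree (hδ : IsDifferentGenerator D δ) (hodd : Odd D) : Squarefree D := by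
  have hδ0 := hδ.ne_zero hodd.pos.ne'
  rw [Nat.squarefree_iff_prime_squarefree]
  rintro p hp ⟨m, hm⟩
  have hp0 : (p : K) ≠ 0 := Nat.cast_ne_zero.mpr hp.ne_zero
  have hint : IsIntegral ℤ (δ / p) := by
    refine IsIntegral.of_pow (n := 2) two_pos ?_
    have hsq : (δ / p) ^ 2 = ((-(m : ℤ) : ℤ) : K) := by
      rw [div_pow, hδ.sq, hm]
      push_cast
      field_simp
    rw [hsq]
    exact isIntegral_algebraMap (R := ℤ)
  -- `δ / p` is integral, so `2 δ / p = δ / p - star (δ / p)` is an integral multiple of `δ`.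
  obtain ⟨k, hk⟩ := hδ.sub ⟨δ / p, hint⟩ 1
  change δ / p * star (1 : K) - 1 * star (δ / p) = k * δ at hk
  simp only [star_one, star_div₀, hδ.star_eq, star_natCast, one_mul, mul_one] at hk
  have htwo : (2 : ℤ) = p * k := by
    field_simp at hk
    exact_mod_cast (by linear_combination hk : (2 : K) = p * k)
  have hdvd : p ∣ 2 := Int.natCast_dvd_natCast.mp ⟨k, htwo⟩
  rw [(Nat.prime_dvd_prime_iff_eq hp Nat.prime_two).mp hdvd] at hm
  exact Nat.not_even_iff_odd.mpr hodd ⟨2 * m, by omega⟩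

lemma eq_ratCast_of_star_eq (hδ : IsDifferentGenerator D δ) {x : K} (hx : star x = x) :
    x = ((Algebra.trace ℚ K x / 2 : ℚ) : K) := by
  have htrace : ((Algebra.trace ℚ K x : ℚ) : K) = x + star x := hδ.trace x
  push_cast
  rw [htrace, hx]
  ring

lemma exists_int_of_star_eq (hδ : IsDifferentGenerator D δ) {a : 𝓞 K}
    (ha : star (a : K) = a) : ∃ k : ℤ, (a : K) = k := by
  have hrat := hδ.eq_ratCast_of_star_eq ha
  have hint : IsIntegral ℤ (a : K) := a.isIntegral_coe
  rw [hrat] at hint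
  obtain ⟨k, hk⟩ := IsIntegrallyClosed.isIntegral_iff.mp
    ((isIntegral_algebraMap_iff (algebraMap ℚ K).injective).mp hint)
  refine ⟨k, ?_⟩
  rw [hrat, ← hk]
  simp

lemma mul_star_eq (hδ : IsDifferentGenerator D δ) (hD : D ≠ 0) (x : K) :
    ∃ u v : ℚ, x * star x = ((u ^ 2 + D * v ^ 2 : ℚ) : K) := by
  have hδ0 := hδ.ne_zero hD
  have hfixed : star ((x - star x) / δ) = (x - star x) / δ := by
    rw [star_div₀, star_sub, star_star, hδ.star_eq, div_neg, ← neg_div, neg_sub]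
  have hrat := hδ.eq_ratCast_of_star_eq hfixed
  set v := Algebra.trace ℚ K ((x - star x) / δ) / 2
  have htrace : ((Algebra.trace ℚ K x : ℚ) : K) = x + star x := hδ.trace x
  have hsub : x - star x = v * δ := by
    rw [← hrat, div_mul_cancel₀ _ hδ0]
  refine ⟨Algebra.trace ℚ K x / 2, v / 2, ?_⟩
  push_cast
  rw [htrace]
  linear_combination (-1 / 4 : K) * (x - star x + v * δ) * hsub - (v : K) ^ 2 / 4 * hδ.sq

lemma intCast_trace (hδ : IsDifferentGenerator D δ) (a : 𝓞 K) :
    ((Algebra.trace ℤ (𝓞 K) a : ℤ) : K) = a + star (a : K) := by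
  rw [← hδ.trace, ← Algebra.coe_trace_int, map_intCast]

lemma trace_mul_trace (hδ : IsDifferentGenerator D δ) (a b : 𝓞 K) :
    ∃ k : ℤ, Algebra.trace ℤ (𝓞 K) a * Algebra.trace ℤ (𝓞 K) b =
      2 * Algebra.trace ℤ (𝓞 K) (a * b) + D * k := by
  obtain ⟨k, hk⟩ := hδ.sub a 1
  obtain ⟨l, hl⟩ := hδ.sub b 1
  simp only [map_one, star_one, mul_one, one_mul] at hk hl
  refine ⟨k * l, Int.cast_injective (α := K) ?_⟩
  push_cast
  have hmul : ((a * b : 𝓞 K) : K) = a * b := map_mul (algebraMap (𝓞 K) K) a b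
  rw [hδ.intCast_trace, hδ.intCast_trace, hδ.intCast_trace, hmul, star_mul']
  linear_combination (star (b : K) - b) * hk - (k * δ) * hl - (k * l : K) * hδ.sq

lemma isIntegral_div_of_dvd_trace (hδ : IsDifferentGenerator D δ) (hD : D ≠ 0) {x : 𝓞 K}
    (hx : ∀ a : 𝓞 K, (D : ℤ) ∣ Algebra.trace ℤ (𝓞 K) (x * a)) : IsIntegral ℤ ((x : K) / δ) := by
  have hδ0 := hδ.ne_zero hD
  have hDK : (D : K) ≠ 0 := Nat.cast_ne_zero.mpr hD
  have hint : IsIntegral ℤ (δ * (x / D)) := by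
    refine hδ.dual _ fun a => ?_
    obtain ⟨j, hj⟩ := hx a
    refine ⟨j, (algebraMap ℚ K).injective ?_⟩
    have htrace := hδ.intCast_trace (x * a)
    have hmul : ((x * a : 𝓞 K) : K) = x * a := map_mul (algebraMap (𝓞 K) K) x a
    rw [hj, hmul] at htrace
    push_cast at htrace
    rw [hδ.trace, map_intCast, star_mul', star_div₀, star_natCast]
    rw [star_mul'] at htrace
    field_simp
    linear_combination -htrace
  have hdiv : (x : K) / δ = -(δ * (x / D)) := by
    field_simp
    linear_combination (x : K) * hδ.sq
  rw [hdiv]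
  exact hint.neg

section Reduction

variable (hδ : IsDifferentGenerator D δ) (hodd : Odd D) (hK : Module.finrank ℚ K = 2)
  (p : D.primeFactors)

/-- Reduction of the integers of `K` modulo the ramified prime above `p ∣ D`, whose residue field
is `ZMod p`. Since `star` acts trivially there, `a` reduces to half of its trace. -/
def red : 𝓞 K →+* ZMod (p : ℕ) where
  toFun a := (Algebra.trace ℤ (𝓞 K) a : ZMod (p : ℕ)) / 2
  map_one' := by
    have htwo : (2 : ZMod (p : ℕ)) ≠ 0 := Ring.two_ne_zero (ringChar_zmod_ne_two hodd p)
    have htrace : Algebra.trace ℤ (𝓞 K) 1 = 2 := by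
      rw [← map_one (algebraMap ℤ (𝓞 K)), Algebra.trace_algebraMap,
        NumberField.RingOfIntegers.rank, hK, nsmul_one, Nat.cast_ofNat]
    rw [htrace, Int.cast_ofNat, div_self htwo]
  map_zero' := by simp
  map_add' a b := by
    rw [map_add, Int.cast_add, add_div]
  map_mul' a b := by
    have htwo : (2 : ZMod (p : ℕ)) ≠ 0 := Ring.two_ne_zero (ringChar_zmod_ne_two hodd p)
    have hD : ((D : ℕ) : ZMod (p : ℕ)) = 0 :=
      (ZMod.natCast_eq_zero_iff _ _).mpr (Nat.dvd_of_mem_primeFactors p.2)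
    obtain ⟨k, hk⟩ := hδ.trace_mul_trace a b
    have hmod := congrArg (Int.cast : ℤ → ZMod (p : ℕ)) hk
    push_cast at hmod
    rw [hD] at hmod
    field_simp
    linear_combination -hmod

lemma two_mul_red (a : 𝓞 K) :
    2 * hδ.red hodd hK p a = (Algebra.trace ℤ (𝓞 K) a : ZMod (p : ℕ)) :=
  mul_div_cancel₀ _ (Ring.two_ne_zero (ringChar_zmod_ne_two hodd p))

lemma red_star {a b : 𝓞 K} (hab : (b : K) = star (a : K)) :
    hδ.red hodd hK p b = hδ.red hodd hK p a := by
  have htrace : Algebra.trace ℤ (𝓞 K) b = Algebra.trace ℤ (𝓞 K) a := by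
    refine Int.cast_injective (α := K) ?_
    rw [hδ.intCast_trace, hδ.intCast_trace, hab, star_star, add_comm]
  change (Algebra.trace ℤ (𝓞 K) b : ZMod (p : ℕ)) / 2 = (Algebra.trace ℤ (𝓞 K) a : ZMod (p : ℕ)) / 2
  rw [htrace]

lemma red_delta {d : 𝓞 K} (hd : (d : K) = δ) : hδ.red hodd hK p d = 0 := by
  have hD : ((D : ℕ) : ZMod (p : ℕ)) = 0 :=
    (ZMod.natCast_eq_zero_iff _ _).mpr (Nat.dvd_of_mem_primeFactors p.2)
  have hsq : d ^ 2 = -(D : 𝓞 K) := by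
    apply NumberField.RingOfIntegers.ext
    simpa only [map_pow, map_neg, map_natCast, ← hd] using hδ.sq
  have hred := congrArg (hδ.red hodd hK p) hsq
  rw [map_pow, map_neg, map_natCast, hD, neg_zero] at hred
  exact pow_eq_zero_iff two_ne_zero |>.mp hred

lemma red_mul_delta {a b : 𝓞 K} (hab : (b : K) = δ * a) : hδ.red hodd hK p b = 0 := by
  obtain ⟨d, hd⟩ : ∃ d : 𝓞 K, (d : K) = δ := ⟨⟨δ, hδ.isIntegral⟩, rfl⟩
  have hb : b = d * a := NumberField.RingOfIntegers.ext <| by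
    simpa only [map_mul, ← hd] using hab
  rw [hb, map_mul, hδ.red_delta hodd hK p hd, zero_mul]

end Reduction

end IsDifferentGenerator

end Quadratic

/-! ### Orthogonal families modulo a prime -/

section Orthogonal

variable {R M F : Type*} [CommRing R] [AddCommGroup M] [Module R M] [Field F] [Algebra R F]
variable {β : M →ₗ[R] M →ₗ[R] F}

/-- An orthogonal family of anisotropic vectors, for a bilinear form with values in a field over
which the module need not be defined. -/
structure IsOrthogonalFamily {ι : Type*} (β : M →ₗ[R] M →ₗ[R] F) (x : ι → M) : Prop where
  orthogonal : ∀ i j, i ≠ j → β (x i) (x j) = 0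
  anisotropic : ∀ i, β (x i) (x i) ≠ 0

lemma IsOrthogonalFamily.sub_sum_apply {ι : Type*} [Fintype ι] {x : ι → M}
    (hx : IsOrthogonalFamily β x) (z : M) {c : ι → R}
    (hc : ∀ i, algebraMap R F (c i) = β z (x i) / β (x i) (x i)) (j : ι) :
    β (z - ∑ i, c i • x i) (x j) = 0 := by
  rw [map_sub, LinearMap.sub_apply, map_sum, LinearMap.sum_apply,
    Finset.sum_eq_single_of_mem j (Finset.mem_univ j)]
  · rw [map_smul, LinearMap.smul_apply, Algebra.smul_def, hc j,
      div_mul_cancel₀ _ (hx.anisotropic j), sub_self]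
  · intro i _ hij
    rw [map_smul, LinearMap.smul_apply, hx.orthogonal i j hij, smul_zero]

lemma anisotropic_or_of_apply_ne_zero (htwo : (2 : F) ≠ 0) (hsymm : ∀ x y, β x y = β y x)
    {y z : M} (hyz : β y z ≠ 0) : β y y ≠ 0 ∨ β z z ≠ 0 ∨ β (y + z) (y + z) ≠ 0 := by
  by_contra! hall
  obtain ⟨hy, hz, hadd⟩ := hall
  rw [map_add, map_add, LinearMap.add_apply, LinearMap.add_apply, hy, hz, hsymm z y, zero_add,
    add_zero, ← two_mul] at hadd
  exact hyz ((mul_eq_zero.mp hadd).resolve_left htwo)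

lemma IsOrthogonalFamily.snoc (hsymm : ∀ x y, β x y = β y x) {m : ℕ} {x : Fin m → M}
    (hx : IsOrthogonalFamily β x) {w : M} (hw : ∀ i, β w (x i) = 0) (hww : β w w ≠ 0) :
    IsOrthogonalFamily β (Fin.snoc x w : Fin (m + 1) → M) where
  orthogonal i j hij := by
    induction i using Fin.lastCases with
    | last =>
      induction j using Fin.lastCases with
      | last => exact absurd rfl hij
      | cast j => rw [Fin.snoc_last, Fin.snoc_castSucc, hw]
    | cast i =>
      induction j using Fin.lastCases with
      | last => rw [Fin.snoc_last, Fin.snoc_castSucc, hsymm, hw]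
      | cast j =>
        rw [Fin.snoc_castSucc, Fin.snoc_castSucc]
        exact hx.orthogonal i j fun h => hij (congrArg _ h)
  anisotropic i := by
    induction i using Fin.lastCases with
    | last => rwa [Fin.snoc_last]
    | cast i => simpa only [Fin.snoc_castSucc] using hx.anisotropic i

lemma IsOrthogonalFamily.exists_snoc (hsurj : Function.Surjective (algebraMap R F))
    (htwo : (2 : F) ≠ 0) (hsymm : ∀ x y, β x y = β y x) {m : ℕ} {x : Fin m → M}
    (hx : IsOrthogonalFamily β x) {y z : M} (hy : ∀ i, β y (x i) = 0) (hyz : β y z ≠ 0) :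
    ∃ w, IsOrthogonalFamily β (Fin.snoc x w : Fin (m + 1) → M) := by
  choose c hc using fun i => hsurj (β z (x i) / β (x i) (x i))
  have hz' := hx.sub_sum_apply z hc
  set z' := z - ∑ i, c i • x i with hz'_def
  have hyz' : β y z' ≠ 0 := by
    simpa only [hz'_def, map_sub, map_sum, map_smul, hy, smul_zero, Finset.sum_const_zero, sub_zero]
      using hyz
  rcases anisotropic_or_of_apply_ne_zero htwo hsymm hyz' with hyy | hzz | hadd
  · exact ⟨y, hx.snoc hsymm hy hyy⟩
  · exact ⟨z', hx.snoc hsymm hz' hzz⟩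
  · refine ⟨y + z', hx.snoc hsymm (fun i => ?_) hadd⟩
    rw [map_add, LinearMap.add_apply, hy, hz', add_zero]

lemma exists_maximal_isOrthogonalFamily (hsurj : Function.Surjective (algebraMap R F))
    (htwo : (2 : F) ≠ 0) (hsymm : ∀ x y, β x y = β y x) {N : ℕ}
    (hN : ∀ m, ∀ x : Fin m → M, IsOrthogonalFamily β x → m ≤ N) :
    ∃ (m : ℕ) (x : Fin m → M), IsOrthogonalFamily β x ∧
      ∀ y, (∀ i, β y (x i) = 0) → ∀ z, β y z = 0 := by
  by_contra! hcon
  have hlength : ∀ m, ∃ x : Fin m → M, IsOrthogonalFamily β x := by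
    intro m
    induction m with
    | zero => exact ⟨Fin.elim0, ⟨fun i => i.elim0, fun i => i.elim0⟩⟩
    | succ m ih =>
      obtain ⟨x, hx⟩ := ih
      obtain ⟨y, hy, z, hyz⟩ := hcon m x hx
      exact ⟨_, (hx.exists_snoc hsurj htwo hsymm hy hyz).choose_spec⟩
  obtain ⟨x, hx⟩ := hlength (N + 1)
  exact absurd (hN _ x hx) (by omega)

end Orthogonal

/-! ### Self-dual lattices -/

section LatticeForm

variable {K : Type*} [Field K] [StarRing K]
variable {V : Type*} [AddCommGroup V] [Module K V]
variable {h : V →ₗ[K] V →ₛₗ[starRingEnd K] K} {L : AddSubgroup V}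

/-- The hermitian form on a self-dual lattice, with its values in `𝓞 K`. -/
def latticeForm (hL : IsSelfDualLattice h L) : L →ₗ[ℤ] L →ₗ[ℤ] 𝓞 K :=
  LinearMap.mk₂ ℤ (fun x y => ⟨h x y, (hL.mem_iff x).mp x.2 y y.2⟩)
    (fun x x' y => by ext; change h (x + x' : V) y = _; rw [map_add]; rfl)
    (fun c x y => by
      ext; change h ((c • x : L) : V) y = algebraMap (𝓞 K) K (c • _)
      rw [AddSubgroup.coe_zsmul, map_zsmul]; rfl)
    (fun x y y' => by ext; change h x (y + y' : V) = _; rw [map_add]; rfl)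
    (fun c x y => by
      ext; change h x ((c • y : L) : V) = algebraMap (𝓞 K) K (c • _)
      rw [AddSubgroup.coe_zsmul, map_zsmul]; rfl)

lemma coe_latticeForm (hL : IsSelfDualLattice h L) (x y : L) :
    ((latticeForm hL x y : 𝓞 K) : K) = h x y := rfl

lemma form_star_smul (a : K) (x y : V) : h x (star a • y) = h x y * a := by
  rw [map_smulₛₗ, smul_eq_mul, starRingEnd_apply, star_star, mul_comm]

lemma IsSelfDualLattice.star_smul_mem (hL : IsSelfDualLattice h L) (a : 𝓞 K) {y : V}
    (hy : y ∈ L) : star (a : K) • y ∈ L :=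
  hL.smul_mem ⟨star (a : K), isIntegral_star a.isIntegral_coe⟩ y hy

lemma exists_latticeForm_eq_mul (hL : IsSelfDualLattice h L) (x y : L) (a : 𝓞 K) :
    ∃ y' : L, latticeForm hL x y' = latticeForm hL x y * a :=
  ⟨⟨star (a : K) • y, hL.star_smul_mem a y.2⟩,
    NumberField.RingOfIntegers.ext (form_star_smul (a : K) (x : V) y)⟩

end LatticeForm

section Lattice

variable {K : Type*} [Field K] [NumberField K] [StarRing K]
variable {V : Type*} [AddCommGroup V] [Module K V]
variable {h : V →ₗ[K] V →ₛₗ[starRingEnd K] K} {L : AddSubgroup V}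
variable {D : ℕ} {δ : K}

lemma IsSelfDualLattice.delta_smul_mem (hL : IsSelfDualLattice h L)
    (hδ : IsDifferentGenerator D δ) {x : V} (hx : x ∈ L) : δ • x ∈ L :=
  hL.smul_mem ⟨δ, hδ.isIntegral⟩ x hx

lemma delta_smul_mem_of_mem_dualLattice (hL : IsSelfDualLattice h L)
    (hδ : IsDifferentGenerator D δ) {x : V} (hx : x ∈ dualLattice h L) : δ • x ∈ L := by
  rw [hL.mem_iff]
  intro y hy
  rw [map_smul, LinearMap.smul_apply, smul_eq_mul]
  refine hδ.dual _ fun a => ?_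
  rw [← form_star_smul]
  exact hx _ (hL.star_smul_mem a hy)

lemma mem_dualLattice_iff (hL : IsSelfDualLattice h L)
    (hδ : IsDifferentGenerator D δ) (hD : D ≠ 0) {x : V} : x ∈ dualLattice h L ↔ δ • x ∈ L := by
  refine ⟨delta_smul_mem_of_mem_dualLattice hL hδ, fun hx y hy => ?_⟩
  have hδ0 := hδ.ne_zero hD
  obtain ⟨k, hk⟩ := hδ.sub (latticeForm hL ⟨_, hx⟩ ⟨y, hy⟩) 1
  have hform : ((latticeForm hL ⟨_, hx⟩ ⟨y, hy⟩ : 𝓞 K) : K) = δ * h x y := by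
    rw [coe_latticeForm, map_smul, LinearMap.smul_apply, smul_eq_mul]
  simp only [hform, map_one, star_one, mul_one, one_mul, star_mul', hδ.star_eq] at hk
  refine ⟨k, (algebraMap ℚ K).injective ?_⟩
  rw [bilin, hδ.trace, map_intCast]
  exact mul_left_cancel₀ hδ0 (by linear_combination hk)

section ReducedForm

variable (hL : IsSelfDualLattice h L) (hδ : IsDifferentGenerator D δ) (hodd : Odd D)
  (hK : Module.finrank ℚ K = 2) (p : D.primeFactors)

/-- The hermitian form on a self-dual lattice modulo the ramified prime above `p`. -/
def redForm : L →ₗ[ℤ] L →ₗ[ℤ] ZMod (p : ℕ) :=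
  (latticeForm hL).compr₂ (hδ.red hodd hK p).toAddMonoidHom.toIntLinearMap

lemma redForm_apply (x y : L) :
    redForm hL hδ hodd hK p x y = hδ.red hodd hK p (latticeForm hL x y) := rfl

lemma redForm_symm (hherm : ∀ x y : V, h y x = star (h x y)) (x y : L) :
    redForm hL hδ hodd hK p x y = redForm hL hδ hodd hK p y x :=
  hδ.red_star hodd hK p (by rw [coe_latticeForm, coe_latticeForm, hherm])

lemma redForm_delta_smul {x x' : L} (hx : (x' : V) = δ • (x : V)) (y : L) :
    redForm hL hδ hodd hK p x' y = 0 := by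
  refine hδ.red_mul_delta hodd hK p (a := latticeForm hL x y) ?_
  rw [coe_latticeForm, coe_latticeForm, hx, map_smul, LinearMap.smul_apply, smul_eq_mul]

variable {hL hδ hodd hK}

lemma dvd_trace_latticeForm {x : L} (hx : ∀ p (y : L), redForm hL hδ hodd hK p x y = 0) (y : L) :
    (D : ℤ) ∣ Algebra.trace ℤ (𝓞 K) (latticeForm hL x y) := by
  rw [Int.natCast_dvd, ← Nat.prod_primeFactors_of_squarefree (hδ.squarefree hodd)]
  refine Finset.prod_primes_dvd _ (fun p hp => (Nat.prime_of_mem_primeFactors hp).prime)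
    fun p hp => ?_
  rw [← Int.natCast_dvd, ← ZMod.intCast_zmod_eq_zero_iff_dvd, ← hδ.two_mul_red hodd hK ⟨p, hp⟩,
    ← redForm_apply, hx, mul_zero]

lemma exists_eq_delta_smul {x : L} (hx : ∀ p (y : L), redForm hL hδ hodd hK p x y = 0) :
    ∃ x' ∈ L, (x : V) = δ • x' := by
  have hδ0 := hδ.ne_zero hodd.pos.ne'
  refine ⟨δ⁻¹ • (x : V), ?_, by rw [smul_smul, mul_inv_cancel₀ hδ0, one_smul]⟩
  rw [hL.mem_iff]
  intro y hy
  rw [map_smul, LinearMap.smul_apply, smul_eq_mul, inv_mul_eq_div]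
  refine hδ.isIntegral_div_of_dvd_trace hodd.pos.ne' (x := latticeForm hL x ⟨y, hy⟩) fun a => ?_
  obtain ⟨y', hy'⟩ := exists_latticeForm_eq_mul hL x ⟨y, hy⟩ a
  rw [← hy']
  exact dvd_trace_latticeForm hx y'

variable {p}

lemma exists_eq_smul_add_delta_smul {y : L} (hy : ∀ z, redForm hL hδ hodd hK p y z = 0) :
    ∃ u ∈ L, ∃ v ∈ L, (y : V) = (p : ℕ) • u + δ • v := by
  set q : ℕ := D / p
  obtain ⟨v, hv, hyv⟩ := exists_eq_delta_smul (hL := hL) (hδ := hδ) (hodd := hodd) (hK := hK)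
    (x := q • y) fun p' z => by
      rw [map_nsmul, LinearMap.smul_apply]
      rcases eq_or_ne p' p with rfl | hne
      · rw [hy, smul_zero]
      · rw [nsmul_eq_mul, natCast_cofactor_eq_zero hne, zero_mul]
  have hbezout : (1 : ℤ) = p * Nat.gcdA p q + q * Nat.gcdB p q := by
    rw [← Nat.gcd_eq_gcd_ab, (coprime_cofactor (hδ.squarefree hodd) p).symm.gcd_eq_one,
      Nat.cast_one]
  refine ⟨Nat.gcdA p q • (y : V), L.zsmul_mem y.2 _, Nat.gcdB p q • v, L.zsmul_mem hv _, ?_⟩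
  rw [smul_comm δ, ← hyv, AddSubgroup.coe_nsmul, ← natCast_zsmul, ← natCast_zsmul, smul_smul,
    smul_smul, ← add_smul, mul_comm _ (q : ℤ), ← hbezout, one_smul]

end ReducedForm

end Lattice

section LocalBasis

lemma span_le_of_forall_exists_add_nsmul {K V : Type*} [Field K] [CharZero K] [AddCommGroup V]
    [Module K V] {L : AddSubgroup V} (hL : L.FG) {W : Submodule K V} {p : ℕ} (hp : p ≠ 1)
    (hLW : ∀ y ∈ L, ∃ w ∈ W, ∃ u ∈ L, y = w + p • u) : Submodule.span K (L : Set V) ≤ W := by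
  let proj : V →ₗ[ℤ] V ⧸ W := W.mkQ.restrictScalars ℤ
  have hproj {w : V} : proj w = 0 ↔ w ∈ W := Submodule.Quotient.mk_eq_zero W
  let N : Submodule ℤ (V ⧸ W) := (AddSubgroup.toIntSubmodule L).map proj
  have hfg : N.FG := Submodule.FG.map _ <| by simpa [Submodule.fg_iff_addSubgroup_fg] using hL
  have hN : N ≤ Ideal.span {(p : ℤ)} • N := by
    rintro _ ⟨y, hy, rfl⟩
    obtain ⟨w, hw, u, hu, rfl⟩ := hLW y hy
    rw [map_add, hproj.mpr hw, zero_add, ← natCast_zsmul, map_zsmul]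
    exact Submodule.smul_mem_smul (Ideal.mem_span_singleton_self _) ⟨u, hu, rfl⟩
  obtain ⟨r, hr, hrN⟩ := Submodule.exists_sub_one_mem_and_smul_eq_zero_of_fg_of_le_smul
    (Ideal.span {(p : ℤ)}) N hfg hN
  have hr0 : r ≠ 0 := by
    rintro rfl
    rw [Ideal.mem_span_singleton, zero_sub, dvd_neg] at hr
    exact hp (Nat.dvd_one.mp (by exact_mod_cast hr))
  rw [Submodule.span_le]
  intro y hy
  have hry : r • y ∈ W := by
    rw [← hproj, map_zsmul]
    exact hrN _ ⟨y, hy, rfl⟩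
  rw [← Int.cast_smul_eq_zsmul K] at hry
  exact (W.smul_mem_iff (Int.cast_ne_zero.mpr hr0)).mp hry

variable {K : Type*} [Field K] [NumberField K] [StarRing K]
variable {V : Type*} [AddCommGroup V] [Module K V]
variable {h : V →ₗ[K] V →ₛₗ[starRingEnd K] K} {L : AddSubgroup V}
variable {D : ℕ} {δ : K}
variable {hL : IsSelfDualLattice h L} {hδ : IsDifferentGenerator D δ} {hodd : Odd D}
  {hK : Module.finrank ℚ K = 2} {p : D.primeFactors} {m : ℕ} {x : Fin m → L}

lemma red_det_gram (hx : IsOrthogonalFamily (redForm hL hδ hodd hK p) x) :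
    hδ.red hodd hK p (Matrix.det (Matrix.of fun i j => latticeForm hL (x i) (x j))) =
      ∏ i, redForm hL hδ hodd hK p (x i) (x i) := by
  rw [RingHom.map_det, ← Matrix.det_diagonal]
  congr 1
  ext i j
  rcases eq_or_ne i j with rfl | hij
  · rw [Matrix.diagonal_apply_eq]
    rfl
  · rw [Matrix.diagonal_apply_ne _ hij]
    exact hx.orthogonal i j hij

lemma IsOrthogonalFamily.linearIndependent
    (hx : IsOrthogonalFamily (redForm hL hδ hodd hK p) x) :
    LinearIndependent K (fun i => (x i : V)) := by
  rw [Fintype.linearIndependent_iff]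
  intro c hc
  have hdet : Matrix.det (Matrix.of fun i j => latticeForm hL (x i) (x j)) ≠ 0 := by
    intro hzero
    have hprod := red_det_gram hx
    rw [hzero, map_zero] at hprod
    exact Finset.prod_ne_zero_iff.mpr (fun i _ => hx.anisotropic i) hprod.symm
  have hdetK : Matrix.det (Matrix.of fun i j => h (x i) (x j)) ≠ 0 := by
    have hmap : Matrix.det (Matrix.of fun i j => h (x i) (x j)) =
        algebraMap (𝓞 K) K (Matrix.det (Matrix.of fun i j => latticeForm hL (x i) (x j))) := by
      rw [RingHom.map_det]
      rfl
    rw [hmap]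
    exact (map_ne_zero_iff _ NumberField.RingOfIntegers.coe_injective).mpr hdet
  refine congrFun (Matrix.eq_zero_of_vecMul_eq_zero hdetK ?_)
  ext j
  have hform := congrArg (fun v => h v (x j)) hc
  simpa [Matrix.vecMul, dotProduct, map_sum, LinearMap.sum_apply] using hform

lemma exists_eq_add_smul_add_delta_smul (hx : IsOrthogonalFamily (redForm hL hδ hodd hK p) x)
    (hmax : ∀ y, (∀ i, redForm hL hδ hodd hK p y (x i) = 0) →
      ∀ z, redForm hL hδ hodd hK p y z = 0) {y : V} (hy : y ∈ L) :
    ∃ w ∈ Submodule.span K (Set.range fun i => (x i : V)), ∃ u ∈ L, ∃ v ∈ L,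
      y = w + (p : ℕ) • u + δ • v := by
  choose c hc using fun i => ZMod.intCast_surjective
    (redForm hL hδ hodd hK p (⟨y, hy⟩ : L) (x i) / redForm hL hδ hodd hK p (x i) (x i))
  obtain ⟨u, hu, v, hv, huv⟩ :=
    exists_eq_smul_add_delta_smul (hmax _ (hx.sub_sum_apply (⟨y, hy⟩ : L) hc))
  refine ⟨∑ i, c i • (x i : V), ?_, u, hu, v, hv, ?_⟩
  · exact Submodule.sum_mem _ fun i _ => zsmul_mem (Submodule.subset_span (Set.mem_range_self i)) _
  · rw [add_assoc, ← huv]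
    push_cast
    abel

lemma exists_eq_add_smul (hx : IsOrthogonalFamily (redForm hL hδ hodd hK p) x)
    (hmax : ∀ y, (∀ i, redForm hL hδ hodd hK p y (x i) = 0) →
      ∀ z, redForm hL hδ hodd hK p y z = 0) {y : V} (hy : y ∈ L) :
    ∃ w ∈ Submodule.span K (Set.range fun i => (x i : V)), ∃ u ∈ L, y = w + (p : ℕ) • u := by
  obtain ⟨w, hw, u, hu, v, hv, rfl⟩ := exists_eq_add_smul_add_delta_smul hx hmax hy
  obtain ⟨w', hw', u', hu', v', hv', rfl⟩ := exists_eq_add_smul_add_delta_smul hx hmax hv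
  refine ⟨w + δ • w', add_mem hw (Submodule.smul_mem _ _ hw'), u + δ • u' - (D / p) • v',
    L.sub_mem (L.add_mem hu (hL.delta_smul_mem hδ hu')) (L.nsmul_mem hv' _), ?_⟩
  have hsq : δ • δ • v' = -((p : ℕ) • (D / p) • v') := by
    rw [smul_smul, smul_smul, Nat.mul_div_cancel' (Nat.dvd_of_mem_primeFactors p.2), ← sq, hδ.sq,
      neg_smul, Nat.cast_smul_eq_nsmul]
  rw [smul_add, smul_add, hsq, smul_sub, smul_add, smul_comm δ]
  abel

lemma span_eq_top_of_maximal (hx : IsOrthogonalFamily (redForm hL hδ hodd hK p) x)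
    (hmax : ∀ y, (∀ i, redForm hL hδ hodd hK p y (x i) = 0) →
      ∀ z, redForm hL hδ hodd hK p y z = 0) :
    Submodule.span K (Set.range fun i => (x i : V)) = ⊤ := by
  rw [eq_top_iff, ← hL.span_eq_top]
  exact span_le_of_forall_exists_add_nsmul hL.fg (Nat.prime_of_mem_primeFactors p.2).ne_one
    fun y hy => exists_eq_add_smul hx hmax hy

variable {n : ℕ}

/-- A family in `L` which is a `K`-basis of `V` and reduces to an orthogonal basis of the quotient
of `L` by the radical of its form modulo the ramified prime above `p`. -/
structure IsLocalBasis (hL : IsSelfDualLattice h L) (hδ : IsDifferentGenerator D δ)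
    (hodd : Odd D) (hK : Module.finrank ℚ K = 2) (p : D.primeFactors) (x : Fin n → L) : Prop where
  orthogonal : IsOrthogonalFamily (redForm hL hδ hodd hK p) x
  radical : ∀ y, (∀ i, redForm hL hδ hodd hK p y (x i) = 0) →
      ∀ z, redForm hL hδ hodd hK p y z = 0
  span : Submodule.span K (Set.range fun i => (x i : V)) = ⊤

lemma exists_isLocalBasis (hL : IsSelfDualLattice h L) (hδ : IsDifferentGenerator D δ)
    (hodd : Odd D) (hK : Module.finrank ℚ K = 2) (p : D.primeFactors)
    (b : Module.Basis (Fin n) K V) (hherm : ∀ x y : V, h y x = star (h x y)) :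
    ∃ x : Fin n → L, IsLocalBasis hL hδ hodd hK p x := by
  have hfinrank : Module.finrank K V = n := by
    rw [Module.finrank_eq_card_basis b, Fintype.card_fin]
  have : Module.Finite K V := Module.Finite.of_basis b
  obtain ⟨m, x, hx, hmax⟩ := exists_maximal_isOrthogonalFamily (N := n)
    ZMod.intCast_surjective (Ring.two_ne_zero (ringChar_zmod_ne_two hodd p))
    (redForm_symm hL hδ hodd hK p hherm) fun m x hx => by
      have hcard := hx.linearIndependent.fintype_card_le_finrank
      rwa [Fintype.card_fin, hfinrank] at hcard
  have hspan := span_eq_top_of_maximal hx hmax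
  obtain rfl : m = n := by
    have hcard := finrank_span_eq_card hx.linearIndependent
    rwa [hspan, finrank_top, hfinrank, Fintype.card_fin, eq_comm] at hcard
  exact ⟨x, hx, hmax, hspan⟩

end LocalBasis

/-! ### Hilbert symbols -/

section Hilbert

variable {p : ℕ} [Fact p.Prime]

lemma norm_intCast_eq_one {d : ℤ} (hd : (d : ZMod p) ≠ 0) : ‖(d : ℤ_[p])‖ = 1 := by
  refine (PadicInt.norm_le_one _).eq_of_not_lt fun hlt => hd ?_
  rwa [PadicInt.norm_intCast_lt_one_iff, ← ZMod.intCast_zmod_eq_zero_iff_dvd] at hlt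

lemma norm_sq_ne_norm_mul_sq {E : ℚ_[p]} (hE : ‖E‖ = (p : ℝ)⁻¹) {x y : ℚ_[p]} (hy : y ≠ 0) :
    ‖x ^ 2‖ ≠ ‖E * y ^ 2‖ := by
  have hp : (1 : ℝ) < p := by exact_mod_cast (Fact.out : p.Prime).one_lt
  have hE0 : E ≠ 0 := norm_pos_iff.mp (hE ▸ by positivity)
  rcases eq_or_ne x 0 with rfl | hx
  · simpa [eq_comm] using ⟨hE0, hy⟩
  · rw [norm_mul, norm_pow, norm_pow, hE, Padic.norm_eq_zpow_neg_valuation hx,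
      Padic.norm_eq_zpow_neg_valuation hy, ← zpow_neg_one, ← zpow_natCast, ← zpow_natCast,
      ← zpow_mul, ← zpow_mul, ← zpow_add₀ (by positivity)]
    intro heq
    have hval := zpow_right_injective₀ (by positivity) hp.ne' heq
    push_cast at hval
    omega

lemma norm_le_one_and_norm_mul_sq_lt_one {E : ℚ_[p]} (hE : ‖E‖ = (p : ℝ)⁻¹) {x y : ℚ_[p]}
    (hxy : ‖x ^ 2 + E * y ^ 2‖ = 1) : ‖x‖ ≤ 1 ∧ ‖E * y ^ 2‖ < 1 := by
  rcases eq_or_ne y 0 with rfl | hy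
  · rw [zero_pow two_ne_zero, mul_zero, add_zero, norm_pow] at hxy
    exact ⟨((pow_eq_one_iff_of_nonneg (norm_nonneg _) two_ne_zero).mp hxy).le, by simp⟩
  · rw [Padic.add_eq_max_of_ne (norm_sq_ne_norm_mul_sq hE hy)] at hxy
    have hx : ‖x ^ 2‖ ≤ 1 := hxy ▸ le_max_left _ _
    rw [norm_pow, pow_le_one_iff_of_nonneg (norm_nonneg _) two_ne_zero] at hx
    have hEy : ‖E * y ^ 2‖ ≤ 1 := hxy ▸ le_max_right _ _
    have hne : ‖(1 : ℚ_[p]) ^ 2‖ ≠ ‖E * y ^ 2‖ := norm_sq_ne_norm_mul_sq hE hy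
    rw [one_pow, norm_one] at hne
    exact ⟨hx, hEy.lt_of_ne hne.symm⟩

lemma isSquare_intCast_of_eq_add {E : ℚ_[p]} (hE : ‖E‖ = (p : ℝ)⁻¹) {d : ℤ}
    (hd : (d : ZMod p) ≠ 0) {x y : ℚ_[p]} (hxy : (d : ℚ_[p]) = x ^ 2 + E * y ^ 2) :
    IsSquare (d : ZMod p) := by
  have hnorm : ‖x ^ 2 + E * y ^ 2‖ = 1 := hxy ▸ norm_intCast_eq_one hd
  obtain ⟨hx, hEy⟩ := norm_le_one_and_norm_mul_sq_lt_one hE hnorm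
  let z : ℤ_[p] := ⟨x, hx⟩
  have hz : (d - z * z : ℤ_[p]) ∈ RingHom.ker (PadicInt.toZMod (p := p)) := by
    rw [PadicInt.ker_toZMod, IsLocalRing.mem_maximalIdeal, PadicInt.mem_nonunits, PadicInt.norm_def]
    push_cast
    rwa [hxy, ← sq, add_sub_cancel_left]
  refine ⟨PadicInt.toZMod z, ?_⟩
  rwa [RingHom.mem_ker, map_sub, map_mul, map_intCast, sub_eq_zero] at hz

lemma exists_sq_eq_intCast (hp : Odd p) {d : ℤ} (hd : (d : ZMod p) ≠ 0)
    (hsq : IsSquare (d : ZMod p)) : ∃ z : ℤ_[p], z ^ 2 = d := by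
  obtain ⟨a, ha⟩ := hsq
  obtain ⟨k, rfl⟩ := ZMod.intCast_surjective a
  have hk : ‖(k : ℤ_[p])‖ = 1 := norm_intCast_eq_one fun hk => hd (by rw [ha, hk, mul_zero])
  have htwo : ‖(2 : ℤ_[p])‖ = 1 :=
    PadicInt.norm_natCast_eq_one_iff.mpr (Nat.coprime_two_right.mpr hp)
  have hlt : ‖(k ^ 2 - d : ℤ_[p])‖ < 1 := by
    rw [← Int.cast_pow, ← Int.cast_sub, PadicInt.norm_intCast_lt_one_iff,
      ← ZMod.intCast_zmod_eq_zero_iff_dvd]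
    push_cast
    rw [ha, sq, sub_self]
  obtain ⟨z, hz, -⟩ := hensels_lemma (p := p) (R := ℤ_[p])
    (F := Polynomial.X ^ 2 - Polynomial.C (d : ℤ_[p])) (a := (k : ℤ_[p]))
    (by simpa [one_add_one_eq_two, htwo, hk] using hlt)
  exact ⟨z, by simpa [sub_eq_zero] using hz⟩

lemma isSquare_intCast_of_isotropic {E : ℚ_[p]} (hE : ‖E‖ = (p : ℝ)⁻¹) {d : ℤ}
    (hd : (d : ZMod p) ≠ 0) {s t : ℚ_[p]} (hst : s ^ 2 + E * t ^ 2 ≠ 0) {x y z : ℚ_[p]}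
    (hne : x ≠ 0 ∨ y ≠ 0 ∨ z ≠ 0) (hxyz : z ^ 2 = d * (s ^ 2 + E * t ^ 2) * x ^ 2 + -E * y ^ 2) :
    IsSquare (d : ZMod p) := by
  have hx : x ≠ 0 := by
    rintro rfl
    have hz : z ^ 2 = -(E * y ^ 2) := by linear_combination hxyz
    obtain rfl : y = 0 := by
      by_contra hy
      exact norm_sq_ne_norm_mul_sq hE (x := z) hy (by rw [hz, norm_neg])
    simp_all
  -- `d x² (s² + E t²) = z² + E y²`, and norms from `ℚ_p(√-E)` are closed under division.
  refine isSquare_intCast_of_eq_add hE hd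
    (x := (s * z - E * t * y) / (x * (s ^ 2 + E * t ^ 2)))
    (y := (s * y + t * z) / (x * (s ^ 2 + E * t ^ 2))) ?_
  field_simp
  linear_combination (-(s ^ 2 + E * t ^ 2)) * hxyz

lemma hilbertSymbol_mul_norm (hp : Odd p) {E : ℚ_[p]} (hE : ‖E‖ = (p : ℝ)⁻¹) {d : ℤ}
    (hd : (d : ZMod p) ≠ 0) {s t : ℚ_[p]} (hst : s ^ 2 + E * t ^ 2 ≠ 0) :
    hilbertSymbol p (d * (s ^ 2 + E * t ^ 2)) (-E) = quadraticChar (ZMod p) d := by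
  classical
  rw [hilbertSymbol, quadraticChar_apply, quadraticCharFun, if_neg hd]
  refine if_congr ⟨?_, fun hsq => ?_⟩ rfl rfl
  · rintro ⟨x, y, z, hne, hxyz⟩
    exact isSquare_intCast_of_isotropic hE hd hst hne hxyz
  · obtain ⟨w, hw⟩ := exists_sq_eq_intCast hp hd hsq
    have hw' : (w : ℚ_[p]) ^ 2 = d := by exact_mod_cast congrArg (fun z : ℤ_[p] => (z : ℚ_[p])) hw
    refine ⟨1, w * t, w * s, Or.inl one_ne_zero, ?_⟩
    linear_combination (s ^ 2 + E * t ^ 2) * hw'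

lemma norm_mul_natCast {q : ℕ} (hq : q.Coprime p) : ‖((q * p : ℕ) : ℚ_[p])‖ = (p : ℝ)⁻¹ := by
  rw [Nat.cast_mul, norm_mul, Padic.norm_p, Padic.norm_natCast_eq_one_iff.mpr hq.symm, one_mul]

lemma hilbertSymbol_mul_natCast (hp : Odd p) {q : ℕ} (hq : q.Coprime p) :
    hilbertSymbol p ((q * p : ℕ) : ℚ_[p]) p = quadraticChar (ZMod p) (-q) := by
  have hp0 : (p : ℚ_[p]) ≠ 0 := by exact_mod_cast (Fact.out : p.Prime).ne_zero
  have hq0 : ((-q : ℤ) : ZMod p) ≠ 0 := by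
    push_cast
    exact neg_ne_zero.mpr (natCast_ne_zero_of_coprime hq)
  -- `q p = (-q) (0² - p 1²)`
  convert hilbertSymbol_mul_norm hp (E := -p) (s := 0) (t := 1) (by rw [norm_neg, Padic.norm_p])
    hq0 (by simpa using hp0) using 2
  · push_cast
    ring
  · ring
  · push_cast
    rfl

end Hilbert

/-! ### The local invariants of a self-dual lattice -/

section Gamma

lemma inv_epsilon_mul {p : ℕ} [Fact p.Prime] (hp : Odd p) :
    (epsilon p)⁻¹ * quadChar (ZMod p) (-1) = epsilon p := by
  rw [quadChar_apply, quadraticChar_neg_one (ringChar_zmod_ne_two_of_odd hp), ZMod.card,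
    epsilon]
  rcases Nat.odd_mod_four_iff.mp (Nat.odd_iff.mp hp) with hmod | hmod
  · simp [hmod, ZMod.χ₄_nat_one_mod_four hmod]
  · simp [hmod, ZMod.χ₄_nat_three_mod_four hmod]

lemma quadGauss_mulShift_div_sqrt {p : ℕ} [Fact p.Prime] (hp : Odd p) {q : ZMod p} (hq : q ≠ 0)
    {a : ZMod p} (ha : a ≠ 0) :
    quadGauss ((ZMod.stdAddChar (N := p)).mulShift (q⁻¹ * a)) / ((√(p : ℕ) : ℝ) : ℂ) =
      (epsilon p)⁻¹ * quadChar (ZMod p) (-q) * quadChar (ZMod p) a := by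
  have hsqrt : ((√(p : ℕ) : ℝ) : ℂ) ≠ 0 := by
    rw [Complex.ofReal_ne_zero, Real.sqrt_ne_zero']
    exact_mod_cast hp.pos
  rw [quadGauss]
  simp only [AddChar.mulShift_apply]
  rw [sum_addChar_mul_sq (ringChar_zmod_ne_two_of_odd hp) (ZMod.isPrimitive_stdAddChar _)
      (mul_ne_zero (inv_ne_zero hq) ha), quadGauss, sum_stdAddChar_sq hp, mul_div_assoc,
    mul_div_cancel_left₀ _ hsqrt, map_mul, quadChar_inv, ← neg_one_mul q, map_mul]
  linear_combination (-(quadChar (ZMod p) q) * quadChar (ZMod p) a) * inv_epsilon_mul hp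

section Gram

variable {R V ι : Type*} [CommRing R] [StarRing R] [AddCommGroup V] [Module R V]
  [Fintype ι] [DecidableEq ι]

lemma det_gram_eq_mul (h : V →ₗ[R] V →ₛₗ[starRingEnd R] R) (b b' : Module.Basis ι R V) :
    Matrix.det (Matrix.of fun i j => h (b i) (b j)) =
      b'.det b * star (b'.det b) * Matrix.det (Matrix.of fun i j => h (b' i) (b' j)) := by
  have hgram : (Matrix.of fun i j => h (b i) (b j)) = (b'.toMatrix b).transpose *
      (Matrix.of fun i j => h (b' i) (b' j)) * (starRingEnd R).mapMatrix (b'.toMatrix b) := by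
    ext i j
    rw [Matrix.of_apply, ← b'.sum_toMatrix_smul_self b i, ← b'.sum_toMatrix_smul_self b j]
    simp only [map_sum, LinearMap.sum_apply, map_smul, LinearMap.smul_apply, map_smulₛₗ,
      Matrix.mul_apply, Matrix.transpose_apply, Matrix.of_apply, RingHom.mapMatrix_apply,
      Matrix.map_apply, Finset.sum_mul, smul_eq_mul, Finset.mul_sum]
    exact Finset.sum_congr rfl fun _ _ => Finset.sum_congr rfl fun _ _ => by ring
  rw [hgram, Matrix.det_mul, Matrix.det_mul, Matrix.det_transpose, ← RingHom.map_det,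
    starRingEnd_apply, Module.Basis.det_apply]
  ring

lemma star_det_gram {h : V →ₗ[R] V →ₛₗ[starRingEnd R] R}
    (hherm : ∀ x y : V, h y x = star (h x y)) (x : ι → V) :
    star (Matrix.det (Matrix.of fun i j => h (x i) (x j))) =
      Matrix.det (Matrix.of fun i j => h (x i) (x j)) := by
  rw [← starRingEnd_apply, RingHom.map_det, ← Matrix.det_transpose]
  congr 1
  ext i j
  exact (hherm _ _).symm

end Gram

variable {K : Type*} [Field K] [NumberField K] [StarRing K]
variable {V : Type*} [AddCommGroup V] [Module K V]
variable {h : V →ₗ[K] V →ₛₗ[starRingEnd K] K} {L : AddSubgroup V}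
variable {D n : ℕ} {δ : K}

lemma gramDet_eq_of_det_eq (hK : Module.finrank ℚ K = 2) {b : Module.Basis (Fin n) K V} {q : ℚ}
    (hq : Matrix.det (Matrix.of fun i j => h (b i) (b j)) = (q : K)) : gramDet h b = q := by
  rw [gramDet, hq, ← eq_ratCast (algebraMap ℚ K), Algebra.trace_algebraMap, hK]
  simp

variable {hL : IsSelfDualLattice h L} {hδ : IsDifferentGenerator D δ} {hodd : Odd D}
  {hK : Module.finrank ℚ K = 2} {p : D.primeFactors} {x : Fin n → L}

lemma IsOrthogonalFamily.exists_int_det_gram (hherm : ∀ x y : V, h y x = star (h x y))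
    (hx : IsOrthogonalFamily (redForm hL hδ hodd hK p) x) :
    ∃ d : ℤ, Matrix.det (Matrix.of fun i j => h (x i) (x j)) = d ∧
      (d : ZMod (p : ℕ)) = ∏ i, redForm hL hδ hodd hK p (x i) (x i) := by
  set Δ : 𝓞 K := Matrix.det (Matrix.of fun i j => latticeForm hL (x i) (x j)) with hΔ
  have hcoe : Matrix.det (Matrix.of fun i j => h (x i) (x j)) = (Δ : K) := by
    rw [NumberField.RingOfIntegers.coe_eq_algebraMap, hΔ, RingHom.map_det]
    rfl
  obtain ⟨d, hd⟩ := hδ.exists_int_of_star_eq (hcoe ▸ star_det_gram hherm fun i => (x i : V))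
  have hdΔ : Δ = d := NumberField.RingOfIntegers.ext (by simpa using hd)
  exact ⟨d, hcoe.trans hd, by rw [← red_det_gram hx, ← hΔ, hdΔ, map_intCast]⟩

lemma localInvariant_eq (hherm : ∀ x y : V, h y x = star (h x y))
    (hx : IsLocalBasis hL hδ hodd hK p x) (b : Module.Basis (Fin n) K V) :
    localInvariant h D b (p : ℕ) =
      quadraticChar (ZMod (p : ℕ)) (∏ i, redForm hL hδ hodd hK p (x i) (x i)) := by
  let b' := Module.Basis.mk hx.orthogonal.linearIndependent hx.span.ge
  obtain ⟨d, hd, hdp⟩ := hx.orthogonal.exists_int_det_gram hherm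
  have hd0 : (d : ZMod (p : ℕ)) ≠ 0 :=
    hdp ▸ Finset.prod_ne_zero_iff.mpr fun i _ => hx.orthogonal.anisotropic i
  obtain ⟨u, v, huv⟩ := hδ.mul_star_eq hodd.pos.ne' (b'.det b)
  have hN : (u ^ 2 + D * v ^ 2 : ℚ) ≠ 0 := by
    intro hzero
    rw [hzero, Rat.cast_zero, mul_eq_zero, star_eq_zero, or_self] at huv
    exact (b'.isUnit_det b).ne_zero huv
  have hgram : gramDet h b = d * (u ^ 2 + D * v ^ 2) := by
    refine gramDet_eq_of_det_eq hK ?_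
    rw [det_gram_eq_mul h b b', huv]
    simp only [b', Module.Basis.mk_apply, hd]
    push_cast
    ring
  have hnorm : ‖(D : ℚ_[p])‖ = ((p : ℕ) : ℝ)⁻¹ := by
    rw [← norm_mul_natCast (coprime_cofactor (hδ.squarefree hodd) p),
      Nat.div_mul_cancel (Nat.dvd_of_mem_primeFactors p.2)]
  rw [localInvariant, hgram, ← hdp, ← hilbertSymbol_mul_norm (s := u) (t := v)
    (hodd.of_dvd_nat (Nat.dvd_of_mem_primeFactors p.2)) hnorm hd0 (by exact_mod_cast hN)]
  push_cast
  rfl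

lemma gammaPrime_eq (hherm : ∀ x y : V, h y x = star (h x y))
    (hx : IsLocalBasis hL hδ hodd hK p x) (b : Module.Basis (Fin n) K V) :
    gammaPrime h D b (p : ℕ) = ∏ j, (quadGauss ((ZMod.stdAddChar (N := (p : ℕ))).mulShift
      (((D / p : ℕ) : ZMod (p : ℕ))⁻¹ * redForm hL hδ hodd hK p (x j) (x j))) /
        ((√(p : ℕ) : ℝ) : ℂ)) := by
  have hp : Odd (p : ℕ) := hodd.of_dvd_nat (Nat.dvd_of_mem_primeFactors p.2)
  have hco := coprime_cofactor (hδ.squarefree hodd) p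
  have hhilbert : hilbertSymbol p (D : ℚ_[p]) ((p : ℕ) : ℚ_[p]) =
      quadraticChar (ZMod (p : ℕ)) (-(D / p : ℕ)) := by
    rw [← hilbertSymbol_mul_natCast hp hco, Nat.div_mul_cancel (Nat.dvd_of_mem_primeFactors p.2)]
  rw [Finset.prod_congr rfl fun j _ => quadGauss_mulShift_div_sqrt hp
      (natCast_ne_zero_of_coprime hco) (hx.orthogonal.anisotropic j),
    Finset.prod_mul_distrib, Finset.prod_const, Finset.card_univ, Fintype.card_fin, gammaPrime,
    localInvariant_eq hherm hx b, hhilbert, mul_pow, inv_pow, ← map_prod, quadChar_apply,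
    quadChar_apply]

end Gamma

/-! ### Diagonalization of the discriminant form -/

lemma addChar_sum_eq_prod {A M ι : Type*} [AddCommMonoid A] [CommMonoid M] (ψ : AddChar A M)
    (s : Finset ι) (f : ι → A) : ψ (∑ i ∈ s, f i) = ∏ i ∈ s, ψ (f i) := by
  have hprod := map_prod ψ.toMonoidHom (fun i => Multiplicative.ofAdd (f i)) s
  rwa [← ofAdd_sum] at hprod

section PartialFractions

variable {D : ℕ}

lemma dvd_sum_mul_cofactor_sub_one (hD : Squarefree D) {v : D.primeFactors → ℤ}
    (hv : ∀ p : D.primeFactors, (v p : ZMod (p : ℕ)) = ((D / p : ℕ) : ZMod (p : ℕ))⁻¹) :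
    (D : ℤ) ∣ ∑ p : D.primeFactors, v p * (D / p : ℕ) - 1 := by
  rw [Int.natCast_dvd]
  refine (Nat.prod_primeFactors_of_squarefree hD).symm.dvd.trans <| Finset.prod_primes_dvd _
    (fun p hp => (Nat.prime_of_mem_primeFactors hp).prime) fun p hp => ?_
  rw [← Int.natCast_dvd, ← ZMod.intCast_zmod_eq_zero_iff_dvd]
  simp only [Int.cast_sub, Int.cast_sum, Int.cast_mul, Int.cast_natCast, Int.cast_one]
  rw [Finset.sum_eq_single ⟨p, hp⟩]
  · have := Fact.mk (Nat.prime_of_mem_primeFactors hp)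
    rw [hv ⟨p, hp⟩, sub_eq_zero]
    exact inv_mul_cancel₀ (natCast_ne_zero_of_coprime (coprime_cofactor hD ⟨p, hp⟩))
  · intro q _ hqp
    rw [natCast_cofactor_eq_zero (q := ⟨p, hp⟩) hqp.symm, mul_zero]
  · simp

lemma e_intCast_div (N : ℤ) (p : ℕ) [NeZero p] :
    e ((N : ℂ) / p) = ZMod.stdAddChar (N : ZMod p) := by
  rw [ZMod.stdAddChar_coe, e, mul_div_assoc]

lemma e_div_eq_prod (hD : Squarefree D) (N : ℤ) :
    e (N / D) = ∏ p : D.primeFactors,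
      ZMod.stdAddChar (((D / p : ℕ) : ZMod (p : ℕ))⁻¹ * (N : ZMod (p : ℕ))) := by
  have hD0 : (D : ℂ) ≠ 0 := by exact_mod_cast hD.ne_zero
  choose v hv using fun p : D.primeFactors =>
    ZMod.intCast_surjective (((D / p : ℕ) : ZMod (p : ℕ))⁻¹)
  obtain ⟨k, hk⟩ := dvd_sum_mul_cofactor_sub_one hD hv
  have hterm (p : D.primeFactors) :
      ((v p * N : ℤ) / (p : ℕ) : ℂ) = v p * (D / p : ℕ) * (N / D) := by
    have hp0 : ((p : ℕ) : ℂ) ≠ 0 := by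
      exact_mod_cast (Nat.prime_of_mem_primeFactors p.2).ne_zero
    rw [Nat.cast_div (Nat.dvd_of_mem_primeFactors p.2) hp0]
    push_cast
    field_simp
  have hsum : (N / D : ℂ) =
      ∑ p : D.primeFactors, ((v p * N : ℤ) / (p : ℕ) : ℂ) + ((-(k * N) : ℤ) : ℂ) := by
    have hk' : ∑ p : D.primeFactors, (v p : ℂ) * (D / p : ℕ) - 1 = D * k := by
      simpa only [Int.cast_sub, Int.cast_sum, Int.cast_mul, Int.cast_natCast, Int.cast_one] using
        congrArg (Int.cast : ℤ → ℂ) hk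
    rw [Finset.sum_congr rfl fun p _ => hterm p, ← Finset.sum_mul, sub_eq_iff_eq_add.mp hk']
    push_cast
    field_simp
    ring
  rw [hsum, e_add, e_intCast, mul_one, e_sum]
  refine Finset.prod_congr rfl fun p _ => ?_
  rw [e_intCast_div, Int.cast_mul, hv]

end PartialFractions

section Diagonalize

variable {K : Type*} [Field K] [NumberField K] [StarRing K]
variable {V : Type*} [AddCommGroup V] [Module K V]
variable {h : V →ₗ[K] V →ₛₗ[starRingEnd K] K} {L : AddSubgroup V}
variable {D n : ℕ} {δ : K}

lemma IsLocalBasis.redForm_eq {hL : IsSelfDualLattice h L} {hδ : IsDifferentGenerator D δ}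
    {hodd : Odd D} {hK : Module.finrank ℚ K = 2} {p : D.primeFactors} {x : Fin n → L}
    (hx : IsLocalBasis hL hδ hodd hK p x) (hherm : ∀ x y : V, h y x = star (h x y)) (y z : L) :
    redForm hL hδ hodd hK p y z = ∑ j, redForm hL hδ hodd hK p (x j) (x j) *
      (redForm hL hδ hodd hK p y (x j) / redForm hL hδ hodd hK p (x j) (x j)) *
      (redForm hL hδ hodd hK p z (x j) / redForm hL hδ hodd hK p (x j) (x j)) := by
  choose c hc using fun i => ZMod.intCast_surjective
    (redForm hL hδ hodd hK p y (x i) / redForm hL hδ hodd hK p (x i) (x i))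
  have hyz := hx.radical _ (hx.orthogonal.sub_sum_apply y hc) z
  rw [map_sub, LinearMap.sub_apply, sub_eq_zero, map_sum, LinearMap.sum_apply] at hyz
  rw [hyz]
  refine Finset.sum_congr rfl fun j _ => ?_
  have hxj := hx.orthogonal.anisotropic j
  rw [map_zsmul, LinearMap.smul_apply, zsmul_eq_mul, hc,
    redForm_symm hL hδ hodd hK p hherm (x j) z]
  field_simp

/-- Multiplication by the generator `δ` of the different, from `L'` to `L`. -/
def deltaSMul (hL : IsSelfDualLattice h L) (hδ : IsDifferentGenerator D δ) :
    dualLattice h L →+ L where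
  toFun y := ⟨δ • (y : V), delta_smul_mem_of_mem_dualLattice hL hδ y.2⟩
  map_zero' := by ext; simp
  map_add' y z := by ext; simp

/-- The coordinates of `δy`, for `y ∈ L'`, in orthogonal bases modulo the ramified primes. -/
def discCoord (hL : IsSelfDualLattice h L) (hδ : IsDifferentGenerator D δ) (hodd : Odd D)
    (hK : Module.finrank ℚ K = 2) (x : D.primeFactors → Fin n → L) :
    dualLattice h L →+ (∀ i : PrimeIdx D n, ZMod (i.1 : ℕ)) where
  toFun y i := redForm hL hδ hodd hK i.1 (deltaSMul hL hδ y) (x i.1 i.2) /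
    redForm hL hδ hodd hK i.1 (x i.1 i.2) (x i.1 i.2)
  map_zero' := by ext; simp
  map_add' y z := by
    ext i
    rw [Pi.add_apply, map_add, map_add, LinearMap.add_apply, add_div]

variable {hL : IsSelfDualLattice h L} {hδ : IsDifferentGenerator D δ} {hodd : Odd D}
  {hK : Module.finrank ℚ K = 2} {x : D.primeFactors → Fin n → L}

lemma discCoord_apply (y : dualLattice h L) (i : PrimeIdx D n) :
    discCoord hL hδ hodd hK x y i =
      redForm hL hδ hodd hK i.1 (deltaSMul hL hδ y) (x i.1 i.2) /
        redForm hL hδ hodd hK i.1 (x i.1 i.2) (x i.1 i.2) := rfl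

lemma discCoord_ker (hx : ∀ p, IsLocalBasis hL hδ hodd hK p (x p)) :
    (discCoord hL hδ hodd hK x).ker = L.addSubgroupOf (dualLattice h L) := by
  ext y
  rw [AddMonoidHom.mem_ker, AddSubgroup.mem_addSubgroupOf]
  refine ⟨fun hy => ?_, fun hy => ?_⟩
  · obtain ⟨y', hy', hyy'⟩ := exists_eq_delta_smul (x := deltaSMul hL hδ y) fun p =>
      (hx p).radical _ fun j =>
        (div_eq_zero_iff.mp (congrFun hy (p, j))).resolve_right ((hx p).orthogonal.anisotropic j)
    rwa [show (y : V) = y' from smul_right_injective V (hδ.ne_zero hodd.pos.ne') hyy']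
  · ext i
    rw [discCoord_apply, redForm_delta_smul hL hδ hodd hK i.1 (x := ⟨y, hy⟩) rfl, zero_div,
      Pi.zero_apply]

lemma deltaSMul_surjective (hD : D ≠ 0) : Function.Surjective (deltaSMul hL hδ) := by
  intro y
  have hy : δ • δ⁻¹ • (y : V) = y := smul_inv_smul₀ (hδ.ne_zero hD) _
  exact ⟨⟨δ⁻¹ • (y : V), (mem_dualLattice_iff hL hδ hD).mpr (hy.symm ▸ y.2)⟩, Subtype.ext hy⟩

lemma discCoord_surjective (hx : ∀ p, IsLocalBasis hL hδ hodd hK p (x p)) :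
    Function.Surjective (discCoord hL hδ hodd hK x) := by
  intro t
  choose k hk using fun i : PrimeIdx D n =>
    ZMod.intCast_surjective (((D / i.1 : ℕ) : ZMod (i.1 : ℕ))⁻¹ * t i)
  obtain ⟨y, hy⟩ := deltaSMul_surjective (hL := hL) (hδ := hδ) hodd.pos.ne'
    (∑ i : PrimeIdx D n, (k i * (D / i.1 : ℕ)) • x i.1 i.2)
  refine ⟨y, ?_⟩
  ext ⟨p, j⟩
  rw [discCoord_apply, hy, div_eq_iff ((hx p).orthogonal.anisotropic j), map_sum,
    LinearMap.sum_apply, Finset.sum_eq_single (p, j)]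
  · have hcofactor := natCast_ne_zero_of_coprime (coprime_cofactor (hδ.squarefree hodd) p)
    rw [map_zsmul, LinearMap.smul_apply, zsmul_eq_mul, Int.cast_mul, Int.cast_natCast, hk]
    field_simp
  · rintro ⟨q, j'⟩ - hne
    rw [map_zsmul, LinearMap.smul_apply, zsmul_eq_mul]
    rcases eq_or_ne p q with rfl | hpq
    · rw [(hx p).orthogonal.orthogonal j' j fun hj => hne (by rw [hj]), mul_zero]
    · rw [Int.cast_mul, Int.cast_natCast, natCast_cofactor_eq_zero hpq, mul_zero, zero_mul]
  · simp

/-- The coordinates on `L'/L` given by orthogonal bases modulo the ramified primes. -/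
def discEquiv (hx : ∀ p, IsLocalBasis hL hδ hodd hK p (x p)) :
    DiscGroup h L ≃+ (∀ i : PrimeIdx D n, ZMod (i.1 : ℕ)) :=
  (QuotientAddGroup.quotientAddEquivOfEq (discCoord_ker hx).symm).trans
    (QuotientAddGroup.quotientKerEquivOfSurjective _ (discCoord_surjective hx))

lemma discEquiv_apply (hx : ∀ p, IsLocalBasis hL hδ hodd hK p (x p)) (μ : DiscGroup h L) :
    discEquiv hx μ = discCoord hL hδ hodd hK x μ.out := by
  conv_lhs => rw [← Quotient.out_eq μ]
  rfl

lemma coe_latticeForm_deltaSMul (y z : dualLattice h L) :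
    (latticeForm hL (deltaSMul hL hδ y) (deltaSMul hL hδ z) : K) = D * h (y : V) (z : V) := by
  have hdelta (w : dualLattice h L) : (deltaSMul hL hδ w : V) = δ • (w : V) := rfl
  rw [coe_latticeForm, hdelta, hdelta, LinearMap.map_smul, LinearMap.smul_apply,
    LinearMap.map_smulₛₗ, smul_eq_mul, smul_eq_mul, starRingEnd_apply, hδ.star_eq]
  linear_combination (-h (y : V) (z : V)) * hδ.sq

lemma discBilin_eq (hD : D ≠ 0) (μ ν : DiscGroup h L) :
    discBilin μ ν = (Algebra.trace ℤ (𝓞 K)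
      (latticeForm hL (deltaSMul hL hδ μ.out) (deltaSMul hL hδ ν.out)) : ℤ) / D := by
  rw [eq_div_iff (by exact_mod_cast hD), Algebra.coe_trace_int, coe_latticeForm_deltaSMul,
    ← nsmul_eq_mul, map_nsmul, nsmul_eq_mul, mul_comm]
  rfl

lemma exists_discQuad_eq (hD : D ≠ 0) (hK : Module.finrank ℚ K = 2)
    (hherm : ∀ x y : V, h y x = star (h x y)) (μ : DiscGroup h L) : ∃ N : ℤ, discQuad μ = N / D ∧
      latticeForm hL (deltaSMul hL hδ μ.out) (deltaSMul hL hδ μ.out) = N := by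
  obtain ⟨N, hN⟩ := hδ.exists_int_of_star_eq
    (a := latticeForm hL (deltaSMul hL hδ μ.out) (deltaSMul hL hδ μ.out))
    (by rw [coe_latticeForm, ← hherm])
  have hform : h (μ.out : V) (μ.out : V) = algebraMap ℚ K (N / D) := by
    have hD0 : (D : K) ≠ 0 := by exact_mod_cast hD
    rw [eq_ratCast, Rat.cast_div, Rat.cast_intCast, Rat.cast_natCast, eq_div_iff hD0, ← hN,
      coe_latticeForm_deltaSMul, mul_comm]
  refine ⟨N, ?_, NumberField.RingOfIntegers.ext (by simpa using hN)⟩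
  rw [discQuad, quad, bilin, hform, Algebra.trace_algebraMap, hK]
  simp

/-- The characters of the diagonalization of `L'/L` given by orthogonal bases modulo the ramified
primes. -/
def discChar (hL : IsSelfDualLattice h L) (hδ : IsDifferentGenerator D δ) (hodd : Odd D)
    (hK : Module.finrank ℚ K = 2) (x : D.primeFactors → Fin n → L) (i : PrimeIdx D n) :
    AddChar (ZMod (i.1 : ℕ)) ℂ :=
  ZMod.stdAddChar.mulShift (((D / i.1 : ℕ) : ZMod (i.1 : ℕ))⁻¹ *
    redForm hL hδ hodd hK i.1 (x i.1 i.2) (x i.1 i.2))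

lemma isPrimitive_discChar (hx : ∀ p, IsLocalBasis hL hδ hodd hK p (x p)) (i : PrimeIdx D n) :
    (discChar hL hδ hodd hK x i).IsPrimitive := by
  have hcofactor := natCast_ne_zero_of_coprime (coprime_cofactor (hδ.squarefree hodd) i.1)
  intro a ha
  rw [discChar, AddChar.mulShift_mulShift]
  exact ZMod.isPrimitive_stdAddChar _ (mul_ne_zero
    (mul_ne_zero (inv_ne_zero hcofactor) ((hx i.1).orthogonal.anisotropic i.2)) ha)

lemma e_div_eq_prod_discChar (hherm : ∀ x y : V, h y x = star (h x y))
    (hx : ∀ p, IsLocalBasis hL hδ hodd hK p (x p)) {μ ν : DiscGroup h L} {c N : ℤ}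
    (hN : ∀ p : D.primeFactors, (N : ZMod (p : ℕ)) = c * hδ.red hodd hK p
      (latticeForm hL (deltaSMul hL hδ μ.out) (deltaSMul hL hδ ν.out))) :
    e (N / D) = ∏ i, discChar hL hδ hodd hK x i (c * discEquiv hx μ i * discEquiv hx ν i) := by
  rw [e_div_eq_prod (hδ.squarefree hodd), Fintype.prod_prod_type]
  refine Finset.prod_congr rfl fun p _ => ?_
  rw [hN, ← redForm_apply, (hx p).redForm_eq hherm, Finset.mul_sum, Finset.mul_sum,
    addChar_sum_eq_prod]
  refine Finset.prod_congr rfl fun j _ => ?_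
  rw [discChar, AddChar.mulShift_apply, discEquiv_apply, discEquiv_apply, discCoord_apply,
    discCoord_apply]
  congr 1
  ring

lemma isDiagonalization_discEquiv (b : Module.Basis (Fin n) K V)
    (hherm : ∀ x y : V, h y x = star (h x y))
    (hx : ∀ p, IsLocalBasis hL hδ hodd hK p (x p)) :
    IsDiagonalization b (discEquiv hx) (discChar hL hδ hodd hK x) where
  primitive := isPrimitive_discChar hx
  quad μ := by
    obtain ⟨N, hμ, hN⟩ := exists_discQuad_eq (hL := hL) (hδ := hδ) hodd.pos.ne' hK hherm μ
    rw [hμ, Rat.cast_div, Rat.cast_intCast, Rat.cast_natCast,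
      e_div_eq_prod_discChar hherm hx (μ := μ) (ν := μ) (c := 1) fun p => by
        rw [hN, map_intCast, Int.cast_one, one_mul]]
    simp only [Int.cast_one, one_mul, sq]
  bilin μ ν := by
    rw [discBilin_eq (hL := hL) (hδ := hδ) hodd.pos.ne', Rat.cast_div, Rat.cast_intCast,
      Rat.cast_natCast, e_div_eq_prod_discChar hherm hx (μ := μ) (ν := ν) (c := 2) fun p => by
        rw [← hδ.two_mul_red hodd hK p, Int.cast_ofNat]]
    simp only [Int.cast_ofNat]
  gamma p := gammaPrime_eq hherm (hx p) b

lemma exists_isDiagonalization (b : Module.Basis (Fin n) K V)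
    (hherm : ∀ x y : V, h y x = star (h x y)) (hL : IsSelfDualLattice h L)
    (hδ : IsDifferentGenerator D δ) (hodd : Odd D) (hK : Module.finrank ℚ K = 2) :
    ∃ (θ : DiscGroup h L ≃+ (∀ i : PrimeIdx D n, ZMod (i.1 : ℕ)))
      (ψ : ∀ i : PrimeIdx D n, AddChar (ZMod (i.1 : ℕ)) ℂ), IsDiagonalization b θ ψ := by
  choose x hx using fun p => exists_isLocalBasis hL hδ hodd hK p b hherm
  exact ⟨_, _, isDiagonalization_discEquiv b hherm hx⟩

end Diagonalize

/-! ### Uniqueness and averaging of `q`-expansions -/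

section QExpansion

open Filter

lemma norm_e (z : ℂ) : ‖e z‖ = Real.exp (-(2 * π * z.im)) := by
  simp [e, Complex.norm_exp, mul_comm]

lemma e_natCast_mul (r : ℕ) (x : ℂ) : e (r * x) = e x ^ r := by
  rw [e, e, ← Complex.exp_nat_mul]
  ring_nf

lemma e_ratCast_eq_one_iff (x : ℚ) : e x = 1 ↔ ∃ j : ℤ, x = j := by
  rw [e, Complex.exp_eq_one_iff]
  refine exists_congr fun j => ?_
  rw [mul_comm (j : ℂ), mul_right_inj' Complex.two_pi_I_ne_zero]
  exact_mod_cast Iff.rfl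

lemma norm_e_mul_I (m : ℚ) (y : ℝ) : ‖e (m * (y * Complex.I))‖ = Real.exp (-(2 * π * (m * y))) := by
  rw [norm_e, ← Complex.ofReal_ratCast, Complex.im_ofReal_mul]
  simp

lemma tendsto_e_mul_I_atTop {m : ℚ} (hm : 0 < m) :
    Tendsto (fun y : ℝ => e (m * (y * Complex.I))) atTop (nhds 0) := by
  rw [tendsto_zero_iff_norm_tendsto_zero]
  simp only [norm_e_mul_I]
  exact Real.tendsto_exp_neg_atTop_nhds_zero.comp <|
    (tendsto_id.const_mul_atTop (Rat.cast_pos.mpr hm)).const_mul_atTop (by positivity)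

lemma tendsto_tsum_mul_e_atTop {a : ℚ → ℂ} (ha : ∀ m, a m ≠ 0 → 0 ≤ m)
    (hsum : Summable fun m : ℚ => a m * e (m * ((1 : ℝ) * Complex.I))) :
    Tendsto (fun y : ℝ => ∑' m : ℚ, a m * e (m * (y * Complex.I))) atTop (nhds (a 0)) := by
  rw [← tsum_ite_eq (0 : ℚ) a]
  refine tendsto_tsum_of_dominated_convergence hsum.norm (fun m => ?_) ?_
  · rcases lt_trichotomy m 0 with hm | rfl | hm
    · have ham : a m = 0 := by_contra fun h => hm.not_ge (ha m h)
      simp [ham, hm.ne]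
    · simp [e]
    · simpa [hm.ne'] using (tendsto_e_mul_I_atTop hm).const_mul (a m)
  · filter_upwards [eventually_ge_atTop 1] with y hy m
    rw [norm_mul, norm_mul, norm_e_mul_I, norm_e_mul_I]
    by_cases ham : a m = 0
    · simp [ham]
    · have hm : (0 : ℝ) ≤ m := by exact_mod_cast ha m ham
      gcongr

variable {N : ℕ} {g : ℍ → ℂ} {a : ℚ → ℂ}

lemma IsQExpansion.exists_isLeast_support (hN : N ≠ 0) (ha : IsQExpansion N g a) (hne : a ≠ 0) :
    ∃ m, IsLeast (Function.support a) m := by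
  have hN' : (0 : ℚ) < N := by exact_mod_cast Nat.pos_of_ne_zero hN
  have heq : ∀ {m : ℚ} {j : ℤ}, m * N = j → m = j / N := fun h => eq_div_of_mul_eq hN'.ne' h
  obtain ⟨m, hm⟩ := Function.ne_iff.mp hne
  obtain ⟨j, hj⟩ := ha.support m hm
  obtain ⟨M, hM⟩ := ha.bounded_below
  obtain ⟨j₀, hj₀, hmin⟩ := Int.exists_least_of_bdd (P := fun j : ℤ => a (j / N) ≠ 0)
    ⟨⌈M * N⌉, fun j hj => Int.ceil_le.mpr ((le_div_iff₀ hN').mp (hM _ hj))⟩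
    ⟨j, heq hj ▸ hm⟩
  refine ⟨j₀ / N, hj₀, fun m hm => ?_⟩
  obtain ⟨j, hj⟩ := ha.support m hm
  rw [heq hj] at hm ⊢
  exact div_le_div_of_nonneg_right (by exact_mod_cast hmin j hm) hN'.le

lemma IsQExpansion.eq_zero (hN : N ≠ 0) (ha : IsQExpansion N 0 a) : a = 0 := by
  by_contra hne
  obtain ⟨m₀, hm₀, hmin⟩ := ha.exists_isLeast_support hN hne
  have hshift : ∀ y : ℝ, 0 < y →
      HasSum (fun m : ℚ => a (m + m₀) * e (m * (y * Complex.I))) 0 := fun y hy => by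
    have hτ := (ha.hasSum ⟨y * Complex.I, by simpa using hy⟩).mul_right
      (e (-(m₀ * (y * Complex.I))))
    rw [Pi.zero_apply, zero_mul, ← (Equiv.addRight m₀).hasSum_iff] at hτ
    refine hτ.congr_fun fun m => ?_
    rw [Function.comp_apply, mul_assoc, ← e_add, Equiv.coe_addRight]
    push_cast
    ring_nf
  have hlim := tendsto_tsum_mul_e_atTop (a := fun m => a (m + m₀))
    (fun m hm => le_add_iff_nonneg_left m₀ |>.mp (hmin hm)) (hshift 1 one_pos).summable
  have hzero : Tendsto (fun y : ℝ => ∑' m : ℚ, a (m + m₀) * e (m * (y * Complex.I))) atTop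
      (nhds 0) := tendsto_const_nhds.congr' <| by
    filter_upwards [eventually_gt_atTop 0] with y hy using (hshift y hy).tsum_eq.symm
  exact hm₀ (by simpa using tendsto_nhds_unique hlim hzero)

lemma IsQExpansion.of_dvd {N' : ℕ} (hN : N ∣ N') (ha : IsQExpansion N g a) :
    IsQExpansion N' g a where
  support m hm := by
    obtain ⟨k, rfl⟩ := hN
    obtain ⟨j, hj⟩ := ha.support m hm
    exact ⟨j * k, by push_cast; rw [← hj, mul_assoc]⟩
  bounded_below := ha.bounded_below
  hasSum := ha.hasSum

lemma IsQExpansion.zero (N : ℕ) : IsQExpansion N 0 0 where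
  support _ hm := absurd rfl hm
  bounded_below := ⟨0, fun _ hm => absurd rfl hm⟩
  hasSum _ := by simp

lemma IsQExpansion.const_mul (ha : IsQExpansion N g a) (C : ℂ) :
    IsQExpansion N (fun τ => C * g τ) (fun m => C * a m) where
  support m hm := ha.support m (right_ne_zero_of_mul hm)
  bounded_below := ha.bounded_below.imp fun _ hM m hm => hM m (right_ne_zero_of_mul hm)
  hasSum τ := by simpa only [mul_assoc] using (ha.hasSum τ).mul_left C

lemma IsQExpansion.sub {g' : ℍ → ℂ} {a' : ℚ → ℂ} (ha : IsQExpansion N g a)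
    (ha' : IsQExpansion N g' a') : IsQExpansion N (g - g') (a - a') := by
  have hor : ∀ m, (a - a') m ≠ 0 → a m ≠ 0 ∨ a' m ≠ 0 := fun m hm => by
    contrapose! hm
    simp [hm]
  refine ⟨fun m hm => (hor m hm).elim (ha.support m) (ha'.support m), ?_, fun τ => ?_⟩
  · obtain ⟨M, hM⟩ := ha.bounded_below
    obtain ⟨M', hM'⟩ := ha'.bounded_below
    exact ⟨min M M', fun m hm => (hor m hm).elim (fun h => min_le_of_left_le (hM m h))
      fun h => min_le_of_right_le (hM' m h)⟩
  · simpa only [Pi.sub_apply, sub_mul] using (ha.hasSum τ).sub (ha'.hasSum τ)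

lemma IsQExpansion.sum {ι : Type*} (s : Finset ι) {g : ι → ℍ → ℂ} {a : ι → ℚ → ℂ}
    (ha : ∀ i ∈ s, IsQExpansion N (g i) (a i)) :
    IsQExpansion N (fun τ => ∑ i ∈ s, g i τ) (fun m => ∑ i ∈ s, a i m) where
  support m hm := by
    obtain ⟨i, hi, him⟩ := Finset.exists_ne_zero_of_sum_ne_zero hm
    exact (ha i hi).support m him
  bounded_below := by
    choose! M hM using fun i hi => (ha i hi).bounded_below
    obtain ⟨B, hB⟩ := (s.image M).bddBelow
    refine ⟨B, fun m hm => ?_⟩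
    obtain ⟨i, hi, him⟩ := Finset.exists_ne_zero_of_sum_ne_zero hm
    exact (hB (Finset.mem_coe.mpr (Finset.mem_image_of_mem M hi))).trans (hM i hi m him)
  hasSum τ := by
    simpa only [Finset.sum_mul] using hasSum_sum fun i hi => (ha i hi).hasSum τ

lemma IsQExpansion.unique {N' : ℕ} {a' : ℚ → ℂ} (hN : N ≠ 0) (hN' : N' ≠ 0)
    (ha : IsQExpansion N g a) (ha' : IsQExpansion N' g a') : a = a' := by
  have hsub := (ha.of_dvd (dvd_mul_right N N')).sub (ha'.of_dvd (dvd_mul_left N' N))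
  rw [sub_self] at hsub
  exact sub_eq_zero.mp (hsub.eq_zero (mul_ne_zero hN hN'))

lemma IsQExpansion.of_comp_mul {G : ℍ → ℂ} {r : ℕ} (hr : r ≠ 0) (ha : IsQExpansion N g a)
    (hG : ∀ τ τ' : ℍ, (τ' : ℂ) = r * τ → g τ = G τ') :
    IsQExpansion (N * r) G (fun m => a (m * r)) where
  support m hm := by
    obtain ⟨j, hj⟩ := ha.support _ hm
    exact ⟨j, by push_cast; rw [← hj]; ring⟩
  bounded_below := by
    obtain ⟨M, hM⟩ := ha.bounded_below
    have hr' : (0 : ℚ) < r := by exact_mod_cast Nat.pos_of_ne_zero hr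
    exact ⟨M / r, fun m hm => (div_le_iff₀ hr').mpr (hM _ hm)⟩
  hasSum τ := by
    have hr' : (0 : ℝ) < r := by exact_mod_cast Nat.pos_of_ne_zero hr
    have hrC : (r : ℂ) ≠ 0 := by exact_mod_cast hr
    let τ' : ℍ := ⟨(τ : ℂ) / r, by
      rw [← Complex.ofReal_natCast, Complex.div_ofReal_im]
      exact div_pos τ.im_pos hr'⟩
    have hτ' : (τ : ℂ) = r * τ' := (mul_div_cancel₀ (τ : ℂ) hrC).symm
    have hsum := ha.hasSum τ'
    rw [hG τ' τ hτ', ← (Equiv.mulRight₀ (r : ℚ) (by exact_mod_cast hr)).hasSum_iff] at hsum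
    refine hsum.congr_fun fun m => ?_
    rw [Function.comp_apply, Equiv.mulRight₀_apply, hτ']
    push_cast
    ring_nf

open Classical in
lemma sum_range_e_mul {r : ℕ} {x : ℚ} (hx : ∃ j : ℤ, r * x = j) :
    ∑ j ∈ Finset.range r, e (j * x) = if ∃ j : ℤ, x = j then (r : ℂ) else 0 := by
  simp only [e_natCast_mul, ← e_ratCast_eq_one_iff]
  split_ifs with he
  · simp [he]
  · have hpow : e x ^ r = 1 := by
      rw [← e_natCast_mul]
      exact_mod_cast (e_ratCast_eq_one_iff (r * x)).mpr hx
    have hgeom := geom_sum_mul (e x) r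
    rw [hpow, sub_self] at hgeom
    exact (mul_eq_zero.mp hgeom).resolve_right (sub_ne_zero.mpr he)

open Classical in
lemma IsQExpansion.sum_translates (ha : IsQExpansion N g a) {x : ℚ} (hx : ∃ j : ℤ, N * x = j) :
    IsQExpansion N (fun τ => ∑ j ∈ Finset.range N, e (j * x) * g ((j : ℝ) +ᵥ τ))
      (fun m => if ∃ j : ℤ, m + x = j then N * a m else 0) where
  support m hm := by
    split_ifs at hm
    · exact ha.support m (right_ne_zero_of_mul hm)
    · exact absurd rfl hm
  bounded_below := ha.bounded_below.imp fun M hM m hm => by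
    split_ifs at hm
    · exact hM m (right_ne_zero_of_mul hm)
    · exact absurd rfl hm
  hasSum τ := by
    have hterm := hasSum_sum fun (j : ℕ) (_ : j ∈ Finset.range N) =>
      (ha.hasSum ((j : ℝ) +ᵥ τ)).mul_left (e (j * x))
    refine hterm.congr_fun fun m => ?_
    have hsplit : ∀ j : ℕ, e (j * x) * (a m * e (m * (((j : ℝ) +ᵥ τ : ℍ) : ℂ))) =
        e (j * ((m + x : ℚ) : ℂ)) * (a m * e (m * τ)) := fun j => by
      rw [mul_left_comm, mul_left_comm (e (j * _)), ← e_add, ← e_add, UpperHalfPlane.coe_vadd]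
      push_cast
      ring_nf
    simp only [hsplit, ← Finset.sum_mul]
    by_cases ham : a m = 0
    · simp [ham]
    · obtain ⟨j, hj⟩ := ha.support m ham
      obtain ⟨k, hk⟩ := hx
      rw [sum_range_e_mul ⟨j + k, by push_cast; rw [← hj, ← hk]; ring⟩]
      split_ifs <;> ring

end QExpansion

/-! ### Representatives of `Γ₀(D) \ SL₂(ℤ)` -/

section Cosets

lemma sum_eq_sum_of_isComplement {G α M : Type*} [Group G] [AddCommMonoid M] {H : Subgroup G}
    {R : Finset G} (hR : Subgroup.IsComplement (H : Set G) (R : Set G)) {F : G → M}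
    (hF : ∀ γ ∈ H, ∀ g, F (γ * g) = F g) {I : Finset α} {s : α → G}
    (hs : ∀ g, ∃! i, i ∈ I ∧ g * (s i)⁻¹ ∈ H) : ∑ g ∈ R, F g = ∑ i ∈ I, F (s i) := by
  rw [Subgroup.isComplement_iff_existsUnique_mul_inv_mem] at hR
  have hsymm : ∀ {x y : G}, x * y⁻¹ ∈ H → y * x⁻¹ ∈ H := fun h => by simpa using H.inv_mem h
  have htrans : ∀ {x y z : G}, x * y⁻¹ ∈ H → y * z⁻¹ ∈ H → x * z⁻¹ ∈ H := fun h h' => by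
    simpa [mul_assoc] using H.mul_mem h h'
  choose i hi hi_unique using hs
  refine Finset.sum_bij (fun g _ => i g) (fun g _ => (hi g).1) (fun g hg g' hg' hgg' => ?_)
    (fun j hj => ?_) fun g _ => ?_
  · have hmem : g * g'⁻¹ ∈ H := htrans (hi g).2 (hgg' ▸ hsymm (hi g').2)
    exact congrArg Subtype.val
      ((hR g).unique (y₁ := ⟨g, hg⟩) (y₂ := ⟨g', hg'⟩) (by simp [H.one_mem]) hmem)
  · obtain ⟨⟨g, hg⟩, hgH, -⟩ := hR (s j)
    exact ⟨g, hg, (hi_unique g j ⟨hj, hsymm hgH⟩).symm⟩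
  · rw [← hF _ (hi g).2 (s (i g)), inv_mul_cancel_right]

lemma mul_dvd_bottom_row_iff {r s c d c' d' : ℤ} (hrs : IsCoprime r s) (hcd : IsCoprime c' d')
    (hs : s ∣ c') (hr : r ∣ d') (j : ℤ) :
    r * s ∣ c * (c' * j + d') - d * c' ↔ s ∣ c ∧ r ∣ c * j - d := by
  have hs_iff : s ∣ c * (c' * j + d') - d * c' ↔ s ∣ c := by
    rw [show c * (c' * j + d') - d * c' = c * d' + c' * (c * j - d) by ring,
      dvd_add_left (hs.mul_right _)]
    exact ⟨(hcd.of_isCoprime_of_dvd_left hs).dvd_of_dvd_mul_right, fun h => h.mul_right _⟩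
  have hr_iff : r ∣ c * (c' * j + d') - d * c' ↔ r ∣ c * j - d := by
    rw [show c * (c' * j + d') - d * c' = c' * (c * j - d) + d' * c by ring,
      dvd_add_left (hr.mul_right _)]
    exact ⟨(hcd.symm.of_isCoprime_of_dvd_left hr).dvd_of_dvd_mul_left, fun h => h.mul_left _⟩
  rw [← hs_iff, ← hr_iff, and_comm]
  exact ⟨fun h => ⟨(Dvd.intro _ rfl).trans h, (Dvd.intro_left _ rfl).trans h⟩,
    fun h => hrs.mul_dvd h.1 h.2⟩

lemma mem_Gamma0_iff_dvd {D : ℕ} {g : SL(2, ℤ)} :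
    g ∈ CongruenceSubgroup.Gamma0 D ↔ (D : ℤ) ∣ g 1 0 := by
  rw [CongruenceSubgroup.Gamma0_mem, ZMod.intCast_zmod_eq_zero_iff_dvd]

lemma mul_inv_mul_T_pow_mem_Gamma0_iff {D r s : ℕ} (hD : Squarefree D) (hrs : D = r * s)
    {R : SL(2, ℤ)} (hs : (s : ℤ) ∣ R 1 0) (hr : (r : ℤ) ∣ R 1 1) (g : SL(2, ℤ)) (j : ℕ) :
    g * (R * ModularGroup.T ^ j)⁻¹ ∈ CongruenceSubgroup.Gamma0 D ↔
      (s : ℤ) ∣ g 1 0 ∧ (r : ℤ) ∣ g 1 0 * j - g 1 1 := by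
  have hco : IsCoprime (r : ℤ) s :=
    Nat.isCoprime_iff_coprime.mpr (Nat.coprime_of_squarefree_mul (hrs ▸ hD))
  have hrow : (g * (R * ModularGroup.T ^ j)⁻¹) 1 0 =
      g 1 0 * (R 1 0 * j + R 1 1) - g 1 1 * R 1 0 := by
    rw [← zpow_natCast, Matrix.SpecialLinearGroup.coe_mul, Matrix.SpecialLinearGroup.coe_inv,
      Matrix.SpecialLinearGroup.coe_mul, ModularGroup.coe_T_zpow, Matrix.adjugate_fin_two]
    simp [Matrix.mul_apply, Fin.sum_univ_two, sub_eq_add_neg]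
  rw [mem_Gamma0_iff_dvd, hrow, hrs, Nat.cast_mul,
    mul_dvd_bottom_row_iff hco (R.isCoprime_row 1) hs hr]

lemma existsUnique_lt_dvd_mul_sub {r : ℕ} (hr : r ≠ 0) {c : ℤ} (hc : IsCoprime (r : ℤ) c) (d : ℤ) :
    ∃! j : ℕ, j < r ∧ (r : ℤ) ∣ c * j - d := by
  obtain ⟨u, v, huv⟩ := id hc
  obtain ⟨j, hjr, hj⟩ := Int.existsUnique_equiv_nat (v * d) (Int.natCast_pos.mpr hr.bot_lt)
  obtain ⟨k, hk⟩ := hj.symm.dvd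
  have hjd : (r : ℤ) ∣ c * j - d := ⟨c * k - u * d, by linear_combination c * hk + d * huv⟩
  refine ⟨j, ⟨by exact_mod_cast hjr, hjd⟩, fun i ⟨hir, hi⟩ => ?_⟩
  have hdvd : (r : ℤ) ∣ c * (i - j) := by
    rw [mul_sub, ← sub_sub_sub_cancel_right _ _ d]
    exact dvd_sub hi hjd
  have hlt : |(i : ℤ) - j| < r := Int.abs_sub_lt_of_lt_lt (by exact_mod_cast hjr) hir
  exact_mod_cast sub_eq_zero.mp (Int.eq_zero_of_abs_lt_dvd (hc.dvd_of_dvd_mul_left hdvd) hlt)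

lemma dvd_and_coprime_iff_eq_div_gcd {D r c : ℕ} (hD : Squarefree D) (hr : r ∣ D) :
    D / r ∣ c ∧ r.Coprime c ↔ r = D / D.gcd c := by
  constructor
  · rintro ⟨hs, hco⟩
    obtain ⟨s, rfl⟩ := hr
    obtain ⟨hr0, hs0⟩ := mul_ne_zero_iff.mp hD.ne_zero
    rw [Nat.mul_div_cancel_left _ hr0.bot_lt] at hs
    rw [hco.gcd_mul_left_cancel, Nat.gcd_eq_left hs, Nat.mul_div_cancel _ hs0.bot_lt]
  · rintro rfl
    have hgcd := Nat.gcd_dvd_left D c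
    have hco : (D / D.gcd c).Coprime (D.gcd c) :=
      Nat.coprime_of_squarefree_mul (by rwa [Nat.div_mul_cancel hgcd])
    refine ⟨by simpa only [Nat.div_div_self hgcd hD.ne_zero] using Nat.gcd_dvd_right D c, ?_⟩
    exact Nat.eq_one_of_dvd_coprimes hco (Nat.gcd_dvd_left _ _)
      (Nat.gcd_dvd_gcd_of_dvd_left c (Nat.div_dvd_of_dvd hgcd))

lemma existsUnique_divisor_residue {D : ℕ} (hD : Squarefree D) {c d : ℤ} (hcd : IsCoprime c d) :
    ∃! i : (_ : ℕ) × ℕ, i ∈ D.divisors.sigma Finset.range ∧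
      ((D / i.1 : ℕ) : ℤ) ∣ c ∧ (i.1 : ℤ) ∣ c * i.2 - d := by
  have hco : ∀ {r : ℕ} {j : ℤ}, (r : ℤ) ∣ c * j - d → IsCoprime (r : ℤ) c := fun {r j} ⟨k, hk⟩ => by
    obtain ⟨u, v, huv⟩ := hcd
    exact ⟨-(v * k), u + v * j, by linear_combination huv + v * hk⟩
  have hcop : ∀ {r : ℕ}, IsCoprime (r : ℤ) c ↔ r.Coprime c.natAbs := Int.isCoprime_iff_gcd_eq_one
  set r := D / D.gcd c.natAbs with hr
  have hrD : r ∣ D := Nat.div_dvd_of_dvd (Nat.gcd_dvd_left _ _)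
  obtain ⟨hdvd, hrc⟩ := (dvd_and_coprime_iff_eq_div_gcd hD hrD).mpr hr
  obtain ⟨j, ⟨hjr, hj⟩, hj_unique⟩ :=
    existsUnique_lt_dvd_mul_sub (ne_zero_of_dvd_ne_zero hD.ne_zero hrD) (hcop.mpr hrc) d
  simp only [Finset.mem_sigma, Nat.mem_divisors, Finset.mem_range, Int.natCast_dvd]
  refine ⟨⟨r, j⟩, ⟨⟨⟨hrD, hD.ne_zero⟩, hjr⟩, hdvd, Int.natCast_dvd.mp hj⟩, ?_⟩
  rintro ⟨r', j'⟩ ⟨⟨⟨hr', -⟩, hj'r⟩, hdvd', hj'⟩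
  rw [← Int.natCast_dvd] at hj'
  obtain rfl : r' = r := (dvd_and_coprime_iff_eq_div_gcd hD hr').mp ⟨hdvd', hcop.mp (hco hj')⟩
  exact congrArg _ (hj_unique j' ⟨hj'r, hj'⟩)

lemma existsUnique_mul_inv_mul_T_pow_mem_Gamma0 {D : ℕ} (hD : Squarefree D) {Q : ℕ → SL(2, ℤ)}
    (hQ : ∀ r ∈ D.divisors, ((D / r : ℕ) : ℤ) ∣ Q r 1 0 ∧ (r : ℤ) ∣ Q r 1 1) (g : SL(2, ℤ)) :
    ∃! i : (_ : ℕ) × ℕ, i ∈ D.divisors.sigma Finset.range ∧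
      g * (Q i.1 * ModularGroup.T ^ i.2)⁻¹ ∈ CongruenceSubgroup.Gamma0 D := by
  refine (existsUnique_congr fun i => and_congr_right fun hi => ?_).mpr
    (existsUnique_divisor_residue hD (g.isCoprime_row 1))
  have hi' := (Finset.mem_sigma.mp hi).1
  exact mul_inv_mul_T_pow_mem_Gamma0_iff hD
    (Nat.mul_div_cancel' (Nat.dvd_of_mem_divisors hi')).symm (hQ _ hi').1 (hQ _ hi').2 g i.2

end Cosets

/-! ### Expansions at the cusps -/

section Slash

lemma SL_slash_eq (k : ℤ) (f : ℍ → ℂ) (R : SL(2, ℤ)) (τ : ℍ) :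
    (f ∣[k] R) τ = f (R • τ) * ((R 1 0 : ℂ) * (τ : ℂ) + (R 1 1 : ℂ)) ^ (-k) := by
  rw [ModularForm.SL_slash_apply, ModularGroup.denom_apply]

lemma slash_mul_diag (k : ℤ) (f : ℍ → ℂ) (R : SL(2, ℤ)) (r : ℕ) {τ τ' : ℍ}
    (hτ : (τ' : ℂ) = r * τ) :
    slash k f ((R : Matrix (Fin 2) (Fin 2) ℤ) * !![(r : ℤ), 0; 0, 1]) τ =
      (((r : ℝ) ^ ((k : ℝ) / 2) : ℝ) : ℂ) * (f ∣[k] R) τ' := by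
  have hdet : ((R : Matrix (Fin 2) (Fin 2) ℤ) * !![(r : ℤ), 0; 0, 1]).det = r := by
    rw [Matrix.det_mul, R.det_coe, Matrix.det_fin_two_of]
    ring
  have hR : UpperHalfPlane.ofComplex
      (((R 0 0 : ℂ) * (τ' : ℂ) + (R 0 1 : ℂ)) / ((R 1 0 : ℂ) * (τ' : ℂ) + (R 1 1 : ℂ))) =
        R • τ' := by
    rw [← UpperHalfPlane.ofComplex_apply (R • τ'), UpperHalfPlane.coe_specialLinearGroup_apply]
    simp
  rw [slash, hdet, SL_slash_eq, ← hR, hτ]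
  simp [Matrix.mul_apply, Fin.sum_univ_two]
  ring_nf

lemma slash_mul_T_pow (k : ℤ) (f : ℍ → ℂ) (R : SL(2, ℤ)) (j : ℕ) (τ : ℍ) :
    (f ∣[k] (R * ModularGroup.T ^ j)) τ = (f ∣[k] R) ((j : ℝ) +ᵥ τ) := by
  rw [SlashAction.slash_mul, SL_slash_eq k _ (ModularGroup.T ^ j), ← zpow_natCast,
    UpperHalfPlane.modular_T_zpow_smul, ModularGroup.coe_T_zpow]
  simp

lemma IsQExpansion.slash_of_mul_diag {k : ℤ} {f : ℍ → ℂ} {R : SL(2, ℤ)} {r : ℕ} (hr : r ≠ 0)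
    {C : ℂ} {c : ℚ → ℂ} (hc : IsQExpansion 1 (fun τ => C *
      slash k f ((R : Matrix (Fin 2) (Fin 2) ℤ) * !![(r : ℤ), 0; 0, 1]) τ) c) :
    IsQExpansion r (fun τ => C * (((r : ℝ) ^ ((k : ℝ) / 2) : ℝ) : ℂ) * (f ∣[k] R) τ)
      (fun m => c (m * r)) := by
  rw [← one_mul r]
  simpa only [one_mul] using
    hc.of_comp_mul hr fun τ τ' hτ => by rw [slash_mul_diag k f R r hτ, mul_assoc]

lemma inv_mul_rpow_eq_inv_sqrt_pow {r : ℕ} (hr : r ≠ 0) (n : ℕ) :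
    (r : ℂ)⁻¹ * (((r : ℝ) ^ (((2 - (n : ℤ) : ℤ) : ℝ) / 2) : ℝ) : ℂ) =
      (((√r : ℝ) : ℂ) ^ n)⁻¹ := by
  have hr' : (0 : ℝ) < r := by exact_mod_cast Nat.pos_of_ne_zero hr
  have hreal : (r : ℝ)⁻¹ * (r : ℝ) ^ (((2 - (n : ℤ) : ℤ) : ℝ) / 2) = (√r ^ n)⁻¹ := by
    rw [Real.sqrt_eq_rpow, ← Real.rpow_natCast, ← Real.rpow_mul hr'.le, ← Real.rpow_neg hr'.le,
      ← Real.rpow_neg_one, ← Real.rpow_add hr']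
    congr 1
    push_cast
    ring
  have hcomplex := congrArg Complex.ofReal hreal
  rwa [Complex.ofReal_mul, Complex.ofReal_inv, Complex.ofReal_inv, Complex.ofReal_pow,
    Complex.ofReal_natCast] at hcomplex

variable {D n : ℕ}

lemma chi_one (n : ℕ) (a : ℤ) : chi n 1 a = 1 := by simp [chi]

lemma chi_mul_chi_of_dvd_lower_left {γ : SL(2, ℤ)} (hγ : (D : ℤ) ∣ γ 1 0) :
    chi n D (γ 0 0) * chi n D (γ 1 1) = 1 := by
  have hmod : γ 0 0 * γ 1 1 ≡ 1 [ZMOD D] := Int.modEq_iff_dvd.mpr <| by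
    convert! (hγ.mul_left (γ 0 1)).neg_right using 1
    linear_combination -sl2_det γ
  rw [chi, chi, ← mul_pow, ← Int.cast_mul, ← jacobiSym.mul_left, jacobiSym.mod_left' hmod,
    jacobiSym.one_left, Int.cast_one, one_pow]

variable {f : ℍ → ℂ}

lemma IsQExpansionAtCusp.eq_of_one (hf : IsWeaklyHolomorphicForm D n f) {c c' : ℚ → ℂ}
    (hc : IsQExpansion 1 f c) (hc' : IsQExpansionAtCusp D n f 1 c') : c' = c := by
  obtain ⟨R, hs, -, hq⟩ := hc'
  have hq' := hq.slash_of_mul_diag one_ne_zero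
  rw [Nat.div_one] at hs
  rw [hf.slash_eq R (mem_Gamma0_iff_dvd.mpr hs), Nat.div_one] at hq'
  refine IsQExpansion.unique one_ne_zero one_ne_zero ?_ hc
  simpa [chi_one, ← mul_assoc, chi_mul_chi_of_dvd_lower_left hs] using hq'

lemma notMem_Gamma0_of_dvd_lower_right {r : ℕ} (hr : r ∣ D) (hr1 : r ≠ 1) {R : SL(2, ℤ)}
    (hR : (r : ℤ) ∣ R 1 1) : R ∉ CongruenceSubgroup.Gamma0 D := by
  rw [mem_Gamma0_iff_dvd]
  intro hD
  have hunit := (R.isCoprime_row 1).isUnit_of_dvd' ((Int.natCast_dvd_natCast.mpr hr).trans hD) hR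
  exact hr1 (by simpa using Int.isUnit_iff_natAbs_eq.mp hunit)

lemma IsQExpansionAtCusp.eq_zero_of_neg (hf : IsWeaklyHolomorphicForm D n f) {r : ℕ}
    (hD : D ≠ 0) (hr : r ∣ D) (hr1 : r ≠ 1) {c : ℚ → ℂ} (hc : IsQExpansionAtCusp D n f r c) {m : ℚ}
    (hm : m < 0) : c m = 0 := by
  have hr0 : r ≠ 0 := ne_zero_of_dvd_ne_zero hD hr
  have hrQ : (0 : ℚ) < r := by exact_mod_cast Nat.pos_of_ne_zero hr0
  obtain ⟨R, -, hR, hq⟩ := hc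
  obtain ⟨N, hN, a, ha, ha0⟩ :=
    hf.holomorphic_off_infinity R (notMem_Gamma0_of_dvd_lower_right hr hr1 hR)
  have hcoeff := congrFun ((hq.slash_of_mul_diag hr0).unique hr0 hN.ne' (ha.const_mul _)) (m / r)
  rwa [div_mul_cancel₀ _ hrQ.ne', ha0 _ (div_neg_of_neg_of_pos hm hrQ), mul_zero] at hcoeff

end Slash

/-! ### The induced form -/

section Induced

variable {K : Type*} [Field K] [NumberField K] [StarRing K]
variable {V : Type*} [AddCommGroup V] [Module K V]
variable {h : V →ₗ[K] V →ₛₗ[starRingEnd K] K} {L : AddSubgroup V}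
variable {D n : ℕ} {b : Module.Basis (Fin n) K V}
  {θ : DiscGroup h L ≃+ (∀ i : PrimeIdx D n, ZMod (i.1 : ℕ))}
  {ψ : ∀ i : PrimeIdx D n, AddChar (ZMod (i.1 : ℕ)) ℂ} {f : ℍ → ℂ}

lemma weilRep_T_pow_inv (hθ : IsDiagonalization b θ ψ) (hodd : Odd D) (j : ℕ)
    (φ : DiscGroup h L → ℂ) (μ : DiscGroup h L) :
    weilRep hθ hodd (ModularGroup.T ^ j)⁻¹ φ μ = e (j * discQuad μ) * φ μ := by
  have hT : ∀ φ, e (discQuad μ) * φ μ = weilRep hθ hodd ModularGroup.T⁻¹ φ μ := fun φ => by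
    have hTT := weilRep_T hθ hodd (weilRep hθ hodd ModularGroup.T⁻¹ φ) μ
    rw [← Module.End.mul_apply, ← map_mul, mul_inv_cancel, map_one, Module.End.one_apply,
      e_neg] at hTT
    rw [hTT, mul_inv_cancel_left₀ (e_ne_zero _)]
  rw [e_natCast_mul]
  induction j generalizing φ with
  | zero => simp
  | succ j ih =>
    rw [pow_succ', mul_inv_rev, map_mul, Module.End.mul_apply, ih, ← hT, pow_succ, mul_assoc]

lemma rOf_dvd_one_iff (hD : Squarefree D)
    (θ : DiscGroup h L ≃+ (∀ i : PrimeIdx D n, ZMod (i.1 : ℕ))) (μ : DiscGroup h L) :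
    rOf D μ ∣ 1 ↔ μ = 0 := by
  have hp : ∀ p : D.primeFactors, ¬ (p : ℕ) ∣ 1 := fun p =>
    (Nat.prime_of_mem_primeFactors p.2).not_dvd_one
  rw [rOf_dvd_iff hD θ, ← map_eq_zero_iff θ θ.injective, funext_iff, Prod.forall]
  exact forall_congr' fun p => or_iff_right (hp p)

lemma gammaDiv_one : gammaDiv h D b 1 = 1 :=
  Finset.prod_eq_one fun p _ => absurd p.2 (by simp)

lemma weilRep_inv_phiZero_of_dvd_lower_left (hθ : IsDiagonalization b θ ψ) (hodd : Odd D)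
    (hn : 2 ≤ n) (hD : Squarefree D) {γ : SL(2, ℤ)} (hγ : (D : ℤ) ∣ γ 1 0) :
    weilRep hθ hodd γ⁻¹ phiZero = chi n D (γ 0 0) • phiZero := by
  classical
  ext μ
  rw [weilRep_inv_phiZero hθ hodd hn hD (one_mul D).symm γ hγ (by simp), chi_one, one_mul,
    gammaDiv_one]
  simp [rOf_dvd_one_iff hD θ, phiZero, Pi.single_apply]

lemma slash_mul_weilRep_of_mem_Gamma0 (hθ : IsDiagonalization b θ ψ) (hodd : Odd D) (hn : 2 ≤ n)
    (hD : Squarefree D) (hf : IsWeaklyHolomorphicForm D n f) (τ : ℍ) (μ : DiscGroup h L)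
    {γ : SL(2, ℤ)} (hγ : γ ∈ CongruenceSubgroup.Gamma0 D) (g : SL(2, ℤ)) :
    (f ∣[2 - (n : ℤ)] (γ * g)) τ * weilRep hθ hodd (γ * g)⁻¹ phiZero μ =
      (f ∣[2 - (n : ℤ)] g) τ * weilRep hθ hodd g⁻¹ phiZero μ := by
  have hdvd := mem_Gamma0_iff_dvd.mp hγ
  rw [SlashAction.slash_mul, hf.slash_eq γ hγ, ModularForm.SL_smul_slash, mul_inv_rev, map_mul,
    Module.End.mul_apply, weilRep_inv_phiZero_of_dvd_lower_left hθ hodd hn hD hdvd, map_smul,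
    Pi.smul_apply, Pi.smul_apply, smul_eq_mul, smul_eq_mul]
  linear_combination ((f ∣[2 - (n : ℤ)] g) τ * weilRep hθ hodd g⁻¹ phiZero μ) *
    chi_mul_chi_of_dvd_lower_left (n := n) hdvd

lemma slash_mul_weilRep_mul_T_pow (hθ : IsDiagonalization b θ ψ) (hodd : Odd D) (k : ℤ)
    (R : SL(2, ℤ)) (j : ℕ) (φ : DiscGroup h L → ℂ) (τ : ℍ) (μ : DiscGroup h L) :
    (f ∣[k] (R * ModularGroup.T ^ j)) τ * weilRep hθ hodd (R * ModularGroup.T ^ j)⁻¹ φ μ =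
      e (j * discQuad μ) * ((f ∣[k] R) ((j : ℝ) +ᵥ τ) * weilRep hθ hodd R⁻¹ φ μ) := by
  rw [mul_inv_rev, map_mul, Module.End.mul_apply, weilRep_T_pow_inv, slash_mul_T_pow,
    mul_left_comm]

lemma exists_mul_discQuad_eq (hθ : IsDiagonalization b θ ψ) (hD : Squarefree D) {r : ℕ}
    {μ : DiscGroup h L} (hμ : rOf D μ ∣ r) : ∃ j : ℤ, r * discQuad μ = j := by
  rw [← e_ratCast_eq_one_iff]
  push_cast
  rw [e_natCast_mul, hθ.quad, ← Finset.prod_pow]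
  refine Finset.prod_eq_one fun ⟨p, j⟩ _ => ?_
  rcases (rOf_dvd_iff hD θ r μ).mp hμ p with hp | hp
  · rw [← AddChar.map_nsmul_eq_pow, nsmul_eq_mul, (ZMod.natCast_eq_zero_iff _ _).mpr hp, zero_mul,
      AddChar.map_zero_eq_one]
  · rw [hp j]
    simp

lemma inducedForm_eq_sum_divisors (hθ : IsDiagonalization b θ ψ) (hodd : Odd D) (hn : 2 ≤ n)
    (hD : Squarefree D) (hf : IsWeaklyHolomorphicForm D n f) {R : Finset SL(2, ℤ)}
    (hR : Subgroup.IsComplement (CongruenceSubgroup.Gamma0 D : Set SL(2, ℤ)) (R : Set SL(2, ℤ)))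
    {Q : ℕ → SL(2, ℤ)}
    (hQ : ∀ r ∈ D.divisors, ((D / r : ℕ) : ℤ) ∣ Q r 1 0 ∧ (r : ℤ) ∣ Q r 1 1) (τ : ℍ)
    (μ : DiscGroup h L) :
    inducedForm n (weilRep hθ hodd) f R τ μ = ∑ r ∈ D.divisors, ∑ j ∈ Finset.range r,
      e (j * discQuad μ) *
        ((f ∣[2 - (n : ℤ)] Q r) ((j : ℝ) +ᵥ τ) * weilRep hθ hodd (Q r)⁻¹ phiZero μ) := by
  simp only [← slash_mul_weilRep_mul_T_pow]
  rw [← Finset.sum_sigma D.divisors Finset.range fun i =>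
      (f ∣[2 - (n : ℤ)] (Q i.1 * ModularGroup.T ^ i.2)) τ *
        weilRep hθ hodd (Q i.1 * ModularGroup.T ^ i.2)⁻¹ phiZero μ,
    ← sum_eq_sum_of_isComplement hR
      (F := fun g => (f ∣[2 - (n : ℤ)] g) τ * weilRep hθ hodd g⁻¹ phiZero μ)
      (fun γ hγ g => slash_mul_weilRep_of_mem_Gamma0 hθ hodd hn hD hf τ μ hγ g)
      (existsUnique_mul_inv_mul_T_pow_mem_Gamma0 hD hQ), inducedForm, Finset.sum_apply]
  rfl

open Classical in
lemma isQExpansion_sum_translates (hθ : IsDiagonalization b θ ψ) (hodd : Odd D) (hn : 2 ≤ n)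
    (hD : Squarefree D) {r : ℕ} (hr : r ∣ D) {R : SL(2, ℤ)} (hs : ((D / r : ℕ) : ℤ) ∣ R 1 0)
    (hr' : (r : ℤ) ∣ R 1 1) {c : ℚ → ℂ}
    (hc : IsQExpansion 1 (fun τ => chi n r (R 0 1) * chi n (D / r) (R 0 0) *
      slash (2 - (n : ℤ)) f ((R : Matrix (Fin 2) (Fin 2) ℤ) * !![(r : ℤ), 0; 0, 1]) τ) c)
    (μ : DiscGroup h L) :
    IsQExpansion r (fun τ => ∑ j ∈ Finset.range r, e (j * discQuad μ) *
        ((f ∣[2 - (n : ℤ)] R) ((j : ℝ) +ᵥ τ) * weilRep hθ hodd R⁻¹ phiZero μ))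
      (fun m => if ∃ j : ℤ, m + discQuad μ = j then
        if rOf D μ ∣ r then gammaDiv h D b r * c (m * r) else 0 else 0) := by
  have hr0 : r ≠ 0 := ne_zero_of_dvd_ne_zero hD.ne_zero hr
  have hrC : (r : ℂ) ≠ 0 := by exact_mod_cast hr0
  rw [weilRep_inv_phiZero hθ hodd hn hD (Nat.mul_div_cancel' hr).symm R hs hr' μ]
  split_ifs with hμ
  · have hexp := ((hc.slash_of_mul_diag hr0).const_mul
      ((r : ℂ)⁻¹ * gammaDiv h D b r)).sum_translates (exists_mul_discQuad_eq hθ hD hμ)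
    convert! hexp using 2
    · refine Finset.sum_congr rfl fun j _ => ?_
      rw [← inv_mul_rpow_eq_inv_sqrt_pow hr0 n]
      ring
    · rw [← mul_assoc, mul_inv_cancel_left₀ hrC]
  · simp only [mul_zero, Finset.sum_const_zero, ite_self]
    exact IsQExpansion.zero r

open Classical in
lemma isQExpansion_inducedForm (hθ : IsDiagonalization b θ ψ) (hodd : Odd D) (hn : 2 ≤ n)
    (hD : Squarefree D) (hf : IsWeaklyHolomorphicForm D n f) {cAt : ℕ → ℚ → ℂ}
    (hcAt : ∀ r ∈ D.divisors, IsQExpansionAtCusp D n f r (cAt r)) {R : Finset SL(2, ℤ)}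
    (hR : Subgroup.IsComplement (CongruenceSubgroup.Gamma0 D : Set SL(2, ℤ)) (R : Set SL(2, ℤ)))
    (μ : DiscGroup h L) :
    IsQExpansion D (fun τ => inducedForm n (weilRep hθ hodd) f R τ μ)
      (fun m => if ∃ j : ℤ, m + discQuad μ = j then
        ∑ r ∈ D.divisors with rOf D μ ∣ r, gammaDiv h D b r * cAt r (m * r) else 0) := by
  choose! Q hs hr hQ using hcAt
  simp only [inducedForm_eq_sum_divisors hθ hodd hn hD hf hR (fun r hrD => ⟨hs r hrD, hr r hrD⟩)]
  convert! IsQExpansion.sum D.divisors fun r hrD =>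
    (isQExpansion_sum_translates hθ hodd hn hD (Nat.dvd_of_mem_divisors hrD) (hs r hrD) (hr r hrD)
      (hQ r hrD) μ).of_dvd (Nat.dvd_of_mem_divisors hrD) using 2 with m
  split_ifs
  · rw [Finset.sum_filter]
  · rw [Finset.sum_const_zero]

open Classical in
lemma sum_gammaDiv_mul_of_neg (hθ : IsDiagonalization b θ ψ) (hD : Squarefree D)
    (hf : IsWeaklyHolomorphicForm D n f) {c : ℚ → ℂ} (hc : IsQExpansion 1 f c) {cAt : ℕ → ℚ → ℂ}
    (hcAt : ∀ r ∈ D.divisors, IsQExpansionAtCusp D n f r (cAt r)) (μ : DiscGroup h L) {m : ℚ}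
    (hm : m < 0) :
    (if ∃ j : ℤ, m + discQuad μ = j then
      ∑ r ∈ D.divisors with rOf D μ ∣ r, gammaDiv h D b r * cAt r (m * r) else 0) =
      if μ = 0 then c m else 0 := by
  have hzero : ∀ r ∈ D.divisors, r ≠ 1 → gammaDiv h D b r * cAt r (m * r) = 0 := fun r hr hr1 => by
    rw [(hcAt r hr).eq_zero_of_neg hf hD.ne_zero (Nat.dvd_of_mem_divisors hr) hr1
      (mul_neg_of_neg_of_pos hm (by exact_mod_cast Nat.pos_of_mem_divisors hr)), mul_zero]
  have hone : 1 ∈ D.divisors := Nat.one_mem_divisors.mpr hD.ne_zero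
  have hsum : ∑ r ∈ D.divisors with rOf D μ ∣ r, gammaDiv h D b r * cAt r (m * r) =
      if μ = 0 then c m else 0 := by
    rw [Finset.sum_filter, Finset.sum_eq_single_of_mem 1 hone fun r hr hr1 => by
      rw [hzero r hr hr1, ite_self], gammaDiv_one, (hcAt 1 hone).eq_of_one hf hc, one_mul,
      Nat.cast_one, mul_one]
    simp only [rOf_dvd_one_iff hD θ]
  rw [hsum, ite_eq_left_iff]
  intro hint
  split_ifs with hμ
  · by_contra hne
    obtain ⟨i, hi⟩ := hc.support m (Ne.symm hne)
    obtain ⟨k, hk⟩ := exists_mul_discQuad_eq hθ hD ((rOf_dvd_one_iff hD θ μ).mpr hμ)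
    refine hint ⟨i + k, ?_⟩
    push_cast at hi hk ⊢
    rw [← hi, ← hk]
    ring
  · rfl

end Induced

end PromotedForm

end

open Classical in
open PromotedForm in
theorem mainTheorem7_general
    {K : Type*} [Field K] [NumberField K] [StarRing K]
    (ι : K →+* ℂ) (hι : ∀ x : K, ι (star x) = starRingEnd ℂ (ι x))
    (hK : Module.finrank ℚ K = 2)
    (D : ℕ) (hodd : Odd D) (hD : NumberField.discr K = -(D : ℤ))
    (n : ℕ) (hn : 2 ≤ n)
    {V : Type*} [AddCommGroup V] [Module K V]
    (h : V →ₗ[K] V →ₛₗ[starRingEnd K] K)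
    (hherm : ∀ x y : V, h y x = star (h x y))
    (b : Module.Basis (Fin n) K V)
    (L : AddSubgroup V) (hL : IsSelfDualLattice h L) :
    ∃ ω : Representation ℂ SL(2, ℤ) (DiscGroup h L → ℂ),
      IsWeilRepresentation ω ∧ (∀ ω', IsWeilRepresentation ω' → ω' = ω) ∧
      ∀ f : ℍ → ℂ, IsWeaklyHolomorphicForm D n f →
      ∀ c : ℚ → ℂ, IsQExpansion 1 f c →
      ∀ cAt : ℕ → ℚ → ℂ, (∀ r ∈ D.divisors, IsQExpansionAtCusp D n f r (cAt r)) →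
      ∀ R : Finset SL(2, ℤ),
        Subgroup.IsComplement (CongruenceSubgroup.Gamma0 D : Set SL(2, ℤ)) (R : Set SL(2, ℤ)) →
      (∃ N : ℕ, 0 < N ∧ ∃ ct : ℚ → DiscGroup h L → ℂ,
        ∀ μ, IsQExpansion N (fun τ => inducedForm n ω f R τ μ) (fun m => ct m μ)) ∧
      ∀ (N : ℕ) (ct : ℚ → DiscGroup h L → ℂ), 0 < N →
        (∀ μ, IsQExpansion N (fun τ => inducedForm n ω f R τ μ) (fun m => ct m μ)) →
        (∀ (m : ℚ) (μ : DiscGroup h L),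
          ct m μ = if ∃ j : ℤ, m + discQuad μ = j then
            ∑ r ∈ D.divisors with rOf D μ ∣ r, gammaDiv h D b r * cAt r (m * r) else 0) ∧
        (∀ (m : ℚ) (μ : DiscGroup h L), m < 0 → ct m μ = if μ = 0 then c m else 0) ∧
        (∀ μ : DiscGroup h L, (∃ j : ℤ, discQuad μ = j) →
          ct 0 μ = ∑ r ∈ D.divisors with rOf D μ ∣ r, gammaDiv h D b r * cAt r 0) := by
  obtain ⟨δ, hδ⟩ := exists_isDifferentGenerator ι hι hK hD
  have hsq : Squarefree D := hδ.squarefree hodd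
  obtain ⟨θ, ψ, hθ⟩ := exists_isDiagonalization b hherm hL hδ hodd hK
  have hω := isWeilRepresentation_weilRep hθ hodd
  refine ⟨weilRep hθ hodd, hω, fun ω' hω' => hω.unique hω', fun f hf c hc cAt hcAt R hR => ?_⟩
  have hexp := isQExpansion_inducedForm hθ hodd hn hsq hf hcAt hR
  refine ⟨⟨D, hodd.pos, _, hexp⟩, fun N ct hN hct => ?_⟩
  have hcoeff : ∀ m μ, ct m μ = if ∃ j : ℤ, m + discQuad μ = j then
      ∑ r ∈ D.divisors with rOf D μ ∣ r, gammaDiv h D b r * cAt r (m * r) else 0 := fun m μ =>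
    congrFun ((hct μ).unique hN.ne' hodd.pos.ne' (hexp μ)) m
  refine ⟨hcoeff, fun m μ hm => ?_, fun μ hμ => ?_⟩
  · rw [hcoeff, sum_gammaDiv_mul_of_neg hθ hsq hf hc hcAt μ hm]
  · rw [hcoeff, if_pos (by simpa only [zero_add] using hμ)]
    simp only [zero_mul]

open Classical in
open PromotedForm in
theorem mainTheorem7
    {K : Type*} [Field K] [NumberField K] [StarRing K]
    (ι : K →+* ℂ) (hι : ∀ x : K, ι (star x) = starRingEnd ℂ (ι x))
    (hK : Module.finrank ℚ K = 2)
    (D : ℕ) (hodd : Odd D) (hD : NumberField.discr K = -(D : ℤ))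
    (n : ℕ) (hn : 3 ≤ n)
    {V : Type*} [AddCommGroup V] [Module K V]
    (h : V →ₗ[K] V →ₛₗ[starRingEnd K] K)
    (hherm : ∀ x y : V, h y x = star (h x y))
    (hsig : HasSignature ι h (n - 1) 1)
    (b : Module.Basis (Fin n) K V)
    (L : AddSubgroup V) (hL : IsSelfDualLattice h L) :
    ∃ ω : Representation ℂ SL(2, ℤ) (DiscGroup h L → ℂ),
      IsWeilRepresentation ω ∧ (∀ ω', IsWeilRepresentation ω' → ω' = ω) ∧
      ∀ f : ℍ → ℂ, IsWeaklyHolomorphicForm D n f →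
      ∀ c : ℚ → ℂ, IsQExpansion 1 f c →
      ∀ cAt : ℕ → ℚ → ℂ, (∀ r ∈ D.divisors, IsQExpansionAtCusp D n f r (cAt r)) →
      ∀ R : Finset SL(2, ℤ),
        Subgroup.IsComplement (CongruenceSubgroup.Gamma0 D : Set SL(2, ℤ)) (R : Set SL(2, ℤ)) →
      (∃ N : ℕ, 0 < N ∧ ∃ ct : ℚ → DiscGroup h L → ℂ,
        ∀ μ, IsQExpansion N (fun τ => inducedForm n ω f R τ μ) (fun m => ct m μ)) ∧
      ∀ (N : ℕ) (ct : ℚ → DiscGroup h L → ℂ), 0 < N →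
        (∀ μ, IsQExpansion N (fun τ => inducedForm n ω f R τ μ) (fun m => ct m μ)) →
        (∀ (m : ℚ) (μ : DiscGroup h L),
          ct m μ = if ∃ j : ℤ, m + discQuad μ = j then
            ∑ r ∈ D.divisors with rOf D μ ∣ r, gammaDiv h D b r * cAt r (m * r) else 0) ∧
        (∀ (m : ℚ) (μ : DiscGroup h L), m < 0 → ct m μ = if μ = 0 then c m else 0) ∧
        (∀ μ : DiscGroup h L, (∃ j : ℤ, discQuad μ = j) →
          ct 0 μ = ∑ r ∈ D.divisors with rOf D μ ∣ r, gammaDiv h D b r * cAt r 0) :=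
  mainTheorem7_general ι hι hK D hodd hD n (by omega) h hherm b L hL
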